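/- **Setting.** Let $n\ge 1$, let $\Omega\subset\mathbb R^l$ be open and bounded, let $\sigma_u,\sigma_l,\sigma_\beta,\gamma>0$, $y_m,y_{d,1},\dots,y_{d,n}\in L^2(\Omega)$ and $0<a_i<b_i$ $(i=1,\dots,n)$. Let $q\in(1,2)$, $1/q+1/q'=1$, and $u_m,u_a,u_b\in L^{q'}(\Omega)$ such that $U_{ad}=\{v\in L^2(\Omega): u_a\le v\le u_b \text{ a.e.}\}$ is nonempty. Let $A:H_0^1(\Omega)\to H^{-1}(\Omega)$, $B:L^2(\Omega)\to H^{-1}(\Omega)$, $C_i:H^1_0(\Omega)\to L^2(\Omega)$ be bounded and linear, where $A$ is bijective and $B$ extends to a bounded linear operator $L^q(\Omega)\to H^{-1}(\Omega)$. Put $Q=\prod_i[b_i^{-1},a_i^{-1}]$ and, for $\beta\in(0,\infty)^n$, $$F(\beta,y,u)=\tfrac12\|y-y_m\|_{L^2}^2+\tfrac{\sigma_u}2\|u-u_m\|_{L^2}^2+\tfrac{\sigma_\beta}2\sum_{i=1}^n\beta_i^{-2},\qquad f(\beta,y,u)=\sum_{i=1}^n\tfrac1{2\beta_i}\|C_iy-y_{d,i}\|_{L^2}^2+\tfrac{\sigma_l}2\|u\|_{L^2}^2,$$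 $\varphi(\beta)=\inf\{f(\beta,y,u): Ay=Bu,\ u\in U_{ad}\}$. Let $T\subset Q$ be a non-degenerate $n$-simplex, $\xi_T$ the affine function that agrees with $\varphi$ at the vertices of $T$, and let $K\in\mathbb R^{(n+1)\times n}$, $b_T\in\mathbb R^{n+1}$ be such that $T=\{\beta: K\beta\le b_T\}$. Problem OVRP$(T,\gamma)$ with $P=\mathrm{Id}$ is $$\min_{\beta,y,u}\ F(\beta,y,u)+\gamma\bigl(f(\beta,y,u)-\xi_T(\beta)\bigr)\quad\text{s.t.}\quad \beta\in T,\ Ay-Bu=0,\ u\in U_{ad}.$$ Its KKT system, with multipliers $z\in\mathbb R^{n+1}$, $p\in H_0^1(\Omega)$, $\nu\in L^2(\Omega)$, is $$F'_\beta+\gamma(f'_\beta-\xi_T')+K^\top z=0,\quad F'_y+\gamma f'_y+A^*p=0,\quad F'_u+\gamma f'_u-B^*p+\nu=0,\quad Ay-Bu=0,$$ $$z\ge0,\quad K\beta\le b_T,\quad z^\top(K\beta-b_T)=0,\quad u\in U_{ad},\quad (\nu,v-u)_{L^2}\le0\ \ \forall v\in U_{ad}.$$ Let $\hat\sigma=\sigma_u+\gamma\sigma_l$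 and $$h(\beta,y)=\tfrac12\|y-y_m\|_{L^2}^2+\gamma\Bigl(\sum_{i}\tfrac1{2\beta_i}\|C_iy-y_{d,i}\|^2_{L^2}-\xi_T(\beta)\Bigr)+\tfrac{\sigma_\beta}2\sum_i\beta_i^{-2}.$$ On $D_W=(0,\infty)^n\times H_0^1(\Omega)\times L^2(\Omega)\times\mathbb R^{n+1}\times H_0^1(\Omega)$ define $$W(\beta,y,u,z,p)=\begin{pmatrix}h'_\beta(\beta,y)+K^\top z\\ h'_y(\beta,y)+A^*p\\ u-\min(\max((B^*p+\sigma_uu_m)/\hat\sigma,u_a),u_b)\\ \max(K\beta-b_T,-z)\\ Ay-Bu\end{pmatrix}$$ and the linear operator $$W'(\beta,y,u,z,p)=\begin{bmatrix}h''_{\beta\beta}&h''_{\beta y}&0&K^\top&0\\ h''_{y\beta}&h''_{yy}&0&0&A^*\\0&0&\mathrm{Id}&0&-\hat\sigma^{-1}\chi_{\mathcal A_3}B^*\\ \chi_{\mathcal A_1}K&0&0&-\chi_{\mathcal A_2}&0\\0&A&-B&0&0\end{bmatrix},$$ where $\mathcal A_1=\{j:(K\beta-b_T)_j\ge -z_j\}$,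 $\mathcal A_2=\{j:(K\beta-b_T)_j<-z_j\}$, $\mathcal A_3=\{u_a\le(B^*p+\sigma_uu_m)/\hat\sigma\le u_b\}\subset\Omega$, and $\chi$ denotes multiplication by the characteristic function. The semismooth Newton method starts from a point $x_0$; in step $i$ it stops if $W(x_i)=0$, and otherwise it solves $W'(x_i)s_i=-W(x_i)$ and sets $x_{i+1}=x_i+s_i$. **Theorem.** OVRP$(T,\gamma)$ has a unique global solution $(\bar\beta,\bar y,\bar u)$, and there are unique multipliers $(\bar z,\bar p,\bar\nu)$ that satisfy the KKT system at this solution. The point $\bar x=(\bar\beta,\bar y,\bar u,\bar z,\bar p)$ has a neighborhood such that for every initial value $x_0$ in it the semismooth Newton method is well defined (all iterates lie in $D_W$, and each Newton equation that has to be solved has exactly one solution), and it either terminates in some step $i$ with $x_i=\bar x$ or generates an infinite sequence that converges $q$-superlinearly to $\bar x$ in $\mathbb R^n\times H^1_0(\Omega)\times L^2(\Omega)\times\mathbb R^{n+1}\times H^1_0(\Omega)$, i.e. $x_i\to\bar x$ and $\|x_{i+1}-\bar x\|=o(\|x_i-\bar x\|)$. -/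

import Mathlib

open MeasureTheory Filter Topology Asymptotics
open scoped ENNReal Matrix ContDiff

noncomputable section

namespace ParamId

/-! ### Function spaces on a set `Ω ⊆ ℝˡ` -/

/-- The space `ℝᵏ` with the Euclidean norm. -/
abbrev Euc (k : ℕ) : Type := EuclideanSpace ℝ (Fin k)

variable {l : ℕ}

/-- The real space `L²(Ω)`. -/
abbrev L2 (Ω : Set (Euc l)) : Type := Lp ℝ 2 (volume.restrict Ω)

/-- The space `L²(Ω; ℝˡ)` of square integrable vector fields. -/
abbrev L2Vec (Ω : Set (Euc l)) : Type := Lp (Euc l) 2 (volume.restrict Ω)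

/-- `ψ ∈ C_c^∞(Ω)`. -/
structure IsTestFunction (Ω : Set (Euc l)) (ψ : Euc l → ℝ) : Prop where
  smooth : ContDiff ℝ ∞ ψ
  compact : HasCompactSupport ψ
  support : tsupport ψ ⊆ Ω

/-- `g ∈ L²(Ω; ℝˡ)` is the weak gradient of `v ∈ L²(Ω)`: for every test function `ψ` and every
direction `e`, `∫_Ω v ∂ₑψ = - ∫_Ω (g · e) ψ`. -/
def HasWeakGradient {Ω : Set (Euc l)} (v : L2 Ω) (g : L2Vec Ω) : Prop :=
  ∀ ψ : Euc l → ℝ, IsTestFunction Ω ψ → ∀ e : Euc l,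
    ∫ x in Ω, v x * fderiv ℝ ψ x e = - ∫ x in Ω, inner ℝ (g x) e * ψ x

theorem IsTestFunction.memLp_deriv {Ω : Set (Euc l)} {ψ : Euc l → ℝ} (h : IsTestFunction Ω ψ)
    (e : Euc l) : MemLp (fun x => fderiv ℝ ψ x e) 2 (volume.restrict Ω) := by
  have hc : Continuous (fun x => fderiv ℝ ψ x e) :=
    (h.smooth.continuous_fderiv (by simp)).clm_apply continuous_const
  have hs : HasCompactSupport (fun x => fderiv ℝ ψ x e) := h.compact.fderiv_apply ℝ e
  exact (hc.memLp_of_hasCompactSupport hs).restrict Ω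

theorem IsTestFunction.memLp_smul {Ω : Set (Euc l)} {ψ : Euc l → ℝ} (h : IsTestFunction Ω ψ)
    (e : Euc l) : MemLp (fun x => ψ x • e) 2 (volume.restrict Ω) := by
  have hc : Continuous (fun x => ψ x • e) := h.smooth.continuous.smul continuous_const
  have hs : HasCompactSupport (fun x => ψ x • e) := h.compact.smul_right
  exact (hc.memLp_of_hasCompactSupport hs).restrict Ω

theorem hasWeakGradient_iff {Ω : Set (Euc l)} (v : L2 Ω) (g : L2Vec Ω) :
    HasWeakGradient v g ↔ ∀ (ψ : Euc l → ℝ) (h : IsTestFunction Ω ψ) (e : Euc l),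
      inner ℝ ((h.memLp_deriv e).toLp) v + inner ℝ ((h.memLp_smul e).toLp) g = 0 := by
  have key : ∀ (ψ : Euc l → ℝ) (h : IsTestFunction Ω ψ) (e : Euc l),
      inner ℝ ((h.memLp_deriv e).toLp) v = ∫ x in Ω, v x * fderiv ℝ ψ x e ∧
      inner ℝ ((h.memLp_smul e).toLp) g = ∫ x in Ω, inner ℝ (g x) e * ψ x := by
    intro ψ h e
    rw [L2.inner_def, L2.inner_def]
    constructor
    · refine integral_congr_ae ?_
      filter_upwards [(h.memLp_deriv e).coeFn_toLp] with x hx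
      rw [hx]; simp
    · refine integral_congr_ae ?_
      filter_upwards [(h.memLp_smul e).coeFn_toLp] with x hx
      rw [hx, real_inner_smul_left, real_inner_comm, mul_comm]
  constructor
  · intro H ψ h e
    rw [(key ψ h e).1, (key ψ h e).2, H ψ h e]; ring
  · intro H ψ h e
    have := H ψ h e
    rw [(key ψ h e).1, (key ψ h e).2] at this
    linarith

/-- The Sobolev space `W^{1,2}(Ω)`: a weakly differentiable function `v` is stored together with
its weak gradient as the pair `(v, ∇v)`, and the norm is
`(‖v‖²_{L²} + ‖∇v‖²_{L²})^{1/2}`. -/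
def W12 (Ω : Set (Euc l)) : Submodule ℝ (WithLp 2 (L2 Ω × L2Vec Ω)) where
  carrier := {w | HasWeakGradient w.fst w.snd}
  zero_mem' := by
    rw [Set.mem_ofPred_eq, hasWeakGradient_iff]
    intro ψ h e
    simp
  add_mem' := by
    intro a b ha hb
    rw [Set.mem_ofPred_eq, hasWeakGradient_iff] at *
    intro ψ h e
    have h1 := ha ψ h e
    have h2 := hb ψ h e
    rw [WithLp.add_fst, WithLp.add_snd, inner_add_right, inner_add_right]
    linarith
  smul_mem' := by
    intro c a ha
    rw [Set.mem_ofPred_eq, hasWeakGradient_iff] at *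
    intro ψ h e
    have h1 := ha ψ h e
    rw [WithLp.smul_fst, WithLp.smul_snd, inner_smul_right, inner_smul_right, ← mul_add, h1,
      mul_zero]

/-- The subspace `C_c^∞(Ω)` of `W^{1,2}(Ω)`. -/
def testSubspace (Ω : Set (Euc l)) : Submodule ℝ (W12 Ω) where
  carrier := {w | ∃ ψ : Euc l → ℝ, IsTestFunction Ω ψ ∧
    ∀ᵐ x ∂(volume.restrict Ω), w.1.fst x = ψ x}
  zero_mem' := by
    refine ⟨0, ⟨contDiff_const, HasCompactSupport.zero, by simp⟩, ?_⟩
    filter_upwards [Lp.coeFn_zero ℝ 2 (volume.restrict Ω)] with x hx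
    simpa using hx
  add_mem' := by
    rintro a b ⟨ψ, h, hw⟩ ⟨ψ', h', hw'⟩
    refine ⟨ψ + ψ', ⟨h.smooth.add h'.smooth, h.compact.add h'.compact,
      (tsupport_add ψ ψ').trans (Set.union_subset h.support h'.support)⟩, ?_⟩
    filter_upwards [hw, hw', Lp.coeFn_add a.1.fst b.1.fst] with x h1 h2 h3
    simp only [Submodule.coe_add, WithLp.add_fst, h3, Pi.add_apply, h1, h2]
  smul_mem' := by
    rintro c a ⟨ψ, h, hw⟩
    refine ⟨c • ψ, ⟨h.smooth.const_smul c, h.compact.smul_left (f := fun _ => c),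
      (tsupport_smul_subset_right (fun _ => c) ψ).trans h.support⟩, ?_⟩
    filter_upwards [hw, Lp.coeFn_smul c a.1.fst] with x h1 h2
    simp only [Submodule.coe_smul, WithLp.smul_fst, h2, Pi.smul_apply, h1]

theorem isClosed_W12 (Ω : Set (Euc l)) :
    IsClosed (W12 Ω : Set (WithLp 2 (L2 Ω × L2Vec Ω))) := by
  have : (W12 Ω : Set (WithLp 2 (L2 Ω × L2Vec Ω))) =
      ⋂ (ψ : Euc l → ℝ) (h : IsTestFunction Ω ψ) (e : Euc l),
        {w | inner ℝ ((h.memLp_deriv e).toLp) w.fst + inner ℝ ((h.memLp_smul e).toLp) w.snd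
          = 0} := by
    ext w
    simp only [Set.mem_iInter, Set.mem_ofPred_eq]
    exact hasWeakGradient_iff w.fst w.snd
  rw [this]
  refine isClosed_iInter fun ψ => isClosed_iInter fun h => isClosed_iInter fun e => ?_
  refine isClosed_eq ?_ continuous_const
  have h1 : Continuous fun w : WithLp 2 (L2 Ω × L2Vec Ω) => w.fst :=
    continuous_fst.comp (WithLp.prod_continuous_ofLp 2 _ _)
  have h2 : Continuous fun w : WithLp 2 (L2 Ω × L2Vec Ω) => w.snd :=
    continuous_snd.comp (WithLp.prod_continuous_ofLp 2 _ _)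
  exact (continuous_const.inner h1).add (continuous_const.inner h2)

instance instCompleteSpaceW12 (Ω : Set (Euc l)) : CompleteSpace (W12 Ω) :=
  (isClosed_W12 Ω).completeSpace_coe

/-- `H₀¹(Ω)`, the closure of `C_c^∞(Ω)` in `W^{1,2}(Ω)`. -/
def H01 (Ω : Set (Euc l)) : Type := (testSubspace Ω).topologicalClosure

instance instNormedAddCommGroupH01 (Ω : Set (Euc l)) : NormedAddCommGroup (H01 Ω) :=
  inferInstanceAs (NormedAddCommGroup (testSubspace Ω).topologicalClosure)

instance instInnerProductSpaceH01 (Ω : Set (Euc l)) : InnerProductSpace ℝ (H01 Ω) :=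
  inferInstanceAs (InnerProductSpace ℝ (testSubspace Ω).topologicalClosure)

instance instCompleteSpaceH01 (Ω : Set (Euc l)) : CompleteSpace (H01 Ω) :=
  inferInstanceAs (CompleteSpace (testSubspace Ω).topologicalClosure)

/-- The embedding `H₀¹(Ω) → L²(Ω)`. -/
def H01.toL2 {Ω : Set (Euc l)} : H01 Ω →L[ℝ] L2 Ω :=
  (WithLp.fstL 2 ℝ (L2 Ω) (L2Vec Ω)).comp
    ((W12 Ω).subtypeL.comp (testSubspace Ω).topologicalClosure.subtypeL)

/-- `H⁻¹(Ω)`, the topological dual of `H₀¹(Ω)`. -/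
abbrev Hm1 (Ω : Set (Euc l)) : Type := StrongDual ℝ (H01 Ω)

/-! ### The parameter identification problem on a simplex -/

/-- The data of the penalty subproblem on a simplex. Signs, bijectivity of `A` and the like are not
part of the data. -/
structure Data (Ω : Set (Euc l)) (n : ℕ) where
  /-- weights of the objectives -/
  σu : ℝ
  σl : ℝ
  σβ : ℝ
  /-- the penalty parameter of the subproblem -/
  γ : ℝ
  /-- the measurements of the upper level -/
  ym : L2 Ω
  um : L2 Ω
  /-- the desired states of the lower level -/
  yd : Fin n → L2 Ω
  /-- bounds `lo i ≤ αᵢ ≤ hi i` of the original parameter `α = 1 / β` -/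
  lo : Fin n → ℝ
  hi : Fin n → ℝ
  /-- control bounds -/
  ua : L2 Ω
  ub : L2 Ω
  A : H01 Ω →L[ℝ] Hm1 Ω
  B : L2 Ω →L[ℝ] Hm1 Ω
  C : Fin n → H01 Ω →L[ℝ] L2 Ω
  /-- the `n + 1` affinely independent vertices of the simplex `T` -/
  vert : AffineBasis (Fin (n + 1)) ℝ (Euc n)
  /-- the description `T = {β | K β ≤ bT}` -/
  K : Matrix (Fin (n + 1)) (Fin n) ℝ
  bT : Fin (n + 1) → ℝ

namespace Data

variable {Ω : Set (Euc l)} {n : ℕ} (D : Data Ω n)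

/-- The adjoint `A* : H₀¹(Ω) → H⁻¹(Ω)` (with `H₀¹(Ω)` reflexive), `⟨A* p, y⟩ = ⟨A y, p⟩`. -/
def Aadj : H01 Ω →L[ℝ] Hm1 Ω := D.A.flip

/-- The adjoint `B* : H₀¹(Ω) → L²(Ω)` (with `L²(Ω)' = L²(Ω)`), `(B* p, v) = ⟨B v, p⟩`. -/
def Badj (p : H01 Ω) : L2 Ω := (InnerProductSpace.toDual ℝ (L2 Ω)).symm (D.B.flip p)

/-- The box `∏ᵢ [1 / hi i, 1 / lo i]` of admissible parameters `β`. -/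
def Q : Set (Euc n) := {β | ∀ i, (D.hi i)⁻¹ ≤ β i ∧ β i ≤ (D.lo i)⁻¹}

/-- The admissible controls. -/
def Uad : Set (L2 Ω) := {v | ∀ᵐ x ∂(volume.restrict Ω), D.ua x ≤ v x ∧ v x ≤ D.ub x}

/-- The upper-level objective. -/
def F (β : Euc n) (y : H01 Ω) (u : L2 Ω) : ℝ :=
  1 / 2 * ‖y.toL2 - D.ym‖ ^ 2 + D.σu / 2 * ‖u - D.um‖ ^ 2
    + D.σβ / 2 * ∑ i, (1 / β i) ^ 2

/-- The lower-level objective. -/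
def f (β : Euc n) (y : H01 Ω) (u : L2 Ω) : ℝ :=
  (∑ i, 1 / (2 * β i) * ‖D.C i y - D.yd i‖ ^ 2) + D.σl / 2 * ‖u‖ ^ 2

/-- The optimal-value function of the lower-level problem. -/
def φ (β : Euc n) : ℝ :=
  sInf {r | ∃ (y : H01 Ω) (u : L2 Ω), u ∈ D.Uad ∧ D.A y = D.B u ∧ r = D.f β y u}

/-- The simplex. -/
def T : Set (Euc n) := convexHull ℝ (Set.range D.vert)

/-- The affine function that interpolates `φ` in the vertices of `T`. -/
def ξ (β : Euc n) : ℝ := ∑ i, D.vert.coord i β * D.φ (D.vert i)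

/-- The feasible set of the penalty subproblem. -/
def Feasible (x : Euc n × H01 Ω × L2 Ω) : Prop :=
  x.1 ∈ D.T ∧ D.A x.2.1 - D.B x.2.2 = 0 ∧ x.2.2 ∈ D.Uad

/-- The objective of the penalty subproblem for a penalty function `P`. -/
def penaltyObjective (P : ℝ → ℝ) (x : Euc n × H01 Ω × L2 Ω) : ℝ :=
  D.F x.1 x.2.1 x.2.2 + D.γ * P (D.f x.1 x.2.1 x.2.2 - D.ξ x.1)

/-- `x = (β, y, u)` is a global solution of the penalty subproblem with penalty function `P`. -/
def IsGlobalSolution (P : ℝ → ℝ) (x : Euc n × H01 Ω × L2 Ω) : Prop :=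
  D.Feasible x ∧ ∀ x', D.Feasible x' → D.penaltyObjective P x ≤ D.penaltyObjective P x'

/-- `Kᵀ z`. -/
def KT (z : Euc (n + 1)) : Euc n := WithLp.toLp 2 (D.Kᵀ *ᵥ z.ofLp)

/-- `K β`. -/
def Kv (β : Euc n) : Euc (n + 1) := WithLp.toLp 2 (D.K *ᵥ β.ofLp)

/-- The KKT system of the penalty subproblem with `P = Id` at `x = (β, y, u)`, with multipliers
`m = (z, p, ν)`. Derivatives with respect to `β` and `u` are represented by gradients. -/
structure KKT (x : Euc n × H01 Ω × L2 Ω) (m : Euc (n + 1) × H01 Ω × L2 Ω) : Prop where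
  stat_β : gradient (fun β => D.F β x.2.1 x.2.2) x.1
    + D.γ • (gradient (fun β => D.f β x.2.1 x.2.2) x.1 - gradient D.ξ x.1) + D.KT m.1 = 0
  stat_y : fderiv ℝ (fun y => D.F x.1 y x.2.2) x.2.1
    + D.γ • fderiv ℝ (fun y => D.f x.1 y x.2.2) x.2.1 + D.Aadj m.2.1 = 0
  stat_u : gradient (fun u => D.F x.1 x.2.1 u) x.2.2
    + D.γ • gradient (fun u => D.f x.1 x.2.1 u) x.2.2 - D.Badj m.2.1 + m.2.2 = 0
  state : D.A x.2.1 - D.B x.2.2 = 0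
  sign_z : ∀ j, 0 ≤ m.1 j
  ineq : ∀ j, D.Kv x.1 j ≤ D.bT j
  compl : ∑ j, m.1 j * (D.Kv x.1 j - D.bT j) = 0
  control : x.2.2 ∈ D.Uad
  normal : ∀ v ∈ D.Uad, inner ℝ m.2.2 (v - x.2.2) ≤ 0

/-! ### The nonsmooth reformulation and the semismooth Newton method -/

/-- The part of the objective that does not depend on the control. -/
def h (β : Euc n) (y : H01 Ω) : ℝ :=
  1 / 2 * ‖y.toL2 - D.ym‖ ^ 2
    + D.γ * ((∑ i, 1 / (2 * β i) * ‖D.C i y - D.yd i‖ ^ 2) - D.ξ β)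
    + D.σβ / 2 * ∑ i, (1 / β i) ^ 2

/-- `h'_β`, as a gradient. -/
def hβ (β : Euc n) (y : H01 Ω) : Euc n := gradient (fun β' => D.h β' y) β

/-- `h'_y`. -/
def hy (β : Euc n) (y : H01 Ω) : Hm1 Ω := fderiv ℝ (fun y' => D.h β y') y

/-- `h''_ββ`. -/
def hββ (β : Euc n) (y : H01 Ω) : Euc n →L[ℝ] Euc n := fderiv ℝ (fun β' => D.hβ β' y) β

/-- `h''_βy`. -/
def hβy (β : Euc n) (y : H01 Ω) : H01 Ω →L[ℝ] Euc n := fderiv ℝ (fun y' => D.hβ β y') y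

/-- `h''_yβ`. -/
def hyβ (β : Euc n) (y : H01 Ω) : Euc n →L[ℝ] Hm1 Ω := fderiv ℝ (fun β' => D.hy β' y) β

/-- `h''_yy`. -/
def hyy (β : Euc n) (y : H01 Ω) : H01 Ω →L[ℝ] Hm1 Ω := fderiv ℝ (fun y' => D.hy β y') y

/-- `σ̂ = σ_u + γ σ_l`. -/
def σhat : ℝ := D.σu + D.γ * D.σl

/-- The argument `(B* p + σ_u u_m) / σ̂` of the projection. -/
def projArg (p : H01 Ω) : L2 Ω := D.σhat⁻¹ • (D.Badj p + D.σu • D.um)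

end Data

/-- The space of the iterates `(β, y, u, z, p)`. -/
abbrev X (Ω : Set (Euc l)) (n : ℕ) : Type := Euc n × H01 Ω × L2 Ω × Euc (n + 1) × H01 Ω

/-- The image space of `W`. -/
abbrev Z (Ω : Set (Euc l)) (n : ℕ) : Type := Euc n × Hm1 Ω × L2 Ω × Euc (n + 1) × Hm1 Ω

namespace Data

variable {Ω : Set (Euc l)} {n : ℕ} (D : Data Ω n)

/-- The domain `(0, ∞)ⁿ × H₀¹ × L² × ℝⁿ⁺¹ × H₀¹` of `W`. -/
def dom : Set (X Ω n) := {x | ∀ i, 0 < x.1 i}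

/-- The nonsmooth map `W` (meaningful on `dom`); `⊔`, `⊓` on `L²(Ω)` are the a.e. pointwise maximum
and minimum. -/
def W : X Ω n → Z Ω n := fun (β, y, u, z, p) =>
  (D.hβ β y + D.KT z,
   D.hy β y + D.Aadj p,
   u - (D.projArg p ⊔ D.ua) ⊓ D.ub,
   WithLp.toLp 2 (fun j => max (D.Kv β j - D.bT j) (-z j)),
   D.A y - D.B u)

/-- The set `𝒜₃(p)`. -/
def A3 (p : H01 Ω) : Set (Euc l) := {x | D.ua x ≤ D.projArg p x ∧ D.projArg p x ≤ D.ub x}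

theorem measurableSet_A3 (p : H01 Ω) : MeasurableSet (D.A3 p) := by
  have hs : D.A3 p = {x | D.ua x ≤ D.projArg p x} ∩ {x | D.projArg p x ≤ D.ub x} := by
    ext x; simp [A3]
  rw [hs]
  exact (measurableSet_le (Lp.stronglyMeasurable D.ua).measurable
    (Lp.stronglyMeasurable (D.projArg p)).measurable).inter
    (measurableSet_le (Lp.stronglyMeasurable (D.projArg p)).measurable
      (Lp.stronglyMeasurable D.ub).measurable)

/-- Multiplication by the characteristic function of `𝒜₃(p)` on `L²(Ω)`. -/
def χ3 (p : H01 Ω) (v : L2 Ω) : L2 Ω :=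
  ((Lp.memLp v).indicator (D.measurableSet_A3 p)).toLp

/-- The Newton derivative `W'(x)`, applied to a direction. In the fourth component, the index `j`
belongs to `𝒜₁(β, z)` if `(K β - bT)ⱼ ≥ -zⱼ` and to `𝒜₂(β, z)` otherwise. -/
def W' : X Ω n → X Ω n → Z Ω n := fun (β, y, _, z, p) (dβ, dy, du, dz, dp) =>
  (D.hββ β y dβ + D.hβy β y dy + D.KT dz,
   D.hyβ β y dβ + D.hyy β y dy + D.Aadj dp,
   du - D.σhat⁻¹ • D.χ3 p (D.Badj dp),
   WithLp.toLp 2 (fun j => if -z j ≤ D.Kv β j - D.bT j then D.Kv dβ j else -dz j),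
   D.A dy - D.B du)

/-- One (well-defined) step of the method from `x` to `x'`: the current iterate `x` lies in the
domain of `W`, the stopping criterion `W x = 0` is not met, and `s = x' - x` is the one and only
solution of the Newton equation `W'(x) s = -W(x)`. -/
structure NewtonStep (x x' : X Ω n) : Prop where
  mem_dom : x ∈ dom (Ω := Ω) (n := n)
  not_stopped : D.W x ≠ 0
  newton : ∀ s, D.W' x s = -D.W x ↔ s = x' - x

end Data

/-- `q`-superlinear convergence of a sequence. -/
def QSuperlinear {E : Type*} [NormedAddCommGroup E] (x : ℕ → E) (xbar : E) : Prop :=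
  Tendsto x atTop (𝓝 xbar) ∧ (fun i => x (i + 1) - xbar) =o[atTop] (fun i => x i - xbar)

/-- Started in `x₀`, the method is well defined and either terminates after finitely many steps
with the iterate `xbar`, or it generates an infinite sequence that converges `q`-superlinearly
to `xbar`. -/
def NewtonConverges {Ω : Set (Euc l)} {n : ℕ} (D : Data Ω n) (x₀ xbar : X Ω n) : Prop :=
  ∃ x : ℕ → X Ω n, x 0 = x₀ ∧
    ((∃ i, (∀ j < i, D.NewtonStep (x j) (x (j + 1))) ∧ D.W (x i) = 0 ∧ x i = xbar) ∨
     ((∀ j, D.NewtonStep (x j) (x (j + 1))) ∧ QSuperlinear x xbar))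

end ParamId

end

/-! Existence and uniqueness come from strong convexity, not from weak compactness. The terms `‖C y
- yd‖² / (2 β)` are quadratic over linear, hence jointly convex in `(β, y)`; `ξ` is affine; the
terms in `1 / β²` are strongly convex in `β` on a bounded box, and the control cost is strongly
convex in `u`. On the feasible set differences of states are `A⁻¹ B` of differences of controls, so
convexity in `u` also controls `y`. Minimizing sequences are therefore Cauchy
(`existsUnique_minimizer`).

Bijectivity of `A*` determines `p`, and stationarity in `u` then determines `ν`. For `z` the
geometry of a simplex is used: `n + 1` inequalities that describe it must be, up to order and
positive factors, `λᵢ ≥ 0` for the barycentric coordinates `λᵢ` (`exists_perm_eq_mul_coord`). This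
gives an explicit formula for `z`. Since some constraint is always inactive and the remaining `n`
rows of `K` are independent, `z` is unique.

A KKT point is a zero of `W`, so `newton_superlinear` reduces convergence to two facts: the
remainder `W(x) - W'(x)(x - x̄)` is `o(‖x - x̄‖)`, and `W'(x)` is invertible with a bound uniform
near `x̄`.

For the remainder, the derivatives of `h` are smooth on positive `β`, and the finite-dimensional
maximum is linearized without error near a zero. The projection is the delicate component, since a
superposition operator from `L²` to `L²` is in general not semismooth. Its linearization error lives
on a set `E` whose measure tends to zero, where it is at most `|B*(p - p̄)| / σ̂`. The extension of
`B` to `L^q`, `q < 2`, yields by duality and Hölder `‖χ_E B* p‖ ≤ c |E|^(1/q - 1/2) ‖p‖`, which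
supplies the missing factor `o(1)` (`norm_cutoff_le_of_extension`, `clamp_isLittleO`).

For invertibility, testing the Newton system with its own solution controls only the parameter
direction `δ` and the inactive part of `B* p` (`saddleOp_energy`). The remaining unknowns follow:
`y` through `A`, `p` through `A*`, and `z` through `Kᵀ` together with one component that vanishes by
inactivity. The constants do not depend on the active sets (`saddleOp_bound`). Surjectivity is block
elimination down to an equation `u + χ M u = r` with `M` positive (`saddleOp_surjective`). -/

namespace ParamId

/-! ### Local convergence of a Newton-type iteration -/

section Newton

variable {X Z : Type*} [NormedAddCommGroup X] [NormedAddCommGroup Z]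

/-- Local `q`-superlinear convergence of `x ↦ x - W'(x)⁻¹ W(x)` near a zero of `W`, for a Newton
derivative `W'` that is uniformly boundedly invertible. -/
theorem newton_superlinear {W : X → Z} {W' : X → X → Z} {xbar : X} {dom : Set X}
    (hdom : ∀ᶠ x in 𝓝 xbar, x ∈ dom)
    (hadd : ∀ᶠ x in 𝓝 xbar, ∀ s t, W' x (s + t) = W' x s + W' x t)
    (hbij : ∀ᶠ x in 𝓝 xbar, Function.Bijective (W' x))
    {C : ℝ} (hC : ∀ᶠ x in 𝓝 xbar, ∀ s, ‖s‖ ≤ C * ‖W' x s‖)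
    (ho : (fun x => W x - W' x (x - xbar)) =o[𝓝 xbar] fun x => x - xbar) :
    ∃ N ∈ 𝓝 xbar, ∀ x₀ ∈ N, ∃ x : ℕ → X, x 0 = x₀ ∧
      ((∃ i, (∀ j < i, x j ∈ dom ∧ W (x j) ≠ 0 ∧
          ∀ s, W' (x j) s = -W (x j) ↔ s = x (j + 1) - x j) ∧ W (x i) = 0 ∧ x i = xbar) ∨
       ((∀ j, x j ∈ dom ∧ W (x j) ≠ 0 ∧
          ∀ s, W' (x j) s = -W (x j) ↔ s = x (j + 1) - x j) ∧ QSuperlinear x xbar)) := by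
  classical
  have hex : ∀ x, ∃ x', Function.Bijective (W' x) → ∀ s, W' x s = -W x ↔ s = x' - x := by
    intro x
    by_cases hb : Function.Bijective (W' x)
    · obtain ⟨s, hs⟩ := hb.2 (-W x)
      refine ⟨x + s, fun _ t => ?_⟩
      rw [add_sub_cancel_left]
      exact ⟨fun ht => hb.1 (ht.trans hs.symm), fun ht => ht ▸ hs⟩
    · exact ⟨x, fun h => absurd h hb⟩
  choose Φ hΦ using hex
  -- the error of one step is controlled by the remainder
  have hstep : ∀ᶠ x in 𝓝 xbar, ‖Φ x - xbar‖ ≤ C * ‖W x - W' x (x - xbar)‖ := by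
    filter_upwards [hadd, hbij, hC] with x ha hb hc
    have h1 : W' x (Φ x - x) = -W x := (hΦ x hb _).2 rfl
    have h2 : W' x (Φ x - xbar) = -(W x - W' x (x - xbar)) := by
      have : Φ x - xbar = (Φ x - x) + (x - xbar) := by abel
      rw [this, ha, h1]; abel
    simpa only [h2, norm_neg] using hc (Φ x - xbar)
  have hΦo : (fun x => Φ x - xbar) =o[𝓝 xbar] fun x => x - xbar :=
    (IsBigO.of_bound C hstep).trans_isLittleO ho
  -- `xbar` is an isolated zero: if `W x = 0`, the remainder is `-W' x (x - xbar)`, and the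
  -- stability bound absorbs it. This identifies the point at which the method stops.
  have hzero : ∀ᶠ x in 𝓝 xbar, W x = 0 → x = xbar := by
    have hC0 : ∀ᶠ x in 𝓝 xbar, ‖x - xbar‖ ≤ C * ‖W' x (x - xbar)‖ :=
      hC.mono fun x h => h _
    -- The sign of `C` is not known, hence `|C| + 1`; the factor makes the product with the
    -- stability constant `1 / 2`.
    have hk : 0 < (2 * (|C| + 1))⁻¹ := by positivity
    filter_upwards [hC0, ho.def hk] with x h1 h2 h3
    rw [h3, zero_sub, norm_neg] at h2
    have h4 : ‖x - xbar‖ ≤ (|C| + 1) * ((2 * (|C| + 1))⁻¹ * ‖x - xbar‖) := by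
      refine h1.trans (mul_le_mul ?_ h2 (norm_nonneg _) (by positivity))
      linarith [le_abs_self C]
    have h5 : (|C| + 1) * ((2 * (|C| + 1))⁻¹ * ‖x - xbar‖) = ‖x - xbar‖ / 2 := by
      field_simp
    have h6 : ‖x - xbar‖ ≤ 0 := by linarith [norm_nonneg (x - xbar)]
    exact sub_eq_zero.1 (norm_le_zero_iff.1 h6)
  obtain ⟨r, hr, hball⟩ := Metric.eventually_nhds_iff_ball.1
    (((hdom.and hbij).and hzero).and
      (hΦo.def (show (0 : ℝ) < 1 / 2 by norm_num)))
  refine ⟨Metric.ball xbar r, Metric.ball_mem_nhds _ hr, fun x₀ hx₀ => ?_⟩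
  set x : ℕ → X := fun k => Φ^[k] x₀ with hx
  have hsucc : ∀ k, x (k + 1) = Φ (x k) := fun k => Function.iterate_succ_apply' Φ k x₀
  have hbound : ∀ k, x k ∈ Metric.ball xbar r ∧ ‖x k - xbar‖ ≤ (1 / 2) ^ k * ‖x₀ - xbar‖ := by
    intro k
    induction k with
    | zero => exact ⟨hx₀, by simp [hx]⟩
    | succ k ih =>
      have h1 := (hball _ ih.1).2
      rw [hsucc]
      refine ⟨?_, ?_⟩
      · have := ih.1
        rw [Metric.mem_ball, dist_eq_norm] at *
        linarith [norm_nonneg (x k - xbar)]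
      · calc _ ≤ _ := h1
          _ ≤ 1 / 2 * ((1 / 2) ^ k * ‖x₀ - xbar‖) := by gcongr; exact ih.2
          _ = _ := by ring
  have hnewton : ∀ j, W (x j) ≠ 0 → x j ∈ dom ∧ W (x j) ≠ 0 ∧
      ∀ s, W' (x j) s = -W (x j) ↔ s = x (j + 1) - x j := fun j hj => by
    have hb := (hball _ (hbound j).1).1.1
    rw [hsucc]
    exact ⟨hb.1, hj, hΦ _ hb.2⟩
  refine ⟨x, rfl, ?_⟩
  by_cases hfin : ∃ i, W (x i) = 0
  · left
    refine ⟨Nat.find hfin, fun j hj => hnewton j (Nat.find_min hfin hj), Nat.find_spec hfin, ?_⟩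
    exact (hball _ (hbound _).1).1.2 (Nat.find_spec hfin)
  · right
    push Not at hfin
    have htend : Tendsto x atTop (𝓝 xbar) := by
      rw [tendsto_iff_norm_sub_tendsto_zero]
      refine squeeze_zero (fun _ => norm_nonneg _) (fun k => (hbound k).2) ?_
      have := (tendsto_pow_atTop_nhds_zero_of_lt_one (r := (1 / 2 : ℝ)) (by norm_num)
        (by norm_num)).mul_const ‖x₀ - xbar‖
      simpa using this
    refine ⟨fun j => hnewton j (hfin j), htend, ?_⟩
    have := hΦo.comp_tendsto htend
    simpa only [Function.comp_def, ← hsucc] using this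

end Newton

/-! ### Saddle point systems -/

section Saddle

theorem exists_bound_of_bijective {Y V : Type*} [NormedAddCommGroup Y] [NormedSpace ℝ Y]
    [CompleteSpace Y] [NormedAddCommGroup V] [NormedSpace ℝ V] [CompleteSpace V] (A : Y →L[ℝ] V)
    (hA : Function.Bijective A) : ∃ a, 0 ≤ a ∧ ∀ y, ‖y‖ ≤ a * ‖A y‖ := by
  let e := ContinuousLinearEquiv.ofBijective A (LinearMap.ker_eq_bot.2 hA.1)
    (LinearMap.range_eq_top.2 hA.2)
  refine ⟨‖(e.symm : V →L[ℝ] Y)‖, norm_nonneg _, fun y => ?_⟩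
  simpa [e] using (e.symm : V →L[ℝ] Y).le_opNorm (A y)

/-- The adjoint of a bijective operator from a Hilbert space to its dual is bijective. -/
theorem bijective_flip {Y : Type*} [NormedAddCommGroup Y] [InnerProductSpace ℝ Y]
    [CompleteSpace Y] {A : Y →L[ℝ] StrongDual ℝ Y} (hA : Function.Bijective A) :
    Function.Bijective A.flip := by
  constructor
  · rw [injective_iff_map_eq_zero]
    intro p hp
    -- Testing with the `y` for which `A y = ⟨p, ·⟩` turns `A* p = 0` into `‖p‖² = 0`.
    obtain ⟨y, hy⟩ := hA.2 (innerSL ℝ p)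
    have : A.flip p y = 0 := by rw [hp]; rfl
    rw [ContinuousLinearMap.flip_apply, hy, innerSL_apply_apply] at this
    exact inner_self_eq_zero.1 this
  · intro f
    let e := ContinuousLinearEquiv.ofBijective A (LinearMap.ker_eq_bot.2 hA.1)
      (LinearMap.range_eq_top.2 hA.2)
    -- Evaluating functionals `A y` at `p` is to reproduce `f y`. So `f ∘ A⁻¹` must be evaluation at
    -- `p`, and `p` is its Riesz representative after identifying the dual with the space.
    let g : StrongDual ℝ Y := f ∘L (e.symm : StrongDual ℝ Y →L[ℝ] Y) ∘L innerSL ℝ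
    refine ⟨(InnerProductSpace.toDual ℝ Y).symm g, ?_⟩
    ext y
    obtain ⟨w, hw⟩ := (InnerProductSpace.toDual ℝ Y).surjective (A y)
    have h1 : innerSL ℝ w = A y := hw
    have h2 : g w = f y := by
      change f (e.symm (innerSL ℝ w)) = f y
      rw [h1]
      exact congrArg f (e.symm_apply_apply y)
    rw [ContinuousLinearMap.flip_apply, ← h1, innerSL_apply_apply, real_inner_comm,
      InnerProductSpace.toDual_symm_apply, h2]

/-- `1 + χ M` is onto for a positive operator `M` and an orthogonal projection `χ`. -/
theorem surjective_id_add_projection_comp {U : Type*} [NormedAddCommGroup U]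
    [InnerProductSpace ℝ U] [CompleteSpace U] (χ M : U →L[ℝ] U)
    (hχ : ∀ u v, inner ℝ (χ u) v = inner ℝ u (χ v)) (hχχ : ∀ u, χ (χ u) = χ u)
    (hM : ∀ u, 0 ≤ inner ℝ (M u) u) (r : U) : ∃ u, u + χ (M u) = r := by
  -- `1 + χ M` need not be coercive, but its compression `1 + χ M χ` is, so Lax–Milgram applies. The
  -- part of the solution outside the range of `χ` must be `r - χ r`; the part inside solves the
  -- compressed equation.
  set R : U →L[ℝ] U := ContinuousLinearMap.id ℝ U + χ ∘L M ∘L χ with hR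
  have hcoer : IsCoercive ((innerSL ℝ).comp R : U →L[ℝ] U →L[ℝ] ℝ) := by
    refine ⟨1, one_pos, fun u => ?_⟩
    have h1 : ((innerSL ℝ).comp R : U →L[ℝ] U →L[ℝ] ℝ) u u
        = ‖u‖ ^ 2 + inner ℝ (M (χ u)) (χ u) := by
      rw [← real_inner_self_eq_norm_sq, ← hχ, ← inner_add_left]
      rfl
    rw [h1]
    linarith [hM (χ u)]
  have hRs : ∀ s, ∃ w, R w = s := by
    intro s
    refine ⟨hcoer.continuousLinearEquivOfBilin.symm s, ?_⟩
    refine ext_inner_right ℝ fun v => ?_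
    have := hcoer.continuousLinearEquivOfBilin_apply (hcoer.continuousLinearEquivOfBilin.symm s) v
    rw [ContinuousLinearEquiv.apply_symm_apply] at this
    rw [this]; simp
  obtain ⟨w, hw⟩ := hRs (χ r - χ (M (r - χ r)))
  have hw' : w + χ (M (χ w)) = χ r - χ (M (r - χ r)) := by simpa [hR] using hw
  have hχw : χ w = w := by
    have h := congrArg χ hw'
    simp only [map_add, map_sub, hχχ] at h
    have h2 := hw'
    simp only [map_sub] at h2
    exact add_right_cancel (h.trans h2.symm)
  refine ⟨w + (r - χ r), ?_⟩
  rw [hχw] at hw'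
  rw [map_add, map_add]
  have : χ (M w) = χ r - χ (M (r - χ r)) - w := by rw [← hw']; abel
  rw [this]; abel

variable {k m : ℕ} {Y U : Type*} [NormedAddCommGroup Y] [InnerProductSpace ℝ Y]
  [NormedAddCommGroup U] [InnerProductSpace ℝ U]

/-- The Newton operator with second derivatives `H₁ = (h''_ββ, h''_βy)`, `H₂ = (h''_yβ, h''_yy)`,
inactive control set encoded by the projection `χ`, and active inequalities `I`. -/
noncomputable def saddleOp (A : Y →L[ℝ] StrongDual ℝ Y) (B : U →L[ℝ] StrongDual ℝ Y) (Bt : Y →L[ℝ] U)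
    (K : Euc k →L[ℝ] Euc m) (Kt : Euc m →L[ℝ] Euc k) (κ : ℝ)
    (H₁ : Euc k × Y →L[ℝ] Euc k) (H₂ : Euc k × Y →L[ℝ] StrongDual ℝ Y)
    (χ : U →L[ℝ] U) (I : Fin m → Prop) [DecidablePred I] (s : Euc k × Y × U × Euc m × Y) :
    Euc k × StrongDual ℝ Y × U × Euc m × StrongDual ℝ Y :=
  (H₁ (s.1, s.2.1) + Kt s.2.2.2.1,
   H₂ (s.1, s.2.1) + A.flip s.2.2.2.2,
   s.2.2.1 - κ⁻¹ • χ (Bt s.2.2.2.2),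
   WithLp.toLp 2 (fun j => if I j then K s.1 j else -s.2.2.2.1 j),
   A s.2.1 - B s.2.2.1)

/-- For each index one of the two factors of `z j * w j` equals the residual `r j` up to sign. With
zero residual the pairing vanishes, which is the linearized form of complementarity. -/
theorem abs_inner_le_of_complementarity {z w r : Euc m} {I : Fin m → Prop} [DecidablePred I]
    (hr : ∀ j, r j = if I j then w j else -z j) :
    |inner ℝ z w| ≤ m * (‖r‖ * (‖z‖ + ‖w‖)) := by
  have h1 : inner ℝ z w = ∑ j, z j * w j := by
    rw [PiLp.inner_apply]; simp [mul_comm]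
  rw [h1]
  refine (Finset.abs_sum_le_sum_abs _ _).trans ?_
  refine (Finset.sum_le_card_nsmul _ _ (‖r‖ * (‖z‖ + ‖w‖)) fun j _ => ?_).trans (by simp)
  have hz : |z j| ≤ ‖z‖ := PiLp.norm_apply_le z j
  have hw : |w j| ≤ ‖w‖ := PiLp.norm_apply_le w j
  have hrj : |r j| ≤ ‖r‖ := PiLp.norm_apply_le r j
  rw [abs_mul]
  rw [hr j] at hrj
  by_cases hj : I j
  · rw [if_pos hj] at hrj
    nlinarith [mul_le_mul hz hrj (abs_nonneg _) (norm_nonneg _), norm_nonneg r, norm_nonneg w,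
      mul_nonneg (norm_nonneg r) (norm_nonneg w)]
  · rw [if_neg hj, abs_neg] at hrj
    nlinarith [mul_le_mul hrj hw (abs_nonneg _) (norm_nonneg _),
      mul_nonneg (norm_nonneg r) (norm_nonneg z)]

/-- The first row is tested with `δ`, the second with `y` and the last with `p`. The coupling
through `A` cancels, the coupling through `K` is small by complementarity, and the third row turns
`B u p` into `κ‖v‖²`, `v = κ⁻¹ χ B* p`, because `χ` is an orthogonal projection. Every other term is
a residual times an unknown. -/
theorem saddleOp_energy {A : Y →L[ℝ] StrongDual ℝ Y} {B : U →L[ℝ] StrongDual ℝ Y}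
    {Bt : Y →L[ℝ] U} (hBt : ∀ p v, inner ℝ (Bt p) v = B v p)
    {K : Euc k →L[ℝ] Euc m} {Kt : Euc m →L[ℝ] Euc k}
    (hKt : ∀ z β, inner ℝ (Kt z) β = inner ℝ z (K β)) {κ c : ℝ} (hκ : 0 < κ)
    {H₁ : Euc k × Y →L[ℝ] Euc k} {H₂ : Euc k × Y →L[ℝ] StrongDual ℝ Y}
    (hH : ∀ δ v, c * ‖δ‖ ^ 2 ≤ inner ℝ (H₁ (δ, v)) δ + H₂ (δ, v) v)
    {χ : U →L[ℝ] U} (hχ : ∀ u v, inner ℝ (χ u) v = inner ℝ u (χ v)) (hχχ : ∀ u, χ (χ u) = χ u)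
    {I : Fin m → Prop} [DecidablePred I] (δ : Euc k) (y : Y) (u : U) (z : Euc m) (p : Y) {ρ : ℝ}
    (hρ : ‖saddleOp A B Bt K Kt κ H₁ H₂ χ I (δ, y, u, z, p)‖ ≤ ρ) :
    c * ‖δ‖ ^ 2 + κ * ‖κ⁻¹ • χ (Bt p)‖ ^ 2 ≤
      ρ * (‖δ‖ + ‖y‖ + ‖Bt‖ * ‖p‖ + ‖p‖ + m * (‖z‖ + ‖K‖ * ‖δ‖)) := by
  set r := saddleOp A B Bt K Kt κ H₁ H₂ χ I (δ, y, u, z, p) with hr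
  have hρ0 : 0 ≤ ρ := (norm_nonneg _).trans hρ
  have hr1 : ‖r.1‖ ≤ ρ := (norm_fst_le r).trans hρ
  have hr' : ‖r.2‖ ≤ ρ := (norm_snd_le r).trans hρ
  have hr2 : ‖r.2.1‖ ≤ ρ := (norm_fst_le r.2).trans hr'
  have hr'' : ‖r.2.2‖ ≤ ρ := (norm_snd_le r.2).trans hr'
  have hr3 : ‖r.2.2.1‖ ≤ ρ := (norm_fst_le r.2.2).trans hr''
  have hr''' : ‖r.2.2.2‖ ≤ ρ := (norm_snd_le r.2.2).trans hr''
  have hr4 : ‖r.2.2.2.1‖ ≤ ρ := (norm_fst_le r.2.2.2).trans hr'''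
  have hr5 : ‖r.2.2.2.2‖ ≤ ρ := (norm_snd_le r.2.2.2).trans hr'''
  have e1 : H₁ (δ, y) = r.1 - Kt z := by simp [hr, saddleOp]
  have e2 : H₂ (δ, y) y = r.2.1 y - A y p := by
    simp [hr, saddleOp]
  have e3 : u = κ⁻¹ • χ (Bt p) + r.2.2.1 := by simp [hr, saddleOp]
  have e4 : ∀ j, r.2.2.2.1 j = if I j then K δ j else -z j := fun j => rfl
  have e5 : A y p = B u p + r.2.2.2.2 p := by
    simp [hr, saddleOp]
  have e6 : B u p = κ * ‖κ⁻¹ • χ (Bt p)‖ ^ 2 + inner ℝ (Bt p) r.2.2.1 := by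
    have h2 : inner ℝ (Bt p) (χ (Bt p)) = ‖χ (Bt p)‖ ^ 2 := by
      rw [← real_inner_self_eq_norm_sq, hχ, hχχ]
    rw [← hBt, e3, inner_add_right, inner_smul_right, h2, norm_smul, mul_pow, Real.norm_eq_abs,
      sq_abs]
    simp only [add_left_inj]
    field_simp
  have h := hH δ y
  rw [e1, e2, e5, e6, inner_sub_left, hKt] at h
  have b1 : inner ℝ r.1 δ ≤ ρ * ‖δ‖ := (real_inner_le_norm _ _).trans (by gcongr)
  have b2 : r.2.1 y ≤ ρ * ‖y‖ := by
    refine (le_abs_self _).trans (((r.2.1).le_opNorm y).trans (by gcongr))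
  have b3 : -inner ℝ (Bt p) r.2.2.1 ≤ ρ * (‖Bt‖ * ‖p‖) := by
    refine (neg_le_abs _).trans ((abs_real_inner_le_norm _ _).trans ?_)
    rw [mul_comm ρ]
    have := Bt.le_opNorm p
    gcongr
  have b5 : -r.2.2.2.2 p ≤ ρ * ‖p‖ := by
    refine (neg_le_abs _).trans (((r.2.2.2.2).le_opNorm p).trans (by gcongr))
  have b4 : -inner ℝ z (K δ) ≤ ρ * (m * (‖z‖ + ‖K‖ * ‖δ‖)) := by
    refine (neg_le_abs _).trans ((abs_inner_le_of_complementarity e4).trans ?_)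
    have := K.le_opNorm δ
    calc _ ≤ (m : ℝ) * (ρ * (‖z‖ + ‖K‖ * ‖δ‖)) := by gcongr
      _ = _ := by ring
  linarith

/-- The uniform a priori bound for the Newton systems. -/
theorem saddleOp_bound [CompleteSpace Y] {A : Y →L[ℝ] StrongDual ℝ Y} (hA : Function.Bijective A)
    (hAf : Function.Bijective A.flip)
    {B : U →L[ℝ] StrongDual ℝ Y}
    {Bt : Y →L[ℝ] U} (hBt : ∀ p v, inner ℝ (Bt p) v = B v p)
    {K : Euc k →L[ℝ] Euc m} {Kt : Euc m →L[ℝ] Euc k}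
    (hKt : ∀ z β, inner ℝ (Kt z) β = inner ℝ z (K β)) {κ c M CK : ℝ} (hκ : 0 < κ) (hc : 0 < c)
    (j₀ : Fin m) (hCK : ∀ z, ‖z‖ ≤ CK * (‖Kt z‖ + |z j₀|)) :
    ∃ C, ∀ (H₁ : Euc k × Y →L[ℝ] Euc k) (H₂ : Euc k × Y →L[ℝ] StrongDual ℝ Y)
      (χ : U →L[ℝ] U) (I : Fin m → Prop) [DecidablePred I], ‖H₁‖ ≤ M → ‖H₂‖ ≤ M →
      (∀ δ v, c * ‖δ‖ ^ 2 ≤ inner ℝ (H₁ (δ, v)) δ + H₂ (δ, v) v) →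
      (∀ u v, inner ℝ (χ u) v = inner ℝ u (χ v)) → (∀ u, χ (χ u) = χ u) → ¬ I j₀ →
      ∀ s, ‖s‖ ≤ C * ‖saddleOp A B Bt K Kt κ H₁ H₂ χ I s‖ := by
  obtain ⟨a, ha0, ha⟩ : ∃ a, 0 ≤ a ∧ ∀ y, ‖y‖ ≤ a * ‖A y‖ :=
    exists_bound_of_bijective A hA
  obtain ⟨a', ha0', ha'⟩ : ∃ a, 0 ≤ a ∧ ∀ y, ‖y‖ ≤ a * ‖A.flip y‖ :=
    exists_bound_of_bijective A.flip hAf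
  set c1 := a * (‖B‖ + 1) with hc1
  set c2 := a' * (1 + |M| * (1 + c1)) with hc2
  set c3 := |CK| * (2 + |M| * (1 + c1)) with hc3
  set c4 := 1 + c1 + 1 + c3 + c2 with hc4
  set c5 := 1 + c1 + ‖Bt‖ * c2 + c2 + m * (c3 + ‖K‖) with hc5
  have hc10 : 0 ≤ c1 := by positivity
  have hc20 : 0 ≤ c2 := by positivity
  have hc30 : 0 ≤ c3 := by positivity
  have hc50 : 0 ≤ c5 := by positivity
  set e := min c κ with he
  have he0 : 0 < e := lt_min hc hκ
  refine ⟨c4 * (3 * (c5 / e + 1)), ?_⟩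
  rintro H₁ H₂ χ I _ hM1 hM2 hH hχ hχχ hj₀ ⟨δ, y, u, z, p⟩
  have hen := saddleOp_energy (A := A) hBt hKt hκ hH hχ hχχ (I := I) δ y u z p le_rfl
  set r := saddleOp A B Bt K Kt κ H₁ H₂ χ I (δ, y, u, z, p) with hr
  set ρ := ‖r‖ with hρ
  have hρ0 : 0 ≤ ρ := norm_nonneg _
  have hr1 : ‖r.1‖ ≤ ρ := (norm_fst_le r)
  have hr' : ‖r.2‖ ≤ ρ := (norm_snd_le r)
  have hr2 : ‖r.2.1‖ ≤ ρ := (norm_fst_le r.2).trans hr'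
  have hr'' : ‖r.2.2‖ ≤ ρ := (norm_snd_le r.2).trans hr'
  have hr3 : ‖r.2.2.1‖ ≤ ρ := (norm_fst_le r.2.2).trans hr''
  have hr''' : ‖r.2.2.2‖ ≤ ρ := (norm_snd_le r.2.2).trans hr''
  have hr4 : ‖r.2.2.2.1‖ ≤ ρ := (norm_fst_le r.2.2.2).trans hr'''
  have hr5 : ‖r.2.2.2.2‖ ≤ ρ := (norm_snd_le r.2.2.2).trans hr'''
  set v := κ⁻¹ • χ (Bt p) with hv
  -- `N` collects the quantities controlled by the energy and the residual. Every unknown is bounded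
  -- by a constant times `N`: first `u`, then `y`, then `p` and `z`.
  set N := ‖δ‖ + ‖v‖ + ρ with hN
  have hδN : ‖δ‖ ≤ N := by linarith [norm_nonneg v]
  have hρN : ρ ≤ N := by linarith [norm_nonneg v, norm_nonneg δ]
  have hN0 : 0 ≤ N := by positivity
  have hu : ‖u‖ ≤ N := by
    have e3 : u = v + r.2.2.1 := by simp [hr, saddleOp, hv]
    rw [e3]
    linarith [norm_add_le v r.2.2.1, norm_nonneg δ]
  have hy : ‖y‖ ≤ c1 * N := by
    have e5 : A y = B u + r.2.2.2.2 := by simp [hr, saddleOp]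
    calc ‖y‖ ≤ a * ‖A y‖ := ha y
      _ ≤ a * (‖B‖ * N + N) := by
        rw [e5]
        gcongr
        exact (norm_add_le _ _).trans (add_le_add ((B.le_opNorm u).trans (by gcongr))
          (hr5.trans hρN))
      _ = c1 * N := by rw [hc1]; ring
  have hδy : ‖(δ, y)‖ ≤ (1 + c1) * N := by
    have h1 : 0 ≤ c1 * N := mul_nonneg hc10 hN0
    rw [one_add_mul]
    exact max_le (hδN.trans (le_add_of_nonneg_right h1)) (hy.trans (le_add_of_nonneg_left hN0))
  have hH1 : ‖H₁ (δ, y)‖ ≤ |M| * ((1 + c1) * N) :=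
    (H₁.le_opNorm _).trans (by gcongr; exact hM1.trans (le_abs_self _))
  have hH2 : ‖H₂ (δ, y)‖ ≤ |M| * ((1 + c1) * N) :=
    (H₂.le_opNorm _).trans (by gcongr; exact hM2.trans (le_abs_self _))
  have hp : ‖p‖ ≤ c2 * N := by
    have e2 : A.flip p = r.2.1 - H₂ (δ, y) := by simp [hr, saddleOp]
    calc ‖p‖ ≤ a' * ‖A.flip p‖ := ha' p
      _ ≤ a' * (N + |M| * ((1 + c1) * N)) := by
        rw [e2]
        gcongr
        exact (norm_sub_le _ _).trans (add_le_add (hr2.trans hρN) hH2)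
      _ = c2 * N := by rw [hc2]; ring
  have hz : ‖z‖ ≤ c3 * N := by
    have e1 : Kt z = r.1 - H₁ (δ, y) := by simp [hr, saddleOp]
    have e4 : |z j₀| ≤ ρ := by
      have : r.2.2.2.1 j₀ = -z j₀ := if_neg hj₀
      rw [← abs_neg, ← this]
      exact (PiLp.norm_apply_le r.2.2.2.1 j₀).trans hr4
    calc ‖z‖ ≤ CK * (‖Kt z‖ + |z j₀|) := hCK z
      _ ≤ |CK| * ((N + |M| * ((1 + c1) * N)) + N) := by
        rw [e1]
        refine mul_le_mul (le_abs_self _) ?_ (by positivity) (abs_nonneg _)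
        exact add_le_add ((norm_sub_le _ _).trans (add_le_add (hr1.trans hρN) hH1))
          (e4.trans hρN)
      _ = c3 * N := by rw [hc3]; ring
  have hs : ‖((δ, y, u, z, p) : Euc k × Y × U × Euc m × Y)‖ ≤ c4 * N := by
    have h4 : ∀ t, t ≤ c4 → t * N ≤ c4 * N := fun t ht => mul_le_mul_of_nonneg_right ht hN0
    simp only [Prod.norm_mk]
    refine max_le ?_ (max_le ?_ (max_le ?_ (max_le ?_ ?_)))
    · exact (hδN.trans (one_mul N).ge).trans (h4 _ (by linarith))
    · exact hy.trans (h4 _ (by linarith))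
    · exact (hu.trans (one_mul N).ge).trans (h4 _ (by linarith))
    · exact hz.trans (h4 _ (by linarith))
    · exact hp.trans (h4 _ (by linarith))
  have hen2 : e * (‖δ‖ ^ 2 + ‖v‖ ^ 2) ≤ c5 * (ρ * N) := by
    have h1 : e * ‖δ‖ ^ 2 ≤ c * ‖δ‖ ^ 2 := by gcongr; exact min_le_left _ _
    have h2 : e * ‖v‖ ^ 2 ≤ κ * ‖v‖ ^ 2 := by gcongr; exact min_le_right _ _
    have h3 : ρ * (‖δ‖ + ‖y‖ + ‖Bt‖ * ‖p‖ + ‖p‖ + m * (‖z‖ + ‖K‖ * ‖δ‖)) ≤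
        ρ * (N + c1 * N + ‖Bt‖ * (c2 * N) + c2 * N + m * (c3 * N + ‖K‖ * N)) := by gcongr
    calc _ = e * ‖δ‖ ^ 2 + e * ‖v‖ ^ 2 := by ring
      _ ≤ _ := (add_le_add h1 h2).trans (hen.trans h3)
      _ = _ := by rw [hc5]; ring
  -- The energy estimate is quadratic in `N` on the left and only of the form `ρ N` on the right, so
  -- one factor `N` cancels.
  have hNρ : N ≤ 3 * (c5 / e + 1) * ρ := by
    rcases hN0.eq_or_lt with h0 | h0
    · rw [← h0]; positivity
    have h1 : ‖δ‖ ^ 2 + ‖v‖ ^ 2 ≤ c5 / e * (ρ * N) := by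
      rw [div_mul_eq_mul_div, le_div_iff₀ he0]; linarith
    have h2 : ρ ^ 2 ≤ ρ * N := by rw [sq]; gcongr
    have h3 : N ^ 2 ≤ 3 * (‖δ‖ ^ 2 + ‖v‖ ^ 2 + ρ ^ 2) := by
      rw [hN]
      linarith [sq_nonneg (‖δ‖ - ‖v‖), sq_nonneg (‖δ‖ - ρ), sq_nonneg (‖v‖ - ρ)]
    have h4 : N * N ≤ 3 * (c5 / e + 1) * ρ * N := by linarith
    exact le_of_mul_le_mul_right h4 h0
  have hc40 : 0 ≤ c4 := by positivity
  calc _ ≤ c4 * N := hs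
    _ ≤ c4 * (3 * (c5 / e + 1) * ρ) := by gcongr
    _ = _ := by ring

/-- Block elimination. For given `y` the pair `(δ, z)` solves a square finite-dimensional system,
where injectivity suffices. Then `y` and `p` are expressed through `u` by the inverses of `A` and
`A*`, and the third row becomes `u + χ M u = r`. The operator `M` is a Schur complement and inherits
positivity from `hH`. -/
theorem saddleOp_surjective [CompleteSpace Y] [CompleteSpace U] {A : Y →L[ℝ] StrongDual ℝ Y} (hA : Function.Bijective A)
    (hAf : Function.Bijective A.flip)
    {B : U →L[ℝ] StrongDual ℝ Y}
    {Bt : Y →L[ℝ] U} (hBt : ∀ p v, inner ℝ (Bt p) v = B v p)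
    {K : Euc k →L[ℝ] Euc m} {Kt : Euc m →L[ℝ] Euc k}
    (hKt : ∀ z β, inner ℝ (Kt z) β = inner ℝ z (K β)) {κ c CK : ℝ} (hκ : 0 < κ) (hc : 0 < c)
    (j₀ : Fin m) (hCK : ∀ z, ‖z‖ ≤ CK * (‖Kt z‖ + |z j₀|))
    {H₁ : Euc k × Y →L[ℝ] Euc k} {H₂ : Euc k × Y →L[ℝ] StrongDual ℝ Y}
    (hH : ∀ δ v, c * ‖δ‖ ^ 2 ≤ inner ℝ (H₁ (δ, v)) δ + H₂ (δ, v) v)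
    {χ : U →L[ℝ] U} (hχ : ∀ u v, inner ℝ (χ u) v = inner ℝ u (χ v)) (hχχ : ∀ u, χ (χ u) = χ u)
    {I : Fin m → Prop} [DecidablePred I] (hj₀ : ¬ I j₀) :
    Function.Surjective (saddleOp A B Bt K Kt κ H₁ H₂ χ I) := by
  let eA := ContinuousLinearEquiv.ofBijective A (LinearMap.ker_eq_bot.2 hA.1)
    (LinearMap.range_eq_top.2 hA.2)
  let eF := ContinuousLinearEquiv.ofBijective A.flip (LinearMap.ker_eq_bot.2 hAf.1)
    (LinearMap.range_eq_top.2 hAf.2)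
  have heA : ∀ f, A (eA.symm f) = f := fun f => eA.apply_symm_apply f
  have heF : ∀ f, A.flip (eF.symm f) = f := fun f => eF.apply_symm_apply f
  -- the finite-dimensional part
  let L : Euc k × Euc m →ₗ[ℝ] Euc k × Euc m :=
    { toFun := fun w => (H₁ (w.1, 0) + Kt w.2,
        WithLp.toLp 2 (fun j => if I j then K w.1 j else -w.2 j))
      map_add' := by
        intro w w'
        refine Prod.ext ?_ ?_
        · have : H₁ (w.1 + w'.1, 0) = H₁ (w.1, 0) + H₁ (w'.1, 0) := by simp [← map_add]
          simp only [this, map_add, Prod.snd_add, Prod.fst_add]; abel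
        · ext j
          by_cases hj : I j <;> simp [hj, add_comm]
      map_smul' := by
        intro t w
        refine Prod.ext ?_ ?_
        · have : H₁ (t • w.1, 0) = t • H₁ (w.1, 0) := by simp [← map_smul]
          simp only [this, map_smul, Prod.smul_snd, Prod.smul_fst, smul_add, RingHom.id_apply]
        · ext j
          by_cases hj : I j <;> simp [hj] }
  have hcompl : ∀ (δ : Euc k) (z : Euc m), (∀ j, (if I j then K δ j else -z j) = 0) →
      inner ℝ z (K δ) = 0 := by
    intro δ z h
    have := abs_inner_le_of_complementarity (z := z) (w := K δ) (r := 0) (I := I)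
      (fun j => by rw [h j]; rfl)
    simpa using this
  have hLinj : Function.Injective L := by
    rw [injective_iff_map_eq_zero]
    rintro ⟨δ, z⟩ h
    have h1 : H₁ (δ, 0) + Kt z = 0 := congrArg Prod.fst h
    have h2 : ∀ j, (if I j then K δ j else -z j) = 0 := fun j => by
      have := congrArg (fun w : Euc k × Euc m => w.2 j) h
      exact this
    have h3 := hH δ 0
    rw [eq_neg_of_add_eq_zero_left h1, inner_neg_left, hKt, hcompl δ z h2] at h3
    have hδ : δ = 0 := by
      have : ‖δ‖ ^ 2 ≤ 0 := by
        have : c * ‖δ‖ ^ 2 ≤ 0 := by simpa using h3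
        by_contra hn
        exact absurd this (not_le.2 (mul_pos hc (not_le.1 hn)))
      simpa using this
    have hz : z = 0 := by
      have h4 : Kt z = 0 := by simpa [hδ, ← Prod.zero_eq_mk] using h1
      have h5 : z j₀ = 0 := by simpa [hj₀] using h2 j₀
      have := hCK z
      rw [h4, h5] at this
      simpa using this
    rw [hδ, hz]; rfl
  let eL : (Euc k × Euc m) ≃L[ℝ] (Euc k × Euc m) :=
    (LinearEquiv.ofInjectiveEndo L hLinj).toContinuousLinearEquiv
  have heL : ∀ w, L (eL.symm w) = w := fun w => eL.apply_symm_apply w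
  let q : Y →L[ℝ] Euc k × Euc m :=
    (eL.symm : (Euc k × Euc m) →L[ℝ] (Euc k × Euc m)) ∘L
      (ContinuousLinearMap.inl ℝ (Euc k) (Euc m)) ∘L (-(H₁ ∘L ContinuousLinearMap.inr ℝ (Euc k) Y))
  have hq : ∀ y, L (q y) = (-H₁ (0, y), 0) := fun y => by
    change L (eL.symm _) = _
    rw [heL]; simp
  let g : Y →L[ℝ] Euc k := ContinuousLinearMap.fst ℝ (Euc k) (Euc m) ∘L q
  -- With `δ = g y` the first row is homogeneous, so its contribution to the quadratic form is `-⟨z,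
  -- K δ⟩`, which is zero by complementarity. Only the `H₂` term remains in `hH`.
  have hg : ∀ y, 0 ≤ H₂ (g y, y) y := by
    intro y
    have h1 : H₁ (g y, 0) + Kt (q y).2 = -H₁ (0, y) := congrArg Prod.fst (hq y)
    have h2 : ∀ j, (if I j then K (g y) j else -(q y).2 j) = 0 := fun j => by
      have := congrArg (fun w : Euc k × Euc m => w.2 j) (hq y)
      exact this
    have h3 : H₁ (g y, y) = -Kt (q y).2 := by
      have : (g y, y) = (g y, (0 : Y)) + (0, y) := by simp
      rw [this, map_add, ← sub_eq_zero]
      have h4 : H₁ (g y, 0) = -H₁ (0, y) - Kt (q y).2 := by rw [← h1]; abel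
      rw [h4]; abel
    have h5 := hH (g y) y
    rw [h3, inner_neg_left, hKt, hcompl _ _ h2, neg_zero, zero_add] at h5
    exact le_trans (by positivity) h5
  let S : U →L[ℝ] Y := (eA.symm : StrongDual ℝ Y →L[ℝ] Y) ∘L B
  let M : U →L[ℝ] U := κ⁻¹ • (Bt ∘L (eF.symm : StrongDual ℝ Y →L[ℝ] Y) ∘L H₂ ∘L
    (g.prod (ContinuousLinearMap.id ℝ Y)) ∘L S)
  have hMapp : ∀ u, M u = κ⁻¹ • Bt (eF.symm (H₂ (g (S u), S u))) := fun u => rfl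
  have hM : ∀ u, 0 ≤ inner ℝ (M u) u := by
    intro u
    rw [hMapp, inner_smul_left, hBt]
    have h1 : B u = A (S u) := (heA (B u)).symm
    have h2 : A (S u) (eF.symm (H₂ (g (S u), S u))) = H₂ (g (S u), S u) (S u) := by
      rw [← ContinuousLinearMap.flip_apply, heF]
    rw [h1, h2]
    have := hg (S u)
    simp only [conj_trivial]
    positivity
  rintro ⟨r1, r2, r3, r4, r5⟩
  let y₀ : Y := eA.symm r5
  let w₀ := eL.symm (r1, r4)
  -- The pair `(w₀, y₀)` carries the inhomogeneous data; the right-hand side is `r3` plus the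
  -- contribution of these data to `κ⁻¹ χ B* p`.
  obtain ⟨u, hu⟩ := surjective_id_add_projection_comp χ M hχ hχχ hM
    (r3 + κ⁻¹ • χ (Bt (eF.symm (r2 - H₂ (w₀.1 + g y₀, y₀)))))
  let y : Y := S u + y₀
  let w := w₀ + q y
  have hw : L w = (r1, r4) + (-H₁ (0, y), 0) := by
    change L (w₀ + q y) = _
    rw [map_add, heL, hq]
  refine ⟨(w.1, y, u, w.2, eF.symm (r2 - H₂ (w.1, y))), ?_⟩
  have k1 : H₁ (w.1, 0) + Kt w.2 = r1 + -H₁ (0, y) := congrArg Prod.fst hw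
  have k4 : WithLp.toLp 2 (fun j => if I j then K w.1 j else -w.2 j) = r4 := by
    have : WithLp.toLp 2 (fun j => if I j then K w.1 j else -w.2 j) = r4 + 0 :=
      congrArg Prod.snd hw
    rw [this, add_zero]
  refine Prod.ext ?_ (Prod.ext ?_ (Prod.ext ?_ (Prod.ext ?_ ?_)))
  · change H₁ (w.1, y) + Kt w.2 = r1
    have : (w.1, y) = (w.1, (0 : Y)) + (0, y) := by simp
    rw [this, map_add, add_right_comm, k1]; abel
  · change H₂ (w.1, y) + A.flip (eF.symm (r2 - H₂ (w.1, y))) = r2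
    rw [heF]; abel
  · change u - κ⁻¹ • χ (Bt (eF.symm (r2 - H₂ (w.1, y)))) = r3
    have h1 : (w.1, y) = (w₀.1 + g y₀, y₀) + (g (S u), S u) := by
      refine Prod.ext ?_ ?_
      · change (w₀ + q (S u + y₀)).1 = w₀.1 + (q y₀).1 + (q (S u)).1
        rw [map_add, Prod.fst_add, Prod.fst_add]; abel
      · change S u + y₀ = y₀ + S u
        abel
    have h2 : κ⁻¹ • χ (Bt (eF.symm (r2 - H₂ (w.1, y)))) =
        κ⁻¹ • χ (Bt (eF.symm (r2 - H₂ (w₀.1 + g y₀, y₀)))) - χ (M u) := by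
      rw [hMapp, h1, map_add, ← sub_sub]
      simp only [map_sub, map_smul, smul_sub]
    rw [h2, sub_sub_eq_add_sub, hu]; abel
  · exact k4
  · change A (S u + y₀) - B u = r5
    rw [map_add]
    change A (eA.symm (B u)) + A (eA.symm r5) - B u = r5
    rw [heA, heA]; abel

end Saddle

/-! ### Half-space descriptions of a simplex -/

section Simplex

variable {n : ℕ}

theorem affineMap_eq_sum_coord {V : Type*} [NormedAddCommGroup V] [NormedSpace ℝ V]
    {ι : Type*} [Fintype ι] (b : AffineBasis ι ℝ V) (g : V →ᵃ[ℝ] ℝ) (x : V) :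
    g x = ∑ i, b.coord i x * g (b i) := by
  have h := b.affineCombination_coord_eq_self x
  conv_lhs => rw [← h]
  rw [Finset.map_affineCombination _ _ _ (b.sum_coord_apply_eq_one x),
    Finset.affineCombination_eq_linear_combination _ _ _ (b.sum_coord_apply_eq_one x)]
  simp

/-- If finitely many affine inequalities describe a simplex of positive dimension, then each facet
is the zero set of one of the inequalities. -/
theorem exists_eq_mul_coord {V : Type*} [NormedAddCommGroup V] [NormedSpace ℝ V]
    {ι κ : Type*} [Fintype ι] [Fintype κ] [Nontrivial ι] (b : AffineBasis ι ℝ V)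
    (g : κ → V →ᵃ[ℝ] ℝ) (hg : ∀ x, (∀ i, 0 ≤ b.coord i x) ↔ ∀ j, 0 ≤ g j x) (i : ι) :
    ∃ j, ∃ c : ℝ, 0 < c ∧ ∀ x, g j x = c * b.coord i x := by
  classical
  -- `m` is the barycenter of the facet opposite to the vertex `i`
  set S : Finset ι := Finset.univ.erase i with hS
  have hSne : S.Nonempty := by
    obtain ⟨k, hk⟩ := exists_ne i
    exact ⟨k, by simp [hS, hk]⟩
  have hScard : (0 : ℝ) < S.card := by exact_mod_cast hSne.card_pos
  set w : ι → ℝ := fun k => if k = i then 0 else (S.card : ℝ)⁻¹ with hw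
  have hwsum : ∑ k, w k = 1 := by
    rw [← Finset.add_sum_erase _ _ (Finset.mem_univ i)]
    have : ∑ k ∈ S, w k = ∑ k ∈ S, (S.card : ℝ)⁻¹ :=
      Finset.sum_congr rfl fun k hk => if_neg (Finset.ne_of_mem_erase hk)
    rw [← hS, this, Finset.sum_const, nsmul_eq_mul, mul_inv_cancel₀ hScard.ne']
    simp [hw]
  set m : V := Finset.univ.affineCombination ℝ b w with hm
  have hmc : ∀ k, b.coord k m = w k := fun k =>
    b.coord_apply_combination_of_mem (Finset.mem_univ k) hwsum
  have hgm : ∀ j, 0 ≤ g j m := (hg m).1 fun k => by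
    rw [hmc]; simp only [hw]; split_ifs <;> positivity
  have hgv : ∀ j k, 0 ≤ g j (b k) := fun j k => (hg (b k)).1 (fun i' => by
    rw [b.coord_apply]; split_ifs <;> norm_num) j
  -- extend beyond the facet
  have hlin : ∀ (f : V →ᵃ[ℝ] ℝ) (t : ℝ), f (AffineMap.lineMap m (b i) (-t)) =
      f m - t * (f (b i) - f m) := fun f t => by
    rw [AffineMap.apply_lineMap, AffineMap.lineMap_apply]; simp; ring
  -- Moving from `m` away from the vertex `b i` makes the `i`-th coordinate `-t`, so the point
  -- leaves the simplex and violates some inequality.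
  have hout : ∀ t : ℝ, 0 < t → ∃ j, g j m - t * (g j (b i) - g j m) < 0 := by
    intro t ht
    by_contra hcon
    push Not at hcon
    have h1 : ∀ j, 0 ≤ g j (AffineMap.lineMap m (b i) (-t)) := fun j => by
      rw [hlin]; exact hcon j
    have h2 := (hg _).2 h1 i
    rw [hlin, hmc, b.coord_apply_eq] at h2
    simp [hw] at h2
    linarith
  -- Otherwise every inequality would persist for small `t > 0`, and since there are finitely many
  -- they would persist together, contradicting `hout`.
  have hzero : ∃ j, g j m = 0 ∧ 0 < g j (b i) := by
    by_contra hcon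
    push Not at hcon
    have hev : ∀ j, ∀ᶠ t : ℝ in 𝓝[>] 0, 0 ≤ g j m - t * (g j (b i) - g j m) := by
      intro j
      rcases (hgm j).eq_or_lt with h0 | h0
      · filter_upwards [self_mem_nhdsWithin] with t ht
        rw [← h0, sub_zero, zero_sub]
        have := hcon j h0.symm
        have ht' : (0 : ℝ) < t := ht
        nlinarith
      · have hc : Continuous fun t : ℝ => g j m - t * (g j (b i) - g j m) := by fun_prop
        have : ∀ᶠ t : ℝ in 𝓝 0, 0 < g j m - t * (g j (b i) - g j m) :=
          hc.continuousAt.eventually (lt_mem_nhds (by simpa using h0))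
        exact (this.filter_mono nhdsWithin_le_nhds).mono fun t => le_of_lt
    obtain ⟨t, ht, ht0⟩ := ((Filter.eventually_all.2 hev).and self_mem_nhdsWithin).exists
    obtain ⟨j, hj⟩ := hout t ht0
    exact absurd (ht j) (not_le.2 hj)
  obtain ⟨j, hj0, hj1⟩ := hzero
  refine ⟨j, g j (b i), hj1, fun x => ?_⟩
  -- `g j m` is an average with positive weights of the nonnegative values at the other vertices, so
  -- its vanishing forces each of them to vanish.
  have hvan : ∀ k, k ≠ i → g j (b k) = 0 := by
    intro k hk
    rw [affineMap_eq_sum_coord b] at hj0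
    have hnn : ∀ l ∈ Finset.univ, 0 ≤ b.coord l m * g j (b l) := fun l _ => by
      refine mul_nonneg ?_ (hgv j l)
      rw [hmc]; simp only [hw]; split_ifs <;> positivity
    have h1 := (Finset.sum_eq_zero_iff_of_nonneg hnn).1 hj0 k (Finset.mem_univ k)
    rw [hmc] at h1
    simp only [hw, if_neg hk] at h1
    exact (mul_eq_zero.1 h1).resolve_left (inv_ne_zero hScard.ne')
  rw [affineMap_eq_sum_coord b, Finset.sum_eq_single i (fun k _ hk => by rw [hvan k hk, mul_zero])
    (by simp), mul_comm]

/-- A description of a simplex by as many affine inequalities as there are facets consists of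
positive multiples of the barycentric coordinates. -/
theorem exists_perm_eq_mul_coord {V : Type*} [NormedAddCommGroup V] [NormedSpace ℝ V]
    {ι : Type*} [Fintype ι] [Nontrivial ι] (b : AffineBasis ι ℝ V)
    (g : ι → V →ᵃ[ℝ] ℝ) (hg : ∀ x, (∀ i, 0 ≤ b.coord i x) ↔ ∀ j, 0 ≤ g j x) :
    ∃ π : Equiv.Perm ι, ∃ c : ι → ℝ, (∀ j, 0 < c j) ∧ ∀ j x, g j x = c j * b.coord (π j) x := by
  classical
  choose τ c hc hτ using exists_eq_mul_coord b g hg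
  -- An inequality assigned to two facets `i ≠ i'` would be both positive and zero at the vertex `b
  -- i`.
  have hinj : Function.Injective τ := by
    intro i i' h
    by_contra hne
    have h1 := hτ i (b i)
    have h2 := hτ i' (b i)
    rw [b.coord_apply_eq] at h1
    rw [b.coord_apply_ne (Ne.symm hne), ← h, h1] at h2
    have := hc i
    linarith
  let e : Equiv.Perm ι := Equiv.ofBijective τ (Finite.injective_iff_bijective.1 hinj)
  refine ⟨e.symm, fun j => c (e.symm j), fun j => hc _, fun j x => ?_⟩
  have := hτ (e.symm j) x
  rwa [show τ (e.symm j) = j from e.apply_symm_apply j] at this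

end Simplex

/-! ### Semismoothness of the pointwise projection -/

section Clamp

/-- The pointwise linearization error of the projection onto `[a, b]`. -/
theorem abs_clamp_sub_le {a b w v : ℝ} (hab : a ≤ b) :
    |((w ⊔ a) ⊓ b) - ((v ⊔ a) ⊓ b) - (if a ≤ w ∧ w ≤ b then w - v else 0)| ≤
      if (0 < |v - a| ∧ |v - a| ≤ |w - v|) ∨ (0 < |v - b| ∧ |v - b| ≤ |w - v|) then |w - v|
      else 0 := by
  -- The error can be nonzero only if a bound lies between `v` and `w` and `v` is strictly off that
  -- bound. Excluding `v` on the bound is essential, because the set where this happens may have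
  -- positive measure.
  rcases lt_or_ge w a with h1 | h1
  · rw [sup_eq_right.2 h1.le, inf_eq_left.2 hab, if_neg (fun h => absurd h.1 (not_le.2 h1)),
      sub_zero]
    rcases le_or_gt v a with h2 | h2
    · rw [sup_eq_right.2 h2, inf_eq_left.2 hab, sub_self, abs_zero]
      split_ifs <;> positivity
    · rw [sup_eq_left.2 h2.le, if_pos (Or.inl ?_), abs_of_nonpos, abs_of_neg (by linarith)]
      · have := inf_le_left (a := v) (b := b)
        linarith
      · rw [sub_nonpos]; exact le_inf h2.le hab
      · rw [abs_of_pos (by linarith), abs_of_neg (by linarith)]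
        constructor <;> linarith
  · rw [sup_eq_left.2 h1]
    rcases le_or_gt w b with h2 | h2
    · rw [inf_eq_left.2 h2, if_pos ⟨h1, h2⟩]
      rcases lt_or_ge v a with h3 | h3
      · rw [sup_eq_right.2 h3.le, inf_eq_left.2 hab, if_pos (Or.inl ?_)]
        · rw [abs_of_pos (a := w - v) (by linarith), abs_le]
          constructor <;> linarith
        · rw [abs_of_neg (by linarith), abs_of_pos (by linarith)]
          constructor <;> linarith
      · rw [sup_eq_left.2 h3]
        rcases le_or_gt v b with h4 | h4
        · rw [inf_eq_left.2 h4, sub_self, abs_zero]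
          split_ifs <;> positivity
        · rw [inf_eq_right.2 h4.le, if_pos (Or.inr ?_)]
          · rw [abs_of_neg (a := w - v) (by linarith), abs_le]
            constructor <;> linarith
          · rw [abs_of_pos (by linarith), abs_of_neg (by linarith)]
            constructor <;> linarith
    · rw [inf_eq_right.2 h2.le, if_neg (fun h => absurd h.2 (not_le.2 h2)), sub_zero]
      rcases le_or_gt b v with h3 | h3
      · rw [inf_eq_right.2 (h3.trans le_sup_left), sub_self, abs_zero]
        split_ifs <;> positivity
      · rw [inf_eq_left.2 (sup_le h3.le hab), if_pos (Or.inr ?_)]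
        · have := le_sup_left (a := v) (b := a)
          have := sup_le h3.le hab
          rw [abs_of_pos (a := w - v) (by linarith), abs_le]
          constructor <;> linarith
        · rw [abs_of_neg (by linarith), abs_of_pos (by linarith)]
          constructor <;> linarith

/-! ### Cutoffs on `L²` and semismoothness from a norm gap. -/

variable {α : Type*} [MeasurableSpace α] {μ : Measure α}

/-- The product of `v` and the characteristic function of `E`. -/
noncomputable def cutoffFun {E : Set α} (hE : MeasurableSet E) (v : Lp ℝ 2 μ) : Lp ℝ 2 μ :=
  ((Lp.memLp v).indicator hE).toLp

theorem cutoffFun_coeFn {E : Set α} (hE : MeasurableSet E) (v : Lp ℝ 2 μ) :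
    (cutoffFun hE v : α → ℝ) =ᵐ[μ] E.indicator (v : α → ℝ) := by
  unfold cutoffFun
  exact MemLp.coeFn_toLp _

theorem cutoffFun_add {E : Set α} (hE : MeasurableSet E) (v w : Lp ℝ 2 μ) :
    cutoffFun hE (v + w) = cutoffFun hE v + cutoffFun hE w := by
  refine Lp.ext ?_
  filter_upwards [cutoffFun_coeFn hE (v + w), cutoffFun_coeFn hE v, cutoffFun_coeFn hE w,
    Lp.coeFn_add (cutoffFun hE v) (cutoffFun hE w), Lp.coeFn_add v w] with x h1 h2 h3 h4 h5
  rw [h1, h4, Pi.add_apply, h2, h3]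
  by_cases hx : x ∈ E
  · simp only [Set.indicator_of_mem hx, h5, Pi.add_apply]
  · simp [hx]

theorem cutoffFun_smul {E : Set α} (hE : MeasurableSet E) (c : ℝ) (v : Lp ℝ 2 μ) :
    cutoffFun hE (c • v) = c • cutoffFun hE v := by
  refine Lp.ext ?_
  filter_upwards [cutoffFun_coeFn hE (c • v), cutoffFun_coeFn hE v,
    Lp.coeFn_smul c (cutoffFun hE v), Lp.coeFn_smul c v] with x h1 h2 h4 h5
  rw [h1, h4, Pi.smul_apply, h2]
  by_cases hx : x ∈ E
  · simp only [Set.indicator_of_mem hx, h5, Pi.smul_apply]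
  · simp [hx]

theorem norm_cutoffFun_le {E : Set α} (hE : MeasurableSet E) (v : Lp ℝ 2 μ) :
    ‖cutoffFun hE v‖ ≤ 1 * ‖v‖ := by
  rw [one_mul]
  refine Lp.norm_le_norm_of_ae_le ?_
  filter_upwards [cutoffFun_coeFn hE v] with x h1
  rw [h1]
  exact norm_indicator_le_norm_self _ _

/-- Multiplication by the characteristic function of `E` on `L²`. -/
noncomputable def cutoff (μ : Measure α) {E : Set α} (hE : MeasurableSet E) :
    Lp ℝ 2 μ →L[ℝ] Lp ℝ 2 μ :=
  LinearMap.mkContinuous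
    { toFun := cutoffFun hE
      map_add' := cutoffFun_add hE
      map_smul' := cutoffFun_smul hE } 1 (norm_cutoffFun_le hE)

theorem cutoff_coeFn {E : Set α} (hE : MeasurableSet E) (v : Lp ℝ 2 μ) :
    (cutoff μ hE v : α → ℝ) =ᵐ[μ] E.indicator (v : α → ℝ) :=
  cutoffFun_coeFn hE v

theorem inner_cutoff {E : Set α} (hE : MeasurableSet E) (u v : Lp ℝ 2 μ) :
    inner ℝ (cutoff μ hE u) v = inner ℝ u (cutoff μ hE v) := by
  rw [L2.inner_def, L2.inner_def]
  refine integral_congr_ae ?_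
  filter_upwards [cutoff_coeFn hE u, cutoff_coeFn hE v] with x h1 h2
  rw [h1, h2]
  by_cases hx : x ∈ E <;> simp [hx]

theorem cutoff_cutoff {E : Set α} (hE : MeasurableSet E) (u : Lp ℝ 2 μ) :
    cutoff μ hE (cutoff μ hE u) = cutoff μ hE u := by
  refine Lp.ext ?_
  filter_upwards [cutoff_coeFn hE u, cutoff_coeFn hE (cutoff μ hE u)] with x h1 h2
  rw [h2]
  by_cases hx : x ∈ E <;> simp [hx, h1]

/-- Split at a level `ε`. The sets `0 < |g| < ε` shrink to the empty set as `ε → 0`, so their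
measure is small by finiteness of `μ`; the sets `ε ≤ |d|` are small because convergence in `L²`
implies convergence in measure. -/
theorem tendsto_measure_abs_le [IsFiniteMeasure μ] {g : α → ℝ} (hg : Measurable g) :
    Tendsto (fun d : Lp ℝ 2 μ => μ {x | 0 < |g x| ∧ |g x| ≤ |d x|}) (𝓝 0) (𝓝 0) := by
  rw [ENNReal.tendsto_nhds_zero]
  intro η hη
  have hη2 : 0 < η / 2 := ENNReal.half_pos hη.ne'
  obtain ⟨ε, hε, hsmall⟩ : ∃ ε : ℝ, 0 < ε ∧ μ {x | 0 < |g x| ∧ |g x| < ε} ≤ η / 2 := by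
    have hanti : Antitone fun k : ℕ => {x | 0 < |g x| ∧ |g x| < 1 / ((k : ℝ) + 1)} := by
      intro k k' hk x hx
      refine ⟨hx.1, hx.2.trans_le ?_⟩
      have : (k : ℝ) ≤ k' := by exact_mod_cast hk
      gcongr
    have hmeas : ∀ k : ℕ, NullMeasurableSet {x | 0 < |g x| ∧ |g x| < 1 / ((k : ℝ) + 1)} μ :=
      fun k => ((measurableSet_lt measurable_const hg.abs).inter
        (measurableSet_lt hg.abs measurable_const)).nullMeasurableSet
    have hlim := tendsto_measure_iInter_atTop hmeas hanti ⟨0, measure_ne_top _ _⟩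
    have hempty : ⋂ k : ℕ, {x | 0 < |g x| ∧ |g x| < 1 / ((k : ℝ) + 1)} = ∅ := by
      ext x
      simp only [Set.mem_iInter, Set.mem_ofPred_eq, Set.mem_empty_iff_false, iff_false]
      intro h
      obtain ⟨k, hk⟩ := exists_nat_one_div_lt (h 0).1
      exact absurd (h k).2 (not_lt.2 hk.le)
    rw [hempty, measure_empty] at hlim
    obtain ⟨k, hk⟩ := ((ENNReal.tendsto_nhds_zero.1 hlim) _ hη2).exists
    exact ⟨1 / ((k : ℝ) + 1), by positivity, hk⟩
  have hcheb := (tendstoInMeasure_of_tendsto_Lp (μ := μ) (p := 2) (f := fun d : Lp ℝ 2 μ => d)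
    (g := 0) tendsto_id) (ENNReal.ofReal ε) (ENNReal.ofReal_pos.2 hε)
  filter_upwards [(ENNReal.tendsto_nhds_zero.1 hcheb) _ hη2] with d hd
  have hsub : {x | 0 < |g x| ∧ |g x| ≤ |d x|} ⊆
      {x | 0 < |g x| ∧ |g x| < ε} ∪ {x | ε ≤ |d x|} := by
    intro x hx
    rcases lt_or_ge |g x| ε with h | h
    · exact Or.inl ⟨hx.1, h⟩
    · exact Or.inr (h.trans hx.2)
  have hd' : μ {x | ε ≤ |d x|} ≤ η / 2 := by
    refine le_trans (le_of_eq (measure_congr ?_)) hd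
    filter_upwards [Lp.coeFn_zero ℝ 2 μ] with x hx
    refine propext ?_
    change ε ≤ |d x| ↔ ENNReal.ofReal ε ≤ edist (d x) ((0 : Lp ℝ 2 μ) x)
    rw [hx, Pi.zero_apply, edist_dist, Real.dist_eq, sub_zero,
      ENNReal.ofReal_le_ofReal_iff (abs_nonneg _)]
  calc _ ≤ _ := measure_mono hsub
    _ ≤ _ := measure_union_le _ _
    _ ≤ η / 2 + η / 2 := add_le_add hsmall hd'
    _ = η := ENNReal.add_halves η

/-- The projection onto an order interval of `L²`, composed with an affine map whose linear part
satisfies a norm gap condition, is semismooth. -/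
theorem clamp_isLittleO [IsFiniteMeasure μ] {P : Type*} [NormedAddCommGroup P] [NormedSpace ℝ P]
    {a b : Lp ℝ 2 μ} (hab : ∀ᵐ x ∂μ, a x ≤ b x) (G : P →L[ℝ] Lp ℝ 2 μ) {C s : ℝ} (hs : 0 < s)
    (hgap : ∀ (p : P) {E : Set α} (hE : MeasurableSet E),
      ‖cutoff μ hE (G p)‖ ≤ C * (μ E).toReal ^ s * ‖p‖)
    (w : P → Lp ℝ 2 μ) (pbar : P) (hw : ∀ p, w p = w pbar + G (p - pbar))
    (hm : ∀ p, MeasurableSet {x | a x ≤ w p x ∧ w p x ≤ b x}) :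
    (fun p => (w p ⊔ a) ⊓ b - (w pbar ⊔ a) ⊓ b - cutoff μ (hm p) (G (p - pbar)))
      =o[𝓝 pbar] fun p => p - pbar := by
  set g₁ : α → ℝ := fun x => w pbar x - a x with hg₁
  set g₂ : α → ℝ := fun x => w pbar x - b x with hg₂
  have hmeas : ∀ v : Lp ℝ 2 μ, Measurable v := fun v => (Lp.stronglyMeasurable v).measurable
  have hmg₁ : Measurable g₁ := (hmeas _).sub (hmeas _)
  have hmg₂ : Measurable g₂ := (hmeas _).sub (hmeas _)
  let E : P → Set α := fun p => {x | 0 < |g₁ x| ∧ |g₁ x| ≤ |G (p - pbar) x|} ∪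
    {x | 0 < |g₂ x| ∧ |g₂ x| ≤ |G (p - pbar) x|}
  have hE : ∀ p, MeasurableSet (E p) := fun p =>
    ((measurableSet_lt measurable_const hmg₁.abs).inter
      (measurableSet_le hmg₁.abs (hmeas _).abs)).union
    ((measurableSet_lt measurable_const hmg₂.abs).inter
      (measurableSet_le hmg₂.abs (hmeas _).abs))
  have hGt : Tendsto (fun p => G (p - pbar)) (𝓝 pbar) (𝓝 0) := by
    have : Continuous fun p => G (p - pbar) := by fun_prop
    simpa using this.tendsto pbar
  have hEt : Tendsto (fun p => μ (E p)) (𝓝 pbar) (𝓝 0) := by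
    refine tendsto_of_tendsto_of_tendsto_of_le_of_le tendsto_const_nhds ?_ (fun _ => zero_le)
      (fun p => measure_union_le _ _)
    have := ((tendsto_measure_abs_le (μ := μ) hmg₁).comp hGt).add
      ((tendsto_measure_abs_le (μ := μ) hmg₂).comp hGt)
    simpa using this
  have hct : Tendsto (fun p => C * (μ (E p)).toReal ^ s) (𝓝 pbar) (𝓝 0) := by
    have h1 : Tendsto (fun p => (μ (E p)).toReal) (𝓝 pbar) (𝓝 0) := by
      exact (ENNReal.tendsto_toReal ENNReal.zero_ne_top).comp hEt
    have h2 := (h1.rpow_const (p := s) (Or.inr hs.le)).const_mul C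
    simpa [Real.zero_rpow hs.ne'] using h2
  -- Pointwise the error is at most `|G (p - pbar)|` on `E p` and zero elsewhere, so the gap
  -- estimate applies to the set `E p`.
  have hbound : ∀ p, ‖(w p ⊔ a) ⊓ b - (w pbar ⊔ a) ⊓ b - cutoff μ (hm p) (G (p - pbar))‖ ≤
      C * (μ (E p)).toReal ^ s * ‖p - pbar‖ := by
    intro p
    refine le_trans (Lp.norm_le_norm_of_ae_le ?_) (hgap (p - pbar) (hE p))
    have hwp : w p =ᵐ[μ] fun x => w pbar x + G (p - pbar) x := by
      rw [hw p]; exact Lp.coeFn_add _ _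
    filter_upwards [hab, hwp, cutoff_coeFn (hm p) (G (p - pbar)),
      cutoff_coeFn (hE p) (G (p - pbar)),
      Lp.coeFn_sub ((w p ⊔ a) ⊓ b - (w pbar ⊔ a) ⊓ b) (cutoff μ (hm p) (G (p - pbar))),
      Lp.coeFn_sub ((w p ⊔ a) ⊓ b) ((w pbar ⊔ a) ⊓ b), Lp.coeFn_inf (w p ⊔ a) b,
      Lp.coeFn_inf (w pbar ⊔ a) b, Lp.coeFn_sup (w p) a, Lp.coeFn_sup (w pbar) a]
      with x h0 h1 h2 h3 h4 h5 h6 h7 h8 h9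
    have hd : G (p - pbar) x = w p x - w pbar x := by rw [h1]; ring
    rw [h4, Pi.sub_apply, h5, Pi.sub_apply, h6, h7, Pi.inf_apply, Pi.inf_apply, h8, h9,
      Pi.sup_apply, Pi.sup_apply, h2, h3, Set.indicator_apply, Set.indicator_apply]
    have key := abs_clamp_sub_le (w := w p x) (v := w pbar x) h0
    rw [← hd] at key
    have e1 : (x ∈ E p) = ((0 < |w pbar x - a x| ∧ |w pbar x - a x| ≤ |G (p - pbar) x|) ∨
      (0 < |w pbar x - b x| ∧ |w pbar x - b x| ≤ |G (p - pbar) x|)) := rfl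
    rw [Real.norm_eq_abs, Real.norm_eq_abs]
    refine key.trans (le_of_eq ?_)
    by_cases hx : x ∈ E p
    · rw [if_pos hx, if_pos (e1 ▸ hx)]
    · rw [if_neg hx, if_neg (e1 ▸ hx), abs_zero]
  rw [isLittleO_iff]
  intro ε hε
  filter_upwards [hct.eventually (ge_mem_nhds hε)] with p hp
  exact (hbound p).trans (by gcongr)

/-- The norm gap: if `G` is the adjoint of an operator that extends to `L^q` with `q < 2`, then the
restrictions of `G p` to small sets are small, uniformly for bounded `p`. -/
theorem norm_cutoff_le_of_extension [IsFiniteMeasure μ] {P : Type*} [NormedAddCommGroup P]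
    [NormedSpace ℝ P] {q : ℝ≥0∞} [Fact (1 ≤ q)] (hq : q ≤ 2) (B : Lp ℝ 2 μ →L[ℝ] StrongDual ℝ P)
    (Bq : Lp ℝ q μ →L[ℝ] StrongDual ℝ P)
    (hBq : ∀ (v : Lp ℝ q μ) (w : Lp ℝ 2 μ), (∀ᵐ x ∂μ, v x = w x) → Bq v = B w)
    (G : P → Lp ℝ 2 μ) (hG : ∀ p v, inner ℝ (G p) v = B v p) (p : P) {E : Set α}
    (hE : MeasurableSet E) :
    ‖cutoff μ hE (G p)‖ ≤ ‖Bq‖ * (μ E).toReal ^ (1 / q.toReal - 1 / 2) * ‖p‖ := by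
  set v := cutoff μ hE (G p) with hv
  have hvq : MemLp v q μ := (Lp.memLp v).mono_exponent hq
  -- Duality with the test function `v` itself. As `v` lives on `E`, Hölder bounds its `L^q` norm by
  -- its `L²` norm times a power of the measure of `E`, and one factor `‖v‖` cancels.
  have h1 : ‖v‖ ^ 2 ≤ ‖Bq‖ * ‖hvq.toLp‖ * ‖p‖ := by
    have e1 : ‖v‖ ^ 2 = Bq hvq.toLp p := by
      rw [hBq _ v hvq.coeFn_toLp, ← hG, ← real_inner_self_eq_norm_sq, hv, inner_cutoff,
        cutoff_cutoff]
    rw [e1]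
    refine (le_abs_self _).trans (((Bq hvq.toLp).le_opNorm p).trans ?_)
    gcongr
    exact Bq.le_opNorm _
  have h2 : ‖hvq.toLp‖ ≤ ‖v‖ * (μ E).toReal ^ (1 / q.toReal - 1 / 2) := by
    have e1 : v =ᵐ[μ] E.indicator v := by
      have := cutoff_coeFn hE v
      rwa [hv, cutoff_cutoff, ← hv] at this
    have e2 : eLpNorm v q μ ≤ eLpNorm v 2 μ * μ E ^ (1 / q.toReal - 1 / 2) := by
      have := eLpNorm_le_eLpNorm_mul_rpow_measure_univ (μ := μ.restrict E) hq
        (Lp.aestronglyMeasurable v).restrict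
      rw [← eLpNorm_indicator_eq_eLpNorm_restrict hE, ← eLpNorm_indicator_eq_eLpNorm_restrict hE,
        ← eLpNorm_congr_ae e1, ← eLpNorm_congr_ae e1] at this
      simpa using this
    have hexp : 0 ≤ 1 / q.toReal - 1 / 2 := by
      have h0 : 0 < q.toReal := ENNReal.toReal_pos
        (zero_lt_one.trans_le (Fact.out : 1 ≤ q)).ne' (ne_top_of_le_ne_top (by simp) hq)
      have h3 : q.toReal ≤ 2 := by
        simpa using ENNReal.toReal_mono (by simp) hq
      rw [sub_nonneg]
      exact one_div_le_one_div_of_le h0 h3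
    rw [Lp.norm_toLp, Lp.norm_def, ENNReal.toReal_rpow, ← ENNReal.toReal_mul]
    exact ENNReal.toReal_mono (ENNReal.mul_ne_top (Lp.eLpNorm_ne_top v)
      (ENNReal.rpow_ne_top_of_nonneg hexp (measure_ne_top _ _))) e2
  rcases (norm_nonneg v).eq_or_lt with h0 | h0
  · rw [← h0]; positivity
  · refine le_of_mul_le_mul_left ?_ h0
    calc ‖v‖ * ‖v‖ = ‖v‖ ^ 2 := (sq _).symm
      _ ≤ ‖Bq‖ * (‖v‖ * (μ E).toReal ^ (1 / q.toReal - 1 / 2)) * ‖p‖ := h1.trans (by gcongr)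
      _ = _ := by ring

end Clamp

/-! ### Derivatives -/

theorem hasGradientAt_sum_coord {n : ℕ} {g : Fin n → ℝ → ℝ} {g' : Fin n → ℝ} {β : Euc n}
    (hg : ∀ i, HasDerivAt (g i) (g' i) (β i)) :
    HasGradientAt (fun β : Euc n => ∑ i, g i (β i)) (WithLp.toLp 2 g') β := by
  rw [hasGradientAt_iff_hasFDerivAt]
  have h1 : ∀ i, HasFDerivAt (fun β : Euc n => g i (β i))
      (g' i • (EuclideanSpace.proj i : Euc n →L[ℝ] ℝ)) β := fun i =>
    (hg i).comp_hasFDerivAt β (EuclideanSpace.proj i : Euc n →L[ℝ] ℝ).hasFDerivAt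
  refine (HasFDerivAt.fun_sum fun i (_ : i ∈ Finset.univ) => h1 i).congr_fderiv ?_
  ext δ
  simp [PiLp.inner_apply, mul_comm]

theorem hasFDerivAt_norm_sub_sq {Y V : Type*} [NormedAddCommGroup Y] [NormedSpace ℝ Y]
    [NormedAddCommGroup V] [InnerProductSpace ℝ V] (T : Y →L[ℝ] V) (a : V) (y : Y) :
    HasFDerivAt (fun y => ‖T y - a‖ ^ 2) ((2 : ℝ) • (innerSL ℝ (T y - a)).comp T) y := by
  have h := (T.hasFDerivAt (x := y)).sub_const a
  refine h.norm_sq.congr_fderiv ?_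
  ext v
  simp

theorem hasGradientAt_norm_sub_sq {V : Type*} [NormedAddCommGroup V] [InnerProductSpace ℝ V]
    [CompleteSpace V] (a u : V) :
    HasGradientAt (fun u => ‖u - a‖ ^ 2) ((2 : ℝ) • (u - a)) u := by
  rw [hasGradientAt_iff_hasFDerivAt]
  refine (hasFDerivAt_norm_sub_sq (ContinuousLinearMap.id ℝ V) a u).congr_fderiv ?_
  ext v
  simp

theorem HasFDerivAt.hasDerivAt_clm_line {E F : Type*} [NormedAddCommGroup E] [NormedSpace ℝ E]
    [NormedAddCommGroup F] [NormedSpace ℝ F] {G : E → F} {G' : E →L[ℝ] F} {w : E}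
    (hG : HasFDerivAt G G' w) (d : E) (L : F →L[ℝ] ℝ) :
    HasDerivAt (fun t : ℝ => L (G (w + t • d))) (L (G' d)) 0 := by
  have hline : HasDerivAt (fun t : ℝ => w + t • d) d 0 := by
    simpa using ((hasDerivAt_id (0 : ℝ)).smul_const d).const_add w
  have hG0 : HasFDerivAt G G' (w + (0 : ℝ) • d) := by simpa using hG
  exact L.hasFDerivAt.comp_hasDerivAt (0 : ℝ) (hG0.comp_hasDerivAt (0 : ℝ) hline)

theorem hasDerivAt_const_div_two_mul {x : ℝ} (hx : 0 < x) (a : ℝ) :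
    HasDerivAt (fun t : ℝ => 1 / (2 * t) * a) (-(a / (2 * x ^ 2))) x := by
  have h : HasDerivAt (fun t : ℝ => (2 * t)) (2 * 1) x := (hasDerivAt_id x).const_mul 2
  have h2 := ((hasDerivAt_const x (1 : ℝ)).div h (by positivity)).mul_const a
  refine h2.congr_deriv ?_
  field_simp
  ring

theorem hasDerivAt_one_div_sq {x : ℝ} (hx : 0 < x) :
    HasDerivAt (fun t : ℝ => (1 / t) ^ 2) (-(2 / x ^ 3)) x := by
  simp only [one_div]
  refine ((hasDerivAt_inv hx.ne').pow 2).congr_deriv ?_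
  norm_num
  field_simp

namespace Data

variable {l n : ℕ} {Ω : Set (Euc l)} (D : Data Ω n)

/-- The gradient of the affine function `ξ`. -/
noncomputable def ξgrad : Euc n := gradient D.ξ 0

theorem ξ_eq_affine : ∃ g : Euc n →ᵃ[ℝ] ℝ, ∀ β, D.ξ β = g β := by
  refine ⟨∑ i, D.φ (D.vert i) • D.vert.coord i, fun β => ?_⟩
  have : ∀ s : Finset (Fin (n + 1)), (∑ i ∈ s, D.φ (D.vert i) • D.vert.coord i) β =
      ∑ i ∈ s, D.vert.coord i β * D.φ (D.vert i) := by
    intro s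
    induction s using Finset.cons_induction with
    | empty => simp
    | cons a s ha ih =>
      rw [Finset.sum_cons, Finset.sum_cons, ← ih]
      simp [mul_comm]
  rw [this]; rfl

theorem hasGradientAt_ξ (β : Euc n) : HasGradientAt D.ξ D.ξgrad β := by
  obtain ⟨g, hg⟩ := D.ξ_eq_affine
  have h1 : D.ξ = fun β => LinearMap.toContinuousLinearMap g.linear β + g 0 := by
    funext β
    rw [hg β]
    have := g.linearMap_vsub β 0
    simp at this
    simp [this]
  have h2 : ∀ β, HasFDerivAt D.ξ (LinearMap.toContinuousLinearMap g.linear) β := fun β => by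
    rw [h1]
    exact (ContinuousLinearMap.hasFDerivAt _).add_const _
  rw [hasGradientAt_iff_hasFDerivAt, ξgrad, gradient, (h2 0).fderiv,
    LinearIsometryEquiv.apply_symm_apply]
  exact h2 β

theorem continuous_ξ : Continuous D.ξ :=
  continuous_iff_continuousAt.2 fun β => (D.hasGradientAt_ξ β).continuousAt

/-- The explicit form of `h'_β`. -/
noncomputable def gradβ (w : Euc n × H01 Ω) : Euc n :=
  WithLp.toLp 2 (fun i => -(D.γ * ‖D.C i w.2 - D.yd i‖ ^ 2 / (2 * w.1 i ^ 2))
    - D.σβ / w.1 i ^ 3) - D.γ • D.ξgrad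

/-- The explicit form of `h'_y`. -/
noncomputable def dery (w : Euc n × H01 Ω) : Hm1 Ω :=
  (innerSL ℝ (H01.toL2 w.2 - D.ym)).comp H01.toL2 +
    ∑ i, (D.γ / w.1 i) • (innerSL ℝ (D.C i w.2 - D.yd i)).comp (D.C i)

variable {D} in
theorem hasGradientAt_lower {β : Euc n} (hβ : ∀ i, 0 < β i) (y : H01 Ω) :
    HasGradientAt (fun β : Euc n => ∑ i, 1 / (2 * β i) * ‖D.C i y - D.yd i‖ ^ 2)
      (WithLp.toLp 2 fun i => -(‖D.C i y - D.yd i‖ ^ 2 / (2 * β i ^ 2))) β :=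
  hasGradientAt_sum_coord (g := fun i t => 1 / (2 * t) * ‖D.C i y - D.yd i‖ ^ 2)
    fun i => hasDerivAt_const_div_two_mul (hβ i) _

theorem hasGradientAt_regularization {β : Euc n} (hβ : ∀ i, 0 < β i) :
    HasGradientAt (fun β : Euc n => ∑ i, (1 / β i) ^ 2)
      (WithLp.toLp 2 fun i => -(2 / β i ^ 3)) β :=
  hasGradientAt_sum_coord (g := fun _ t => (1 / t) ^ 2)
    fun i => hasDerivAt_one_div_sq (hβ i)

theorem hasGradientAt_h_β {β : Euc n} (hβ : ∀ i, 0 < β i) (y : H01 Ω) :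
    HasGradientAt (fun β' => D.h β' y) (D.gradβ (β, y)) β := by
  have h1 := (hasGradientAt_lower (D := D) hβ y).hasFDerivAt
  have h2 := (hasGradientAt_regularization hβ).hasFDerivAt
  have h3 := (D.hasGradientAt_ξ β).hasFDerivAt
  rw [hasGradientAt_iff_hasFDerivAt]
  refine ((((h1.sub h3).const_mul D.γ).const_add (1 / 2 * ‖y.toL2 - D.ym‖ ^ 2)).add
    (h2.const_mul (D.σβ / 2))).congr_fderiv ?_
  ext δ
  simp only [add_apply, smul_apply, sub_apply, InnerProductSpace.toDual_apply_apply, gradβ, inner_sub_left,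
    inner_smul_left, conj_trivial, smul_eq_mul]
  simp only [PiLp.inner_apply, RCLike.inner_apply, conj_trivial, mul_sub, Finset.mul_sum]
  rw [sub_add_eq_add_sub, ← Finset.sum_add_distrib]
  congr 1
  refine Finset.sum_congr rfl fun i _ => ?_
  ring

theorem hasFDerivAt_lower (β : Euc n) (y : H01 Ω) :
    HasFDerivAt (fun y : H01 Ω => ∑ i, 1 / (2 * β i) * ‖D.C i y - D.yd i‖ ^ 2)
      (∑ i, (1 / β i) • (innerSL ℝ (D.C i y - D.yd i)).comp (D.C i)) y := by
  refine HasFDerivAt.fun_sum fun i _ => ?_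
  refine ((hasFDerivAt_norm_sub_sq (D.C i) (D.yd i) y).const_mul _).congr_fderiv ?_
  rw [smul_smul]
  congr 1
  ring

theorem hasFDerivAt_h_y (β : Euc n) (y : H01 Ω) :
    HasFDerivAt (fun y' => D.h β y') (D.dery (β, y)) y := by
  have h1 := D.hasFDerivAt_lower β y
  have h2 := hasFDerivAt_norm_sub_sq (H01.toL2 (Ω := Ω)) D.ym y
  refine (((h2.const_mul (1 / 2)).add ((h1.sub_const (D.ξ β)).const_mul D.γ)).add_const
    _).congr_fderiv ?_
  rw [dery, smul_smul, Finset.smul_sum]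
  congr 1
  · norm_num
  · refine Finset.sum_congr rfl fun i _ => ?_
    rw [smul_smul]
    congr 1
    ring

theorem hβ_eq {β : Euc n} (hβ : ∀ i, 0 < β i) (y : H01 Ω) : D.hβ β y = D.gradβ (β, y) :=
  (D.hasGradientAt_h_β hβ y).gradient

theorem hy_eq (β : Euc n) (y : H01 Ω) : D.hy β y = D.dery (β, y) :=
  (D.hasFDerivAt_h_y β y).fderiv

theorem contDiffAt_gradβ {w : Euc n × H01 Ω} (hw : ∀ i, 0 < w.1 i) :
    ContDiffAt ℝ 2 D.gradβ w := by
  refine ContDiffAt.sub ?_ contDiffAt_const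
  rw [contDiffAt_euclidean]
  intro i
  have h1 : ContDiffAt ℝ 2 (fun w : Euc n × H01 Ω => w.1 i) w := by fun_prop
  have h2 : ContDiffAt ℝ 2 (fun w : Euc n × H01 Ω => ‖D.C i w.2 - D.yd i‖ ^ 2) w :=
    ContDiffAt.norm_sq ℝ (by fun_prop)
  have := (hw i).ne'
  refine ContDiffAt.sub (ContDiffAt.neg ((contDiffAt_const.mul h2).div
    (contDiffAt_const.mul (h1.pow 2)) (by positivity))) (contDiffAt_const.div (h1.pow 3)
      (by positivity))

theorem contDiffAt_dery {w : Euc n × H01 Ω} (hw : ∀ i, 0 < w.1 i) :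
    ContDiffAt ℝ 2 D.dery w := by
  refine ContDiffAt.add ?_ (ContDiffAt.sum fun i _ => ?_)
  · refine ContDiffAt.clm_comp ?_ contDiffAt_const
    exact (innerSL ℝ).contDiff.contDiffAt.comp w (by fun_prop)
  · have h1 : ContDiffAt ℝ 2 (fun w : Euc n × H01 Ω => w.1 i) w := by fun_prop
    refine ContDiffAt.smul (contDiffAt_const.div h1 (hw i).ne') ?_
    refine ContDiffAt.clm_comp ?_ contDiffAt_const
    exact (innerSL ℝ).contDiff.contDiffAt.comp w (by fun_prop)

/-- `h''_β` as a linear map in both variables. -/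
noncomputable def H₁ (w : Euc n × H01 Ω) : Euc n × H01 Ω →L[ℝ] Euc n := fderiv ℝ D.gradβ w

/-- `h''_y` as a linear map in both variables. -/
noncomputable def H₂ (w : Euc n × H01 Ω) : Euc n × H01 Ω →L[ℝ] Hm1 Ω := fderiv ℝ D.dery w

theorem isOpen_pos : IsOpen {β : Euc n | ∀ i, 0 < β i} := by
  simp only [Set.ofPred_forall]
  exact isOpen_iInter_of_finite fun i => isOpen_lt continuous_const (by fun_prop)

/-- The blocks are derivatives of `hβ`, which is known to agree with the smooth formula `gradβ` only
for positive `β`. Positivity is an open condition, so the derivatives agree as well, and the chain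
rule splits the joint derivative into partial ones. -/
theorem H₁_apply {β : Euc n} (hβ : ∀ i, 0 < β i) (y : H01 Ω) (δ : Euc n) (v : H01 Ω) :
    D.hββ β y δ + D.hβy β y v = D.H₁ (β, y) (δ, v) := by
  have hd : HasFDerivAt D.gradβ (D.H₁ (β, y)) (β, y) :=
    ((D.contDiffAt_gradβ (w := (β, y)) hβ).differentiableAt (by simp)).hasFDerivAt
  have h1 : D.hββ β y = (D.H₁ (β, y)).comp (ContinuousLinearMap.inl ℝ _ _) := by
    have h := hd.comp (f := fun e => (e, y)) β (hasFDerivAt_prodMk_left β y)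
    refine (h.congr_of_eventuallyEq ?_).fderiv
    filter_upwards [isOpen_pos.mem_nhds hβ] with β' hβ'
    exact D.hβ_eq hβ' y
  have h2 : D.hβy β y = (D.H₁ (β, y)).comp (ContinuousLinearMap.inr ℝ _ _) := by
    have h := hd.comp (f := fun v => (β, v)) y (hasFDerivAt_prodMk_right β y)
    refine (h.congr_of_eventuallyEq (Eventually.of_forall fun y' => ?_)).fderiv
    exact D.hβ_eq hβ y'
  rw [h1, h2]
  simp [← map_add]

theorem H₂_apply {β : Euc n} (hβ : ∀ i, 0 < β i) (y : H01 Ω) (δ : Euc n) (v : H01 Ω) :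
    D.hyβ β y δ + D.hyy β y v = D.H₂ (β, y) (δ, v) := by
  have hd : HasFDerivAt D.dery (D.H₂ (β, y)) (β, y) :=
    ((D.contDiffAt_dery (w := (β, y)) hβ).differentiableAt (by simp)).hasFDerivAt
  have h1 : D.hyβ β y = (D.H₂ (β, y)).comp (ContinuousLinearMap.inl ℝ _ _) := by
    have h := hd.comp (f := fun e => (e, y)) β (hasFDerivAt_prodMk_left β y)
    refine (h.congr_of_eventuallyEq (Eventually.of_forall fun β' => ?_)).fderiv
    exact D.hy_eq β' y
  have h2 : D.hyy β y = (D.H₂ (β, y)).comp (ContinuousLinearMap.inr ℝ _ _) := by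
    have h := hd.comp (f := fun v => (β, v)) y (hasFDerivAt_prodMk_right β y)
    refine (h.congr_of_eventuallyEq (Eventually.of_forall fun y' => ?_)).fderiv
    exact D.hy_eq β y'
  rw [h1, h2]
  simp [← map_add]

end Data

/-! ### The quadratic form of the second derivative of `h`. -/

/-- One summand of the first variation along a line `(β + t δ, y + t v)`. With the residual `r = C y
- yd`, the numbers `a`, `b`, `d` stand for `‖r‖²`, `⟨r, C v⟩`, `‖C v‖²`, and `k` for a component of
the gradient of `γ ξ`. -/
theorem hasDerivAt_energy_term {β : ℝ} (hβ : 0 < β) (γ σ k a b d δ : ℝ) :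
    HasDerivAt (fun t : ℝ => (-(γ * (a + 2 * t * b + t ^ 2 * d) / (2 * (β + t * δ) ^ 2))
        - σ / (β + t * δ) ^ 3 - k) * δ + γ / (β + t * δ) * (b + t * d))
      (γ / β * (a * (δ / β) ^ 2 - 2 * b * (δ / β) + d) + 3 * σ * δ ^ 2 / β ^ 4) 0 := by
  have e1 : HasDerivAt (fun t : ℝ => β + t * δ) δ 0 := by
    simpa using ((hasDerivAt_id (0 : ℝ)).mul_const δ).const_add β
  have e2 : HasDerivAt (fun t : ℝ => a + 2 * t * b + t ^ 2 * d) (2 * b) 0 := by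
    have h1 : HasDerivAt (fun t : ℝ => 2 * t * b) (2 * b) 0 := by
      simpa using ((hasDerivAt_id (0 : ℝ)).const_mul 2).mul_const b
    have h2 : HasDerivAt (fun t : ℝ => t ^ 2 * d) 0 0 := by
      simpa using ((hasDerivAt_id (0 : ℝ)).pow 2).mul_const d
    exact ((h1.const_add a).add h2).congr_deriv (add_zero _)
  have e3 : HasDerivAt (fun t : ℝ => b + t * d) d 0 := by
    simpa using ((hasDerivAt_id (0 : ℝ)).mul_const d).const_add b
  have n0 : β + 0 * δ ≠ 0 := by simpa using hβ.ne'
  have f1 := ((e2.const_mul γ).div ((e1.pow 2).const_mul 2) (by simpa using n0)).neg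
  have f2 := (hasDerivAt_const (0 : ℝ) σ).div (e1.pow 3) (pow_ne_zero 3 n0)
  have f3 := ((hasDerivAt_const (0 : ℝ) γ).div e1 n0).mul e3
  refine ((((f1.sub f2).sub_const k).mul_const δ).add f3).congr_deriv ?_
  simp
  field_simp
  ring

namespace Data

variable {l n : ℕ} {Ω : Set (Euc l)} (D : Data Ω n)

/-- The form is the derivative at `t = 0` of the first variation in direction `(δ, v)`, taken along
that direction. Uniqueness of derivatives then reduces it to the scalar computation per summand,
with no formula for the operators `H₁`, `H₂`. -/
theorem energy_eq {w : Euc n × H01 Ω} (hw : ∀ i, 0 < w.1 i) (δ : Euc n) (v : H01 Ω) :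
    inner ℝ (D.H₁ w (δ, v)) δ + D.H₂ w (δ, v) v =
      ‖v.toL2‖ ^ 2 + ∑ i, (D.γ / w.1 i * (‖D.C i w.2 - D.yd i‖ ^ 2 * (δ i / w.1 i) ^ 2
        - 2 * inner ℝ (D.C i w.2 - D.yd i) (D.C i v) * (δ i / w.1 i) + ‖D.C i v‖ ^ 2)
        + 3 * D.σβ * δ i ^ 2 / w.1 i ^ 4) := by
  have h1 : HasDerivAt (fun t : ℝ => inner ℝ (D.gradβ (w + t • (δ, v))) δ)
      (inner ℝ (D.H₁ w (δ, v)) δ) 0 := by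
    have hd : HasFDerivAt D.gradβ (D.H₁ w) w :=
      ((D.contDiffAt_gradβ hw).differentiableAt (by simp)).hasFDerivAt
    have h := HasFDerivAt.hasDerivAt_clm_line hd (δ, v) (innerSL ℝ δ)
    simp only [innerSL_apply_apply] at h
    simpa only [real_inner_comm δ] using h
  have h2 : HasDerivAt (fun t : ℝ => D.dery (w + t • (δ, v)) v) (D.H₂ w (δ, v) v) 0 := by
    have hd : HasFDerivAt D.dery (D.H₂ w) w :=
      ((D.contDiffAt_dery hw).differentiableAt (by simp)).hasFDerivAt
    exact HasFDerivAt.hasDerivAt_clm_line hd (δ, v) (ContinuousLinearMap.apply ℝ ℝ v)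
  have h3 : HasDerivAt (fun t : ℝ => inner ℝ (H01.toL2 (w.2 + t • v) - D.ym) (H01.toL2 v))
      (‖v.toL2‖ ^ 2) 0 := by
    have e : ∀ t : ℝ, inner ℝ (H01.toL2 (w.2 + t • v) - D.ym) (H01.toL2 v) =
        inner ℝ (H01.toL2 w.2 - D.ym) (H01.toL2 v) + t * ‖v.toL2‖ ^ 2 := fun t => by
      rw [map_add, map_smul, add_sub_right_comm, inner_add_left, inner_smul_left,
        real_inner_self_eq_norm_sq]
      simp
    simp_rw [e]
    simpa using ((hasDerivAt_id (0 : ℝ)).mul_const (‖v.toL2‖ ^ 2)).const_add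
      (inner ℝ (H01.toL2 w.2 - D.ym) (H01.toL2 v))
  have h4 := HasDerivAt.fun_sum fun i (_ : i ∈ Finset.univ) =>
    hasDerivAt_energy_term (hw i) D.γ D.σβ (D.γ * D.ξgrad i) (‖D.C i w.2 - D.yd i‖ ^ 2)
      (inner ℝ (D.C i w.2 - D.yd i) (D.C i v)) (‖D.C i v‖ ^ 2) (δ i)
  refine (h1.add h2).unique ((h3.add h4).congr_of_eventuallyEq (Eventually.of_forall fun t => ?_))
  have e1 : ∀ i, D.C i (w + t • (δ, v)).2 - D.yd i = (D.C i w.2 - D.yd i) + t • D.C i v :=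
    fun i => by simp; abel
  have e2 : ∀ i, ‖(D.C i w.2 - D.yd i) + t • D.C i v‖ ^ 2 = ‖D.C i w.2 - D.yd i‖ ^ 2 +
      2 * t * inner ℝ (D.C i w.2 - D.yd i) (D.C i v) + t ^ 2 * ‖D.C i v‖ ^ 2 := fun i => by
    rw [norm_add_sq_real, inner_smul_right, norm_smul, mul_pow, Real.norm_eq_abs, sq_abs]
    ring
  have e3 : ∀ i, inner ℝ ((D.C i w.2 - D.yd i) + t • D.C i v) (D.C i v) =
      inner ℝ (D.C i w.2 - D.yd i) (D.C i v) + t * ‖D.C i v‖ ^ 2 := fun i => by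
    rw [inner_add_left, inner_smul_left, real_inner_self_eq_norm_sq]; simp
  have e4 : inner ℝ (D.gradβ (w + t • (δ, v))) δ = ∑ i,
      (-(D.γ * ‖D.C i (w + t • (δ, v)).2 - D.yd i‖ ^ 2 / (2 * (w.1 i + t * δ i) ^ 2))
        - D.σβ / (w.1 i + t * δ i) ^ 3 - D.γ * D.ξgrad i) * δ i := by
    rw [PiLp.inner_apply]
    refine Finset.sum_congr rfl fun i _ => ?_
    simp [gradβ, mul_comm]
  have e5 : D.dery (w + t • (δ, v)) v = inner ℝ (H01.toL2 (w.2 + t • v) - D.ym) (H01.toL2 v) +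
      ∑ i, D.γ / (w.1 i + t * δ i) *
        inner ℝ (D.C i (w + t • (δ, v)).2 - D.yd i) (D.C i v) := by
    simp only [dery, add_apply, sum_apply, smul_apply, ContinuousLinearMap.comp_apply,
      innerSL_apply_apply, smul_eq_mul]
    rfl
  simp only [Pi.add_apply]
  rw [e4, e5, add_left_comm, ← Finset.sum_add_distrib]
  simp only [e1, e2, e3]

/-- Each bracket in the energy is the square `‖(δᵢ / βᵢ) r - Cᵢ v‖²` with `r` the residual.
Coercivity comes solely from the regularization of `β` and holds in `δ` only. -/
theorem energy_ge (hγ : 0 < D.γ) (hσβ : 0 < D.σβ) {R : ℝ} {w : Euc n × H01 Ω}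
    (hw : ∀ i, 0 < w.1 i) (hR : ∀ i, w.1 i ≤ R) (δ : Euc n) (v : H01 Ω) :
    3 * D.σβ / R ^ 4 * ‖δ‖ ^ 2 ≤ inner ℝ (D.H₁ w (δ, v)) δ + D.H₂ w (δ, v) v := by
  rw [D.energy_eq hw, EuclideanSpace.norm_sq_eq, Finset.mul_sum]
  refine le_add_of_nonneg_of_le (sq_nonneg _) (Finset.sum_le_sum fun i _ => ?_)
  have h1 : 0 ≤ ‖D.C i w.2 - D.yd i‖ ^ 2 * (δ i / w.1 i) ^ 2
        - 2 * inner ℝ (D.C i w.2 - D.yd i) (D.C i v) * (δ i / w.1 i) + ‖D.C i v‖ ^ 2 := by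
    have : ‖(δ i / w.1 i) • (D.C i w.2 - D.yd i) - D.C i v‖ ^ 2 =
        ‖D.C i w.2 - D.yd i‖ ^ 2 * (δ i / w.1 i) ^ 2
        - 2 * inner ℝ (D.C i w.2 - D.yd i) (D.C i v) * (δ i / w.1 i) + ‖D.C i v‖ ^ 2 := by
      rw [norm_sub_sq_real, inner_smul_left, norm_smul, mul_pow, Real.norm_eq_abs, sq_abs]
      simp; ring
    rw [← this]; positivity
  have h2 := hw i
  refine le_add_of_nonneg_of_le (mul_nonneg (by positivity) h1) ?_
  rw [Real.norm_eq_abs, sq_abs, div_mul_eq_mul_div]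
  gcongr
  exact hR i

end Data

/-! ### Existence and uniqueness of the solution -/

/-- A continuous, bounded below, strongly (midpoint) convex function has exactly one minimizer on a
closed set. -/
theorem existsUnique_minimizer {X : Type*} [NormedAddCommGroup X] [NormedSpace ℝ X]
    [CompleteSpace X] {S : Set X} (hne : S.Nonempty) (hcl : IsClosed S)
    (hconv : ∀ x ∈ S, ∀ y ∈ S, (2⁻¹ : ℝ) • (x + y) ∈ S) {J : X → ℝ} (hbdd : BddBelow (J '' S))
    (hcont : ContinuousOn J S) {c : ℝ} (hc : 0 < c)
    (hmid : ∀ x ∈ S, ∀ y ∈ S, J ((2⁻¹ : ℝ) • (x + y)) + c * ‖x - y‖ ^ 2 ≤ (J x + J y) / 2) :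
    ∃! x, x ∈ S ∧ ∀ y ∈ S, J x ≤ J y := by
  set m := sInf (J '' S) with hm
  have hm_le : ∀ x ∈ S, m ≤ J x := fun x hx => csInf_le hbdd ⟨x, hx, rfl⟩
  -- The midpoint is again in `S`, so its value is at least `m`. Two nearly optimal points must
  -- therefore be close, which gives both the Cauchy property and uniqueness.
  have hgap : ∀ x ∈ S, ∀ y ∈ S, c * ‖x - y‖ ^ 2 ≤ (J x + J y) / 2 - m := fun x hx y hy => by
    linarith [hmid x hx y hy, hm_le _ (hconv x hx y hy)]
  have hex : ∀ k : ℕ, ∃ x ∈ S, J x < m + 1 / ((k : ℝ) + 1) := fun k => by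
    obtain ⟨_, ⟨x, hx, rfl⟩, h⟩ := exists_lt_of_csInf_lt (hne.image J)
      (lt_add_of_pos_right m (Nat.one_div_pos_of_nat (α := ℝ) (n := k)))
    exact ⟨x, hx, h⟩
  choose x hxS hx using hex
  have hJ : Tendsto (fun k => J (x k)) atTop (𝓝 m) := by
    refine tendsto_of_tendsto_of_tendsto_of_le_of_le tendsto_const_nhds ?_
      (fun k => hm_le _ (hxS k)) (fun k => (hx k).le)
    simpa using tendsto_one_div_add_atTop_nhds_zero_nat.const_add m
  have hcauchy : CauchySeq x := by
    refine cauchySeq_of_le_tendsto_0 (fun N : ℕ => √(1 / ((N : ℝ) + 1) / c)) ?_ ?_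
    · intro j k N hj hk
      rw [dist_eq_norm]
      refine Real.le_sqrt_of_sq_le ?_
      rw [le_div_iff₀ hc, mul_comm]
      have e1 : 1 / ((j : ℝ) + 1) ≤ 1 / ((N : ℝ) + 1) := Nat.one_div_le_one_div hj
      have e2 : 1 / ((k : ℝ) + 1) ≤ 1 / ((N : ℝ) + 1) := Nat.one_div_le_one_div hk
      linarith [hgap _ (hxS j) _ (hxS k), hx j, hx k]
    · have := ((tendsto_one_div_add_atTop_nhds_zero_nat (𝕜 := ℝ)).div_const c).sqrt
      simpa using this
  obtain ⟨xb, hxb⟩ := cauchySeq_tendsto_of_complete hcauchy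
  have hxbS : xb ∈ S := hcl.mem_of_tendsto hxb (Eventually.of_forall hxS)
  have hJb : J xb = m := by
    have h1 : Tendsto x atTop (𝓝[S] xb) :=
      tendsto_nhdsWithin_iff.2 ⟨hxb, Eventually.of_forall hxS⟩
    exact tendsto_nhds_unique ((hcont xb hxbS).tendsto.comp h1) hJ
  refine ⟨xb, ⟨hxbS, fun y hy => hJb ▸ hm_le y hy⟩, ?_⟩
  rintro y ⟨hyS, hy⟩
  have h1 : J y = m := le_antisymm (hJb ▸ hy xb hxbS) (hm_le y hyS)
  have h2 := hgap y hyS xb hxbS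
  rw [h1, hJb] at h2
  have h3 : ‖y - xb‖ ^ 2 ≤ 0 := by
    by_contra hn
    have := mul_pos hc (not_le.1 hn)
    linarith
  have h4 : ‖y - xb‖ = 0 := by
    rw [← sq_eq_zero_iff]
    exact le_antisymm h3 (sq_nonneg _)
  exact sub_eq_zero.1 (norm_eq_zero.1 h4)

theorem norm_midpoint_sq {V : Type*} [NormedAddCommGroup V] [InnerProductSpace ℝ V] (a b : V) :
    ‖(2⁻¹ : ℝ) • (a + b)‖ ^ 2 + ‖a - b‖ ^ 2 / 4 = (‖a‖ ^ 2 + ‖b‖ ^ 2) / 2 := by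
  rw [norm_smul, mul_pow, norm_add_sq_real, norm_sub_sq_real]
  norm_num
  ring

/-- Joint convexity of `(a, s) ↦ ‖a‖² / (2 s)`: the defect is a positive multiple of `‖t a - s b‖²`.
-/
theorem norm_sq_div_midpoint_le {V : Type*} [NormedAddCommGroup V] [InnerProductSpace ℝ V]
    (a b : V) {s t : ℝ} (hs : 0 < s) (ht : 0 < t) :
    1 / (2 * (2⁻¹ * (s + t))) * ‖(2⁻¹ : ℝ) • (a + b)‖ ^ 2 ≤
      (1 / (2 * s) * ‖a‖ ^ 2 + 1 / (2 * t) * ‖b‖ ^ 2) / 2 := by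
  have h1 : ‖(2⁻¹ : ℝ) • (a + b)‖ ^ 2 = (‖a‖ ^ 2 + 2 * inner ℝ a b + ‖b‖ ^ 2) / 4 := by
    rw [norm_smul, mul_pow, norm_add_sq_real]
    norm_num
    ring
  have h2 : 0 ≤ ‖t • a - s • b‖ ^ 2 := sq_nonneg _
  rw [norm_sub_sq_real, inner_smul_left, inner_smul_right, norm_smul, norm_smul, mul_pow, mul_pow,
    Real.norm_eq_abs, Real.norm_eq_abs, sq_abs, sq_abs] at h2
  simp only [conj_trivial] at h2
  rw [h1]
  have h3 : (1 / (2 * s) * ‖a‖ ^ 2 + 1 / (2 * t) * ‖b‖ ^ 2) / 2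
      - 1 / (2 * (2⁻¹ * (s + t))) * ((‖a‖ ^ 2 + 2 * inner ℝ a b + ‖b‖ ^ 2) / 4) =
      (t ^ 2 * ‖a‖ ^ 2 - 2 * (t * (s * inner ℝ a b)) + s ^ 2 * ‖b‖ ^ 2) /
        (4 * s * t * (s + t)) := by
    field_simp
    ring
  rw [← sub_nonneg, h3]
  positivity

/-- By the arithmetic–geometric mean inequality the midpoint value is at most `1 / (s t)`. The gap
between this product and the mean of the squares is `(1/s - 1/t)² / 2 = (s - t)² / (2 s² t²)`. -/
theorem one_div_sq_midpoint_le {s t R : ℝ} (hs : 0 < s) (ht : 0 < t) (hsR : s ≤ R) (htR : t ≤ R) :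
    (1 / (2⁻¹ * (s + t))) ^ 2 + (s - t) ^ 2 / (2 * R ^ 4) ≤ ((1 / s) ^ 2 + (1 / t) ^ 2) / 2 := by
  have h1 : (1 / (2⁻¹ * (s + t))) ^ 2 ≤ (1 / s) * (1 / t) := by
    rw [div_pow, div_mul_div_comm, one_pow, one_mul]
    refine one_div_le_one_div_of_le (by positivity) ?_
    nlinarith [sq_nonneg (s - t)]
  have h2 : (s - t) ^ 2 / (2 * R ^ 4) ≤ (1 / s - 1 / t) ^ 2 / 2 := by
    have e : (1 / s - 1 / t) ^ 2 / 2 = (s - t) ^ 2 / (2 * (s ^ 2 * t ^ 2)) := by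
      field_simp
      ring
    rw [e]
    have h3 : s ^ 2 * t ^ 2 ≤ R ^ 4 := by
      calc s ^ 2 * t ^ 2 ≤ R ^ 2 * R ^ 2 := by gcongr
        _ = R ^ 4 := by ring
    gcongr
  nlinarith [h1, h2]

/-! ### Strong convexity of the penalty subproblem. -/

namespace Data

variable {l n : ℕ} {Ω : Set (Euc l)} (D : Data Ω n)

theorem pos_of_mem_Q (hbox : ∀ i, 0 < D.lo i ∧ D.lo i < D.hi i) {β : Euc n} (hβ : β ∈ D.Q)
    (i : Fin n) : 0 < β i :=
  (inv_pos.2 ((hbox i).1.trans (hbox i).2)).trans_le (hβ i).1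

theorem exists_bound_Q (hbox : ∀ i, 0 < D.lo i ∧ D.lo i < D.hi i) :
    ∃ R, 0 < R ∧ ∀ β ∈ D.Q, ∀ i, β i ≤ R := by
  have h0 : ∀ i, 0 ≤ (D.lo i)⁻¹ := fun i => (inv_pos.2 (hbox i).1).le
  refine ⟨1 + ∑ i, (D.lo i)⁻¹, by
    have := Finset.sum_nonneg fun i (_ : i ∈ Finset.univ) => h0 i
    linarith, fun β hβ i => ?_⟩
  have := Finset.single_le_sum (fun i _ => h0 i) (Finset.mem_univ i)
  linarith [(hβ i).2]

theorem ξ_midpoint (β β' : Euc n) : D.ξ ((2⁻¹ : ℝ) • (β + β')) = (D.ξ β + D.ξ β') / 2 := by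
  obtain ⟨g, hg⟩ := D.ξ_eq_affine
  have h := g.map_midpoint β β'
  rw [midpoint_eq_smul_add, midpoint_eq_smul_add, invOf_eq_inv] at h
  rw [hg, hg, hg, h, smul_eq_mul]
  ring

theorem Uad_eq_Icc : D.Uad = Set.Icc D.ua D.ub := by
  ext v
  rw [Set.mem_Icc, ← Lp.coeFn_le, ← Lp.coeFn_le]
  change (∀ᶠ x in ae (volume.restrict Ω), D.ua x ≤ v x ∧ v x ≤ D.ub x) ↔ _
  exact eventually_and

theorem isClosed_Uad : IsClosed D.Uad := D.Uad_eq_Icc ▸ isClosed_Icc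

theorem convex_Uad : Convex ℝ D.Uad := by
  intro v hv w hw a b ha hb hab
  have hv' : ∀ᵐ x ∂(volume.restrict Ω), D.ua x ≤ v x ∧ v x ≤ D.ub x := hv
  have hw' : ∀ᵐ x ∂(volume.restrict Ω), D.ua x ≤ w x ∧ w x ≤ D.ub x := hw
  change ∀ᵐ x ∂(volume.restrict Ω), _
  filter_upwards [hv', hw', Lp.coeFn_add (a • v) (b • w), Lp.coeFn_smul a v, Lp.coeFn_smul b w]
    with x h1 h2 h3 h4 h5
  rw [h3, Pi.add_apply, h4, h5, Pi.smul_apply, Pi.smul_apply]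
  exact (convex_Icc (D.ua x) (D.ub x)) h1 h2 ha hb hab

theorem isCompact_T : IsCompact D.T := (Set.finite_range D.vert).isCompact_convexHull ℝ

theorem midpoint_mem {V : Type*} [NormedAddCommGroup V] [NormedSpace ℝ V] {s : Set V}
    (hs : Convex ℝ s) {x y : V} (hx : x ∈ s) (hy : y ∈ s) : (2⁻¹ : ℝ) • (x + y) ∈ s := by
  rw [smul_add]
  exact hs hx hy (by norm_num) (by norm_num) (by norm_num)

/-- Convexity is added up term by term. The only quadratic gains kept come from the regularization
of `β` and from the upper-level control cost; there is none in `y`. -/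
theorem penaltyObjective_midpoint_le (hσl : 0 < D.σl) (hσβ : 0 < D.σβ)
    (hγ : 0 < D.γ) {R : ℝ} {x x' : Euc n × H01 Ω × L2 Ω} (hx : ∀ i, 0 < x.1 i)
    (hx' : ∀ i, 0 < x'.1 i) (hR : ∀ i, x.1 i ≤ R) (hR' : ∀ i, x'.1 i ≤ R) :
    D.penaltyObjective id ((2⁻¹ : ℝ) • (x + x')) + (D.σβ / (4 * R ^ 4) * ‖x.1 - x'.1‖ ^ 2 +
      D.σu / 8 * ‖x.2.2 - x'.2.2‖ ^ 2) ≤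
      (D.penaltyObjective id x + D.penaltyObjective id x') / 2 := by
  obtain ⟨β, y, u⟩ := x
  obtain ⟨β', y', u'⟩ := x'
  have haff : ∀ {V : Type} [NormedAddCommGroup V] [NormedSpace ℝ V] (a b c : V),
      (2⁻¹ : ℝ) • (a + b) - c = (2⁻¹ : ℝ) • ((a - c) + (b - c)) := fun a b c => by module
  have e1 : ‖H01.toL2 ((2⁻¹ : ℝ) • (y + y')) - D.ym‖ ^ 2 ≤
      (‖y.toL2 - D.ym‖ ^ 2 + ‖y'.toL2 - D.ym‖ ^ 2) / 2 := by
    rw [map_smul, map_add, haff]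
    linarith [norm_midpoint_sq (y.toL2 - D.ym) (y'.toL2 - D.ym),
      sq_nonneg ‖(y.toL2 - D.ym) - (y'.toL2 - D.ym)‖]
  have e2 : ‖(2⁻¹ : ℝ) • (u + u') - D.um‖ ^ 2 + ‖u - u'‖ ^ 2 / 4 =
      (‖u - D.um‖ ^ 2 + ‖u' - D.um‖ ^ 2) / 2 := by
    have := norm_midpoint_sq (u - D.um) (u' - D.um)
    rwa [sub_sub_sub_cancel_right, ← haff] at this
  have e3 : ‖(2⁻¹ : ℝ) • (u + u')‖ ^ 2 ≤ (‖u‖ ^ 2 + ‖u'‖ ^ 2) / 2 := by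
    linarith [norm_midpoint_sq u u', sq_nonneg ‖u - u'‖]
  have e4 : (∑ i, (1 / ((2⁻¹ : ℝ) • (β + β')) i) ^ 2) + ‖β - β'‖ ^ 2 / (2 * R ^ 4) ≤
      ((∑ i, (1 / β i) ^ 2) + ∑ i, (1 / β' i) ^ 2) / 2 := by
    rw [EuclideanSpace.norm_sq_eq, Finset.sum_div, ← Finset.sum_add_distrib,
      ← Finset.sum_add_distrib, Finset.sum_div]
    refine Finset.sum_le_sum fun i _ => ?_
    rw [Real.norm_eq_abs, sq_abs]
    exact one_div_sq_midpoint_le (hx i) (hx' i) (hR i) (hR' i)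
  have e5 : (∑ i, 1 / (2 * ((2⁻¹ : ℝ) • (β + β')) i) *
      ‖D.C i ((2⁻¹ : ℝ) • (y + y')) - D.yd i‖ ^ 2) ≤
      ((∑ i, 1 / (2 * β i) * ‖D.C i y - D.yd i‖ ^ 2) +
        ∑ i, 1 / (2 * β' i) * ‖D.C i y' - D.yd i‖ ^ 2) / 2 := by
    rw [← Finset.sum_add_distrib, Finset.sum_div]
    refine Finset.sum_le_sum fun i _ => ?_
    rw [map_smul, map_add, haff]
    exact norm_sq_div_midpoint_le _ _ (hx i) (hx' i)
  have e6 := D.ξ_midpoint β β'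
  change 1 / 2 * ‖H01.toL2 ((2⁻¹ : ℝ) • (y + y')) - D.ym‖ ^ 2
    + D.σu / 2 * ‖(2⁻¹ : ℝ) • (u + u') - D.um‖ ^ 2
    + D.σβ / 2 * (∑ i, (1 / ((2⁻¹ : ℝ) • (β + β')) i) ^ 2)
    + D.γ * ((∑ i, 1 / (2 * ((2⁻¹ : ℝ) • (β + β')) i) *
      ‖D.C i ((2⁻¹ : ℝ) • (y + y')) - D.yd i‖ ^ 2) + D.σl / 2 * ‖(2⁻¹ : ℝ) • (u + u')‖ ^ 2
      - D.ξ ((2⁻¹ : ℝ) • (β + β'))) +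
    (D.σβ / (4 * R ^ 4) * ‖β - β'‖ ^ 2 + D.σu / 8 * ‖u - u'‖ ^ 2) ≤
    ((1 / 2 * ‖y.toL2 - D.ym‖ ^ 2 + D.σu / 2 * ‖u - D.um‖ ^ 2 + D.σβ / 2 * (∑ i, (1 / β i) ^ 2)
      + D.γ * ((∑ i, 1 / (2 * β i) * ‖D.C i y - D.yd i‖ ^ 2) + D.σl / 2 * ‖u‖ ^ 2 - D.ξ β)) +
    (1 / 2 * ‖y'.toL2 - D.ym‖ ^ 2 + D.σu / 2 * ‖u' - D.um‖ ^ 2 + D.σβ / 2 * (∑ i, (1 / β' i) ^ 2)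
      + D.γ * ((∑ i, 1 / (2 * β' i) * ‖D.C i y' - D.yd i‖ ^ 2) + D.σl / 2 * ‖u'‖ ^ 2
        - D.ξ β'))) / 2
  rw [e6]
  have f2 := congrArg (fun t => D.σu / 2 * t) e2
  have f3 := mul_le_mul_of_nonneg_left e3 (mul_pos hγ (half_pos hσl)).le
  have f4 := mul_le_mul_of_nonneg_left e4 (half_pos hσβ).le
  have f5 := mul_le_mul_of_nonneg_left e5 hγ.le
  have f6 : D.σβ / (4 * R ^ 4) * ‖β - β'‖ ^ 2 = D.σβ / 2 * (‖β - β'‖ ^ 2 / (2 * R ^ 4)) := by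
    rw [div_mul_div_comm, div_mul_eq_mul_div]
    congr 1
    ring
  rw [f6]
  linarith

theorem continuousAt_penaltyObjective {x : Euc n × H01 Ω × L2 Ω} (hx : ∀ i, 0 < x.1 i) :
    ContinuousAt (D.penaltyObjective id) x := by
  have hξ : ContinuousAt (fun x : Euc n × H01 Ω × L2 Ω => D.ξ x.1) x :=
    (D.continuous_ξ.comp continuous_fst).continuousAt
  have hβ : ∀ i, ContinuousAt (fun x : Euc n × H01 Ω × L2 Ω => x.1 i) x := fun i => by fun_prop
  have h1 : ContinuousAt (fun x : Euc n × H01 Ω × L2 Ω => ∑ i, (1 / x.1 i) ^ 2) x :=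
    tendsto_finsetSum _ fun i _ => (continuousAt_const.div (hβ i) (hx i).ne').pow 2
  have h2 : ContinuousAt (fun x : Euc n × H01 Ω × L2 Ω => ∑ i, 1 / (2 * x.1 i) *
      ‖D.C i x.2.1 - D.yd i‖ ^ 2) x :=
    tendsto_finsetSum _ fun i _ => (continuousAt_const.div (continuousAt_const.mul (hβ i))
      (mul_ne_zero two_ne_zero (hx i).ne')).mul (by fun_prop)
  have h3 : ContinuousAt (fun x : Euc n × H01 Ω × L2 Ω => 1 / 2 * ‖x.2.1.toL2 - D.ym‖ ^ 2
      + D.σu / 2 * ‖x.2.2 - D.um‖ ^ 2) x := by fun_prop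
  have h4 : ContinuousAt (fun x : Euc n × H01 Ω × L2 Ω => D.σl / 2 * ‖x.2.2‖ ^ 2) x := by fun_prop
  exact (h3.add (h1.const_mul _)).add (((h2.add h4).sub hξ).const_mul _)

theorem existsUnique_isGlobalSolution (hσu : 0 < D.σu) (hσl : 0 < D.σl) (hσβ : 0 < D.σβ)
    (hγ : 0 < D.γ) (hbox : ∀ i, 0 < D.lo i ∧ D.lo i < D.hi i) (hUad : D.Uad.Nonempty)
    (hA : Function.Bijective D.A) (hTQ : D.T ⊆ D.Q) : ∃! s, D.IsGlobalSolution id s := by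
  obtain ⟨R, hR0, hR⟩ := D.exists_bound_Q hbox
  obtain ⟨a, ha0, ha⟩ := exists_bound_of_bijective D.A hA
  have hpos : ∀ x, D.Feasible x → ∀ i, 0 < x.1 i := fun x hx =>
    D.pos_of_mem_Q hbox (hTQ hx.1)
  set κ := a * ‖D.B‖ with hκ
  set c₁ := D.σβ / (4 * R ^ 4) with hc₁
  set c₂ := D.σu / 8 with hc₂
  have hc₁0 : 0 < c₁ := by positivity
  have hc₂0 : 0 < c₂ := by positivity
  -- Feasible differences satisfy `‖y - y'‖ ≤ κ ‖u - u'‖` by the state equation, so the gain in `u`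
  -- is shared between `u` and `y`.
  set c := min c₁ (c₂ / (1 + κ ^ 2)) with hc
  have hc0 : 0 < c := lt_min hc₁0 (by positivity)
  refine existsUnique_minimizer (S := {x | D.Feasible x}) (J := D.penaltyObjective id) (c := c)
    ?_ ?_ ?_ ?_ ?_ hc0 ?_
  · obtain ⟨u, hu⟩ := hUad
    obtain ⟨y, hy⟩ := hA.2 (D.B u)
    exact ⟨(D.vert 0, y, u), subset_convexHull ℝ _ ⟨0, rfl⟩, sub_eq_zero.2 hy, hu⟩
  · refine (D.isCompact_T.isClosed.preimage continuous_fst).inter (IsClosed.inter ?_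
      (D.isClosed_Uad.preimage (continuous_snd.comp continuous_snd)))
    exact isClosed_eq (by fun_prop) continuous_const
  · rintro x hx y hy
    refine ⟨midpoint_mem (convex_convexHull ℝ _) hx.1 hy.1, ?_,
      midpoint_mem D.convex_Uad hx.2.2 hy.2.2⟩
    change D.A ((2⁻¹ : ℝ) • (x.2.1 + y.2.1)) - D.B ((2⁻¹ : ℝ) • (x.2.2 + y.2.2)) = 0
    rw [map_smul, map_smul, map_add, map_add, sub_eq_zero.1 hx.2.1, sub_eq_zero.1 hy.2.1, sub_self]
  · obtain ⟨M, hM⟩ := D.isCompact_T.bddAbove_image D.continuous_ξ.continuousOn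
    refine ⟨-(D.γ * M), ?_⟩
    rintro _ ⟨x, hx, rfl⟩
    have h1 : D.ξ x.1 ≤ M := hM ⟨x.1, hx.1, rfl⟩
    have h2 : 0 ≤ D.F x.1 x.2.1 x.2.2 := by unfold F; positivity
    have h3 : 0 ≤ D.f x.1 x.2.1 x.2.2 := by
      have := hpos x hx
      exact add_nonneg (Finset.sum_nonneg fun i _ => by have := this i; positivity) (by positivity)
    change _ ≤ D.F x.1 x.2.1 x.2.2 + D.γ * (D.f x.1 x.2.1 x.2.2 - D.ξ x.1)
    nlinarith
  · exact fun x hx => (D.continuousAt_penaltyObjective (hpos x hx)).continuousWithinAt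
  · intro x hx x' hx'
    refine le_trans ?_ (D.penaltyObjective_midpoint_le hσl hσβ hγ (hpos x hx) (hpos x' hx')
      (hR _ (hTQ hx.1)) (hR _ (hTQ hx'.1)))
    gcongr
    have hy : ‖x.2.1 - x'.2.1‖ ≤ κ * ‖x.2.2 - x'.2.2‖ := by
      refine (ha _).trans ?_
      have : D.A (x.2.1 - x'.2.1) = D.B (x.2.2 - x'.2.2) := by
        rw [map_sub, map_sub, sub_eq_zero.1 hx.2.1, sub_eq_zero.1 hx'.2.1]
      rw [this, hκ, mul_assoc]
      gcongr
      exact D.B.le_opNorm _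
    have h1 : c * ‖x.1 - x'.1‖ ^ 2 ≤ c₁ * ‖x.1 - x'.1‖ ^ 2 := by
      gcongr; exact min_le_left _ _
    have h2 : c * ((1 + κ ^ 2) * ‖x.2.2 - x'.2.2‖ ^ 2) ≤ c₂ * ‖x.2.2 - x'.2.2‖ ^ 2 := by
      rw [← mul_assoc]
      gcongr
      exact (le_div_iff₀ (by positivity)).1 (min_le_right _ _)
    have h3 : ‖x - x'‖ ^ 2 ≤ ‖x.1 - x'.1‖ ^ 2 + (1 + κ ^ 2) * ‖x.2.2 - x'.2.2‖ ^ 2 := by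
      have e : ‖x - x'‖ = max ‖x.1 - x'.1‖ (max ‖x.2.1 - x'.2.1‖ ‖x.2.2 - x'.2.2‖) := rfl
      have hy2 : ‖x.2.1 - x'.2.1‖ ^ 2 ≤ κ ^ 2 * ‖x.2.2 - x'.2.2‖ ^ 2 := by
        rw [← mul_pow]; gcongr
      rw [e]
      rcases max_choice ‖x.1 - x'.1‖ (max ‖x.2.1 - x'.2.1‖ ‖x.2.2 - x'.2.2‖) with h | h <;> rw [h]
      · have : 0 ≤ (1 + κ ^ 2) * ‖x.2.2 - x'.2.2‖ ^ 2 := by positivity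
        linarith
      · rcases max_choice ‖x.2.1 - x'.2.1‖ ‖x.2.2 - x'.2.2‖ with h | h <;> rw [h] <;>
          nlinarith [sq_nonneg ‖x.1 - x'.1‖, sq_nonneg ‖x.2.2 - x'.2.2‖,
            mul_nonneg (sq_nonneg κ) (sq_nonneg ‖x.2.2 - x'.2.2‖)]
    calc c * ‖x - x'‖ ^ 2 ≤ c * (‖x.1 - x'.1‖ ^ 2 + (1 + κ ^ 2) * ‖x.2.2 - x'.2.2‖ ^ 2) := by
          gcongr
      _ ≤ _ := by rw [mul_add]; exact add_le_add h1 h2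

end Data

/-! ### Optimality conditions -/

theorem nonneg_of_hasDerivAt_of_le {g : ℝ → ℝ} {g' : ℝ} (hg : HasDerivAt g g' 0)
    (hmin : ∀ t ∈ Set.Icc (0 : ℝ) 1, g 0 ≤ g t) : 0 ≤ g' := by
  have h := hg.tendsto_slope_zero_right
  refine ge_of_tendsto h ?_
  filter_upwards [Ioo_mem_nhdsGT (zero_lt_one (α := ℝ))] with t ht
  rw [zero_add, smul_eq_mul]
  exact mul_nonneg (inv_nonneg.2 ht.1.le) (sub_nonneg.2 (hmin t ⟨ht.1.le, ht.2.le⟩))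

theorem sum_coord_sub_mul {V : Type*} [NormedAddCommGroup V] [NormedSpace ℝ V]
    {ι : Type*} [Fintype ι] (b : AffineBasis ι ℝ V) (g : V →ᵃ[ℝ] ℝ) (x x' : V) :
    ∑ i, (b.coord i x - b.coord i x') * g (b i) = g x - g x' := by
  rw [affineMap_eq_sum_coord b g x, affineMap_eq_sum_coord b g x', ← Finset.sum_sub_distrib]
  simp only [sub_mul]

namespace Data

variable {l n : ℕ} {Ω : Set (Euc l)} (D : Data Ω n)

/-- `K` as a continuous linear map. -/
noncomputable def KL : Euc n →L[ℝ] Euc (n + 1) :=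
  LinearMap.toContinuousLinearMap
    { toFun := D.Kv
      map_add' := fun x y => by simp [Kv, Matrix.mulVec_add]
      map_smul' := fun c x => by simp [Kv, Matrix.mulVec_smul] }

/-- `Kᵀ` as a continuous linear map. -/
noncomputable def KTL : Euc (n + 1) →L[ℝ] Euc n :=
  LinearMap.toContinuousLinearMap
    { toFun := D.KT
      map_add' := fun x y => by simp [KT, Matrix.mulVec_add]
      map_smul' := fun c x => by simp [KT, Matrix.mulVec_smul] }

theorem KL_apply (β : Euc n) : D.KL β = D.Kv β := rfl

theorem KTL_apply (z : Euc (n + 1)) : D.KTL z = D.KT z := rfl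

theorem inner_KTL (z : Euc (n + 1)) (β : Euc n) :
    inner ℝ (D.KTL z) β = inner ℝ z (D.KL β) := by
  simp only [KTL_apply, KL_apply, KT, Kv, EuclideanSpace.inner_eq_star_dotProduct, star_trivial]
  rw [Matrix.mulVec_transpose, dotProduct_comm, ← Matrix.dotProduct_mulVec, dotProduct_comm]

/-- `B*` as a continuous linear map. -/
noncomputable def BadjL : H01 Ω →L[ℝ] L2 Ω :=
  LinearMap.mkContinuous
    { toFun := D.Badj
      map_add' := fun p p' => by simp only [Badj, map_add]
      map_smul' := fun c p => by
        simp only [Badj, map_smul, RingHom.id_apply] }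
    ‖D.B.flip‖ fun p => ((InnerProductSpace.toDual ℝ (L2 Ω)).symm.norm_map _).trans_le
      (D.B.flip.le_opNorm p)

theorem BadjL_apply (p : H01 Ω) : D.BadjL p = D.Badj p := rfl

theorem inner_BadjL (p : H01 Ω) (v : L2 Ω) : inner ℝ (D.BadjL p) v = D.B v p := by
  rw [BadjL_apply, Badj, InnerProductSpace.toDual_symm_apply]
  rfl

/-! #### The constraints of the simplex -/

/-- The `n + 1` slacks `bT - K β` are affine and describe the simplex, so the classification by
barycentric coordinates applies. `n ≥ 1` ensures at least two vertices. -/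
theorem exists_perm_constraints (hn : 1 ≤ n) (hK : D.T = {β | ∀ j, D.Kv β j ≤ D.bT j}) :
    ∃ π : Equiv.Perm (Fin (n + 1)), ∃ c : Fin (n + 1) → ℝ, (∀ j, 0 < c j) ∧
      ∀ j β, D.bT j - D.Kv β j = c j * D.vert.coord (π j) β := by
  have : Nontrivial (Fin (n + 1)) := Fin.nontrivial_iff_two_le.2 (by omega)
  let g : Fin (n + 1) → Euc n →ᵃ[ℝ] ℝ := fun j => AffineMap.const ℝ (Euc n) (D.bT j) -
    (((EuclideanSpace.proj j : Euc (n + 1) →L[ℝ] ℝ) ∘L D.KL : Euc n →L[ℝ] ℝ) :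
      Euc n →ₗ[ℝ] ℝ).toAffineMap
  have hg : ∀ j β, g j β = D.bT j - D.Kv β j := fun j β => rfl
  obtain ⟨π, c, hc, h⟩ := exists_perm_eq_mul_coord D.vert g (fun β => by
    have h1 : β ∈ D.T ↔ ∀ i, 0 ≤ D.vert.coord i β := by
      rw [T, AffineBasis.convexHull_eq_nonneg_coord]; rfl
    rw [← h1, hK]
    simp only [hg, sub_nonneg]
    rfl)
  exact ⟨π, c, hc, fun j β => by rw [← hg, h]⟩

variable {D} in
theorem inner_KTL_sub {π : Equiv.Perm (Fin (n + 1))} {c : Fin (n + 1) → ℝ}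
    (hπ : ∀ j β, D.bT j - D.Kv β j = c j * D.vert.coord (π j) β) (z : Euc (n + 1)) (x x' : Euc n) :
    inner ℝ (D.KTL z) (x - x') =
      -∑ j, z j * c j * (D.vert.coord (π j) x - D.vert.coord (π j) x') := by
  rw [inner_KTL, map_sub, PiLp.inner_apply, ← Finset.sum_neg_distrib]
  refine Finset.sum_congr rfl fun j _ => ?_
  have h1 := hπ j x
  have h2 := hπ j x'
  simp only [KL_apply, PiLp.sub_apply, RCLike.inner_apply, conj_trivial]
  have h3 : D.Kv x j - D.Kv x' j =
      -(c j * (D.vert.coord (π j) x - D.vert.coord (π j) x')) := by linarith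
  rw [h3]
  ring

/-- Any `n` rows of `K` are independent: along the edge between the vertices opposite to facets `j₀`
and `j` only these two slacks vary. Since `z j₀ = 0`, pairing `Kᵀ z` with the edge isolates `z j`.
-/
theorem eq_zero_of_KTL_eq_zero (hn : 1 ≤ n) (hK : D.T = {β | ∀ j, D.Kv β j ≤ D.bT j})
    {z : Euc (n + 1)} (hz : D.KTL z = 0) {j₀ : Fin (n + 1)} (hj₀ : z j₀ = 0) : z = 0 := by
  obtain ⟨π, c, hc, hπ⟩ := D.exists_perm_constraints hn hK
  ext j
  by_cases hj : j = j₀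
  · rw [hj, hj₀]; rfl
  have h := inner_KTL_sub hπ z (D.vert (π j)) (D.vert (π j₀))
  rw [hz, inner_zero_left, zero_eq_neg, Finset.sum_eq_single j ?_ (by simp)] at h
  · rw [D.vert.coord_apply_eq, D.vert.coord_apply_ne (fun h => hj (π.injective h)), sub_zero,
      mul_one] at h
    simpa using (mul_eq_zero.1 h).resolve_right (hc j).ne'
  · intro k _ hk
    by_cases hk0 : k = j₀
    · rw [hk0, hj₀]; simp
    · rw [D.vert.coord_apply_ne (fun h => hk (π.injective h)),
        D.vert.coord_apply_ne (fun h => hk0 (π.injective h)), sub_zero, mul_zero]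

theorem exists_norm_le_KTL (hn : 1 ≤ n) (hK : D.T = {β | ∀ j, D.Kv β j ≤ D.bT j})
    (j₀ : Fin (n + 1)) : ∃ C : ℝ, ∀ z : Euc (n + 1), ‖z‖ ≤ C * (‖D.KTL z‖ + |z j₀|) := by
  let L : Euc (n + 1) →L[ℝ] Euc n × ℝ :=
    D.KTL.prod (EuclideanSpace.proj j₀ : Euc (n + 1) →L[ℝ] ℝ)
  have hL : LinearMap.ker (L : Euc (n + 1) →ₗ[ℝ] Euc n × ℝ) = ⊥ := by
    rw [LinearMap.ker_eq_bot']
    intro z hz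
    exact D.eq_zero_of_KTL_eq_zero hn hK (congrArg Prod.fst hz) (congrArg Prod.snd hz)
  obtain ⟨C, hC0, hC⟩ := LinearMap.exists_antilipschitzWith _ hL
  refine ⟨C, fun z => ?_⟩
  have h := hC.le_mul_dist z 0
  rw [dist_zero_right, map_zero, dist_zero_right] at h
  refine h.trans ?_
  gcongr
  change max ‖D.KTL z‖ |z j₀| ≤ _
  exact max_le (le_add_of_nonneg_right (abs_nonneg _)) (le_add_of_nonneg_left (norm_nonneg _))

/-! #### The KKT system -/

theorem penaltyObjective_eq (β : Euc n) (y : H01 Ω) (u : L2 Ω) :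
    D.penaltyObjective id (β, y, u) = D.h β y + (D.σu / 2 * ‖u - D.um‖ ^ 2
      + D.γ * D.σl / 2 * ‖u‖ ^ 2) := by
  simp only [penaltyObjective, F, f, h, id_eq]
  ring

theorem gradient_β_eq {β : Euc n} (hβ : ∀ i, 0 < β i) (y : H01 Ω) (u : L2 Ω) :
    gradient (fun β => D.F β y u) β + D.γ • (gradient (fun β => D.f β y u) β - gradient D.ξ β)
      = D.gradβ (β, y) := by
  have h1 := (hasGradientAt_regularization hβ).hasFDerivAt
  have h2 := (hasGradientAt_lower (D := D) hβ y).hasFDerivAt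
  have e1 : HasGradientAt (fun β => D.F β y u)
      ((D.σβ / 2) • WithLp.toLp 2 fun i => -(2 / β i ^ 3)) β := by
    rw [hasGradientAt_iff_hasFDerivAt, map_smul]
    exact (h1.const_mul (D.σβ / 2)).const_add _
  have e2 : HasGradientAt (fun β => D.f β y u)
      (WithLp.toLp 2 fun i => -(‖D.C i y - D.yd i‖ ^ 2 / (2 * β i ^ 2))) β := by
    rw [hasGradientAt_iff_hasFDerivAt]
    exact h2.add_const _
  rw [e1.gradient, e2.gradient, (D.hasGradientAt_ξ β).gradient]
  ext i
  simp [gradβ]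
  ring

theorem fderiv_y_eq (β : Euc n) (y : H01 Ω) (u : L2 Ω) :
    fderiv ℝ (fun y => D.F β y u) y + D.γ • fderiv ℝ (fun y => D.f β y u) y
      = D.dery (β, y) := by
  have h1 := D.hasFDerivAt_lower β y
  have h2 := hasFDerivAt_norm_sub_sq (H01.toL2 (Ω := Ω)) D.ym y
  have e1 : HasFDerivAt (fun y => D.F β y u) _ y :=
    ((h2.const_mul (1 / 2)).add_const (D.σu / 2 * ‖u - D.um‖ ^ 2)).add_const
      (D.σβ / 2 * ∑ i, (1 / β i) ^ 2)
  have e2 : HasFDerivAt (fun y => D.f β y u) _ y := h1.add_const (D.σl / 2 * ‖u‖ ^ 2)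
  rw [e1.fderiv, e2.fderiv, dery, smul_smul, Finset.smul_sum]
  congr 1
  · norm_num
  · refine Finset.sum_congr rfl fun i _ => ?_
    rw [smul_smul]
    congr 1
    ring

theorem hasGradientAt_control (a b : ℝ) (u : L2 Ω) :
    HasGradientAt (fun u => a / 2 * ‖u - D.um‖ ^ 2 + b / 2 * ‖u‖ ^ 2)
      (a • (u - D.um) + b • u) u := by
  have h1 := (hasGradientAt_norm_sub_sq D.um u).hasFDerivAt
  have h2 := (hasGradientAt_norm_sub_sq 0 u).hasFDerivAt
  rw [hasGradientAt_iff_hasFDerivAt]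
  simp only [sub_zero] at h2
  refine ((h1.const_mul (a / 2)).add (h2.const_mul (b / 2))).congr_fderiv ?_
  simp only [map_add, map_smul, smul_smul]
  congr 2 <;> ring

theorem gradient_u_eq (β : Euc n) (y : H01 Ω) (u : L2 Ω) :
    gradient (fun u => D.F β y u) u + D.γ • gradient (fun u => D.f β y u) u
      = D.σhat • u - D.σu • D.um := by
  have h1 := (D.hasGradientAt_control D.σu 0 u).hasFDerivAt
  have h2 := (D.hasGradientAt_control 0 D.σl u).hasFDerivAt
  have e1 : HasGradientAt (fun u => D.F β y u) (D.σu • (u - D.um) + (0 : ℝ) • u) u := by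
    rw [hasGradientAt_iff_hasFDerivAt]
    refine (h1.const_add (1 / 2 * ‖y.toL2 - D.ym‖ ^ 2 + D.σβ / 2 * ∑ i, (1 / β i) ^ 2)
      ).congr_of_eventuallyEq (Eventually.of_forall fun u => ?_)
    simp only [F]
    ring
  have e2 : HasGradientAt (fun u => D.f β y u) ((0 : ℝ) • (u - D.um) + D.σl • u) u := by
    rw [hasGradientAt_iff_hasFDerivAt]
    refine (h2.const_add (∑ i, 1 / (2 * β i) * ‖D.C i y - D.yd i‖ ^ 2)
      ).congr_of_eventuallyEq (Eventually.of_forall fun u => ?_)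
    simp only [f]
    ring
  rw [e1.gradient, e2.gradient, σhat]
  module

variable {D} in
/-- The variational inequality in `β`. -/
theorem IsGlobalSolution.inner_gradβ_nonneg {β : Euc n} {y : H01 Ω} {u : L2 Ω}
    (hs : D.IsGlobalSolution id (β, y, u)) (hβ : ∀ i, 0 < β i) {β' : Euc n} (hβ' : β' ∈ D.T) :
    0 ≤ inner ℝ (D.gradβ (β, y)) (β' - β) := by
  have hd := HasFDerivAt.hasDerivAt_clm_line (D.hasGradientAt_h_β hβ y).hasFDerivAt (β' - β)
    (ContinuousLinearMap.id ℝ ℝ)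
  refine nonneg_of_hasDerivAt_of_le hd fun t ht => ?_
  have hT : β + t • (β' - β) ∈ D.T := (convex_convexHull ℝ _).add_smul_sub_mem hs.1.1 hβ' ht
  have h := hs.2 (β + t • (β' - β), y, u) ⟨hT, hs.1.2⟩
  rw [penaltyObjective_eq, penaltyObjective_eq] at h
  simpa using h

variable {D} in
/-- The variational inequality in `(y, u)`. -/
theorem IsGlobalSolution.dery_add_inner_nonneg {β : Euc n} {y : H01 Ω} {u : L2 Ω}
    (hs : D.IsGlobalSolution id (β, y, u)) {v : L2 Ω} (hv : v ∈ D.Uad) {w : H01 Ω}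
    (hw : D.A w = D.B (v - u)) :
    0 ≤ D.dery (β, y) w + inner ℝ (D.σhat • u - D.σu • D.um) (v - u) := by
  have h1 := HasFDerivAt.hasDerivAt_clm_line (D.hasFDerivAt_h_y β y) w
    (ContinuousLinearMap.id ℝ ℝ)
  have h2 := HasFDerivAt.hasDerivAt_clm_line
    (D.hasGradientAt_control D.σu (D.γ * D.σl) u).hasFDerivAt (v - u) (ContinuousLinearMap.id ℝ ℝ)
  have e : D.σu • (u - D.um) + (D.γ * D.σl) • u = D.σhat • u - D.σu • D.um := by
    rw [σhat]; module
  rw [e] at h2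
  refine nonneg_of_hasDerivAt_of_le (h1.add h2) fun t ht => ?_
  have hU : u + t • (v - u) ∈ D.Uad := D.convex_Uad.add_smul_sub_mem hs.1.2.2 hv ht
  have hst : D.A (y + t • w) - D.B (u + t • (v - u)) = 0 := by
    rw [map_add, map_add, map_smul, map_smul, hw, sub_eq_zero.1 hs.1.2.1, sub_self]
  have h := hs.2 (β, y + t • w, u + t • (v - u)) ⟨hs.1.1, hst, hU⟩
  rw [penaltyObjective_eq, penaltyObjective_eq] at h
  simpa using h

/-- The multiplier is explicit: `z j` is `⟨G, x - β⟩ / c j` at the vertex `x` opposite to facet `j`.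
The variational inequality at the vertices gives the sign, interpolation of the affine function `⟨G,
· - β⟩` gives stationarity, and its value zero at `β` gives complementarity. -/
theorem exists_multiplier_z (hn : 1 ≤ n) (hK : D.T = {β | ∀ j, D.Kv β j ≤ D.bT j})
    {β G : Euc n} (hG : ∀ β' ∈ D.T, 0 ≤ inner ℝ G (β' - β)) :
    ∃ z : Euc (n + 1), G + D.KT z = 0 ∧ (∀ j, 0 ≤ z j) ∧
      ∑ j, z j * (D.Kv β j - D.bT j) = 0 := by
  obtain ⟨π, c, hc, hπ⟩ := D.exists_perm_constraints hn hK
  let g : Euc n →ᵃ[ℝ] ℝ := ((innerSL ℝ G : Euc n →L[ℝ] ℝ) : Euc n →ₗ[ℝ] ℝ).toAffineMap -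
    AffineMap.const ℝ (Euc n) (inner ℝ G β)
  have hg : ∀ x, g x = inner ℝ G (x - β) := fun x => by
    rw [inner_sub_right]; rfl
  refine ⟨WithLp.toLp 2 fun j => g (D.vert (π j)) / c j, ?_, fun j => ?_, ?_⟩
  · rw [← KTL_apply]
    refine ext_inner_right ℝ fun δ => ?_
    have h1 := inner_KTL_sub hπ (WithLp.toLp 2 fun j => g (D.vert (π j)) / c j) (β + δ) β
    rw [add_sub_cancel_left] at h1
    rw [inner_add_left, h1, inner_zero_left]
    have h2 : ∀ j, g (D.vert (π j)) / c j * c j *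
        (D.vert.coord (π j) (β + δ) - D.vert.coord (π j) β) =
        (D.vert.coord (π j) (β + δ) - D.vert.coord (π j) β) * g (D.vert (π j)) := fun j => by
      rw [div_mul_cancel₀ _ (hc j).ne', mul_comm]
    simp only [h2]
    rw [Equiv.sum_comp π fun i => (D.vert.coord i (β + δ) - D.vert.coord i β) * g (D.vert i),
      sum_coord_sub_mul, hg, hg]
    simp
  · refine div_nonneg ?_ (hc j).le
    rw [hg]
    exact hG _ (subset_convexHull ℝ _ ⟨π j, rfl⟩)
  · have h2 : ∀ j, g (D.vert (π j)) / c j * (D.Kv β j - D.bT j) =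
        -(D.vert.coord (π j) β * g (D.vert (π j))) := fun j => by
      rw [← neg_sub, hπ, mul_neg, ← mul_assoc, div_mul_cancel₀ _ (hc j).ne', mul_comm]
    simp only [h2]
    rw [Equiv.sum_comp π fun i => -(D.vert.coord i β * g (D.vert i)), Finset.sum_neg_distrib,
      ← affineMap_eq_sum_coord, hg]
    simp

variable {D} in
theorem KKT.compl_apply {x : Euc n × H01 Ω × L2 Ω} {m : Euc (n + 1) × H01 Ω × L2 Ω}
    (h : D.KKT x m) (j : Fin (n + 1)) : m.1 j * (D.Kv x.1 j - D.bT j) = 0 :=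
  (Finset.sum_eq_zero_iff_of_nonpos fun k _ =>
    mul_nonpos_of_nonneg_of_nonpos (h.sign_z k) (sub_nonpos.2 (h.ineq k))).1 h.compl j
    (Finset.mem_univ j)

/-- At no point of the space all constraints of the simplex are active. -/
theorem exists_inactive (hn : 1 ≤ n) (hK : D.T = {β | ∀ j, D.Kv β j ≤ D.bT j})
    (β : Euc n) : ∃ j, D.Kv β j - D.bT j < 0 := by
  obtain ⟨π, c, hc, hπ⟩ := D.exists_perm_constraints hn hK
  obtain ⟨i, hi⟩ : ∃ i, 0 < D.vert.coord i β := by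
    by_contra hcon
    push Not at hcon
    have h1 := D.vert.sum_coord_apply_eq_one β
    have h2 := Finset.sum_nonpos fun i (_ : i ∈ Finset.univ) => hcon i
    linarith
  refine ⟨π.symm i, ?_⟩
  have h := hπ (π.symm i) β
  rw [Equiv.apply_symm_apply] at h
  linarith [mul_pos (hc (π.symm i)) hi]

theorem existsUnique_KKT (hn : 1 ≤ n) (hbox : ∀ i, 0 < D.lo i ∧ D.lo i < D.hi i)
    (hA : Function.Bijective D.A) (hTQ : D.T ⊆ D.Q) (hK : D.T = {β | ∀ j, D.Kv β j ≤ D.bT j})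
    {s : Euc n × H01 Ω × L2 Ω} (hs : D.IsGlobalSolution id s) : ∃! m, D.KKT s m := by
  obtain ⟨β, y, u⟩ := s
  have hβ : ∀ i, 0 < β i := D.pos_of_mem_Q hbox (hTQ hs.1.1)
  have hAf := bijective_flip hA
  refine existsUnique_of_exists_of_unique ?_ ?_
  · obtain ⟨z, hz, hz0, hzc⟩ := D.exists_multiplier_z hn hK
      fun β' hβ' => hs.inner_gradβ_nonneg hβ hβ'
    obtain ⟨p, hp⟩ := hAf.2 (-D.dery (β, y))
    have hineq : ∀ j, D.Kv β j ≤ D.bT j := by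
      have := hs.1.1
      rw [hK] at this
      exact this
    -- The third multiplier is read off from stationarity in `u`. Its sign condition is the
    -- variational inequality in `(y, u)` after the state direction `A⁻¹ B (v - u)` has been
    -- eliminated by the adjoint equation.
    refine ⟨(z, p, D.Badj p - (D.σhat • u - D.σu • D.um)), ?_, ?_, ?_, hs.1.2.1, hz0, hineq, hzc,
      hs.1.2.2, fun v hv => ?_⟩
    · rw [D.gradient_β_eq hβ, hz]
    · rw [D.fderiv_y_eq, Aadj, hp, add_neg_cancel]
    · rw [D.gradient_u_eq]
      change D.σhat • u - D.σu • D.um - D.Badj p +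
        (D.Badj p - (D.σhat • u - D.σu • D.um)) = 0
      abel
    · obtain ⟨w, hw⟩ := hA.2 (D.B (v - u))
      have h1 := hs.dery_add_inner_nonneg hv hw
      have h2 : D.dery (β, y) w = -inner ℝ (D.Badj p) (v - u) := by
        rw [← BadjL_apply, inner_BadjL, ← hw, ← ContinuousLinearMap.flip_apply, hp]
        simp
      rw [h2] at h1
      change inner ℝ (D.Badj p - (D.σhat • u - D.σu • D.um)) (v - u) ≤ 0
      rw [inner_sub_left]
      linarith
  · rintro ⟨z, p, ν⟩ ⟨z', p', ν'⟩ h h'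
    have hpp : p = p' := hAf.1 (add_left_cancel (h.stat_y.trans h'.stat_y.symm))
    have hνν : ν = ν' := by
      have := h.stat_u.trans h'.stat_u.symm
      simp only [hpp] at this
      exact add_left_cancel this
    have hzz : z = z' := by
      have h1 : D.KTL z = D.KTL z' := add_left_cancel (h.stat_β.trans h'.stat_β.symm)
      obtain ⟨j₀, hj₀⟩ := D.exists_inactive hn hK β
      have h2 : z j₀ = 0 := (mul_eq_zero.1 (h.compl_apply j₀)).resolve_right hj₀.ne
      have h3 : z' j₀ = 0 := (mul_eq_zero.1 (h'.compl_apply j₀)).resolve_right hj₀.ne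
      refine sub_eq_zero.1 (D.eq_zero_of_KTL_eq_zero hn hK (j₀ := j₀) ?_ ?_)
      · rw [map_sub, h1, sub_self]
      · simp [h2, h3]
    rw [hpp, hνν, hzz]

/-- The projection formula for the control. -/
theorem eq_clamp_of_normal {a b u w : L2 Ω} (hu : a ≤ u ∧ u ≤ b)
    (h : ∀ v, a ≤ v → v ≤ b → inner ℝ (w - u) (v - u) ≤ 0) : u = (w ⊔ a) ⊓ b := by
  have hab : a ≤ b := hu.1.trans hu.2
  set v := (w ⊔ a) ⊓ b with hv
  have h1 := h v (le_inf le_sup_right hab) inf_le_right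
  -- Pointwise, `v` is the projection of `w` onto `[a, b]` and `u` is admissible. With the test
  -- inequality for this `v` it forces `‖v - u‖² ≤ 0`.
  have h2 : 0 ≤ inner ℝ (w - v) (v - u) := by
    rw [L2.inner_def]
    refine integral_nonneg_of_ae ?_
    filter_upwards [(Lp.coeFn_le _ _).2 hu.1, (Lp.coeFn_le _ _).2 hu.2, Lp.coeFn_sub w v,
      Lp.coeFn_sub v u, Lp.coeFn_inf (w ⊔ a) b, Lp.coeFn_sup w a] with x k1 k2 k3 k4 k5 k6
    simp only [Pi.zero_apply, RCLike.inner_apply, conj_trivial]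
    rw [k3, k4, Pi.sub_apply, Pi.sub_apply, hv, k5, Pi.inf_apply, k6, Pi.sup_apply]
    rcases le_total (w x ⊔ a x) (b x) with e | e
    · rw [inf_eq_left.2 e]
      rcases le_total (w x) (a x) with e' | e'
      · rw [sup_eq_right.2 e']
        exact mul_nonneg_of_nonpos_of_nonpos (by linarith) (by linarith)
      · rw [sup_eq_left.2 e', sub_self, mul_zero]
    · rw [inf_eq_right.2 e]
      rcases le_sup_iff.1 e with e' | e'
      · exact mul_nonneg (by linarith) (by linarith)
      · have : b x = u x := le_antisymm (e'.trans k1) k2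
        rw [this, sub_self, zero_mul]
  have h3 : inner ℝ (w - u) (v - u) = inner ℝ (w - v) (v - u) + ‖v - u‖ ^ 2 := by
    rw [← real_inner_self_eq_norm_sq, ← inner_add_left, sub_add_sub_cancel]
  have h4 : ‖v - u‖ ^ 2 ≤ 0 := by linarith
  have h5 : ‖v - u‖ = 0 := by
    rw [← sq_eq_zero_iff]
    exact le_antisymm h4 (sq_nonneg _)
  exact (sub_eq_zero.1 (norm_eq_zero.1 h5)).symm

variable {D} in
-- Stationarity in `u` says `projArg p - u = ν / σ̂`, so the normal cone condition is the
-- variational characterization of the projection. Sign, feasibility and complementarity combine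
-- into the equation for the maximum.
theorem KKT.W_eq_zero (hσ : 0 < D.σhat) {β : Euc n} {y : H01 Ω} {u : L2 Ω} {z : Euc (n + 1)}
    {p : H01 Ω} {ν : L2 Ω} (hβ : ∀ i, 0 < β i) (h : D.KKT (β, y, u) (z, p, ν)) :
    D.W (β, y, u, z, p) = 0 := by
  refine Prod.ext ?_ (Prod.ext ?_ (Prod.ext ?_ (Prod.ext ?_ ?_)))
  · change D.hβ β y + D.KT z = 0
    rw [D.hβ_eq hβ, ← D.gradient_β_eq hβ y u]
    exact h.stat_β
  · change D.hy β y + D.Aadj p = 0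
    rw [D.hy_eq, ← D.fderiv_y_eq β y u]
    exact h.stat_y
  · change u - (D.projArg p ⊔ D.ua) ⊓ D.ub = 0
    have hu : D.ua ≤ u ∧ u ≤ D.ub := by
      have := h.control
      rwa [Uad_eq_Icc] at this
    refine sub_eq_zero.2 (eq_clamp_of_normal hu fun v hv1 hv2 => ?_)
    have h1 := h.stat_u
    simp only at h1
    rw [D.gradient_u_eq] at h1
    have h2 : D.projArg p - u = D.σhat⁻¹ • ν := by
      have : ν = D.Badj p + D.σu • D.um - D.σhat • u := by
        rw [← sub_eq_zero, ← h1]; abel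
      rw [this, projArg, smul_sub, smul_smul, inv_mul_cancel₀ hσ.ne', one_smul]
    rw [h2, inner_smul_left, conj_trivial]
    have h3 := h.normal v (by rw [Uad_eq_Icc]; exact ⟨hv1, hv2⟩)
    exact mul_nonpos_of_nonneg_of_nonpos (inv_nonneg.2 hσ.le) h3
  · change WithLp.toLp 2 (fun j => max (D.Kv β j - D.bT j) (-z j)) = 0
    ext j
    have h1 : D.Kv β j ≤ D.bT j := h.ineq j
    have h2 : 0 ≤ z j := h.sign_z j
    change max (D.Kv β j - D.bT j) (-z j) = 0
    rcases mul_eq_zero.1 (h.compl_apply j) with h3 | h3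
    · have h3' : z j = 0 := h3
      rw [h3', neg_zero]
      exact max_eq_right (by linarith)
    · have h3' : D.Kv β j - D.bT j = 0 := h3
      rw [h3']
      exact max_eq_left (by linarith)
  · exact h.state

end Data

/-! ### Semismooth Newton method -/

theorem saddleOp_add {k m : ℕ} {Y U : Type*} [NormedAddCommGroup Y] [InnerProductSpace ℝ Y]
    [NormedAddCommGroup U] [InnerProductSpace ℝ U]
    (A : Y →L[ℝ] StrongDual ℝ Y) (B : U →L[ℝ] StrongDual ℝ Y) (Bt : Y →L[ℝ] U)
    (K : Euc k →L[ℝ] Euc m) (Kt : Euc m →L[ℝ] Euc k) (κ : ℝ)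
    (H₁ : Euc k × Y →L[ℝ] Euc k) (H₂ : Euc k × Y →L[ℝ] StrongDual ℝ Y)
    (χ : U →L[ℝ] U) (I : Fin m → Prop) [DecidablePred I] (s t : Euc k × Y × U × Euc m × Y) :
    saddleOp A B Bt K Kt κ H₁ H₂ χ I (s + t) =
      saddleOp A B Bt K Kt κ H₁ H₂ χ I s + saddleOp A B Bt K Kt κ H₁ H₂ χ I t := by
  obtain ⟨δ, y, u, z, p⟩ := s
  obtain ⟨δ', y', u', z', p'⟩ := t
  have hpair : (δ + δ', y + y') = (δ, y) + (δ', y') := rfl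
  refine Prod.ext ?_ (Prod.ext ?_ (Prod.ext ?_ (Prod.ext ?_ ?_)))
  · change H₁ (δ + δ', y + y') + Kt (z + z') = H₁ (δ, y) + Kt z + (H₁ (δ', y') + Kt z')
    rw [hpair, map_add, map_add]; abel
  · change H₂ (δ + δ', y + y') + A.flip (p + p') =
      H₂ (δ, y) + A.flip p + (H₂ (δ', y') + A.flip p')
    rw [hpair, map_add, map_add]; abel
  · change u + u' - κ⁻¹ • χ (Bt (p + p')) = u - κ⁻¹ • χ (Bt p) + (u' - κ⁻¹ • χ (Bt p'))
    rw [map_add, map_add, smul_add]; abel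
  · ext j
    change (if I j then K (δ + δ') j else -(z + z') j) =
      (if I j then K δ j else -z j) + (if I j then K δ' j else -z' j)
    split_ifs
    · rw [map_add]; rfl
    · rw [PiLp.add_apply, neg_add]
  · change A (y + y') - B (u + u') = A y - B u + (A y' - B u')
    rw [map_add, map_add]; abel

/-- The Newton remainder of a `C²` map. -/
theorem newton_remainder_isLittleO {E F : Type*} [NormedAddCommGroup E] [NormedSpace ℝ E]
    [NormedAddCommGroup F] [NormedSpace ℝ F] {G : E → F} {wbar : E} (hG : ContDiffAt ℝ 2 G wbar) :
    (fun w => G w - G wbar - fderiv ℝ G w (w - wbar)) =o[𝓝 wbar] fun w => w - wbar := by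
  have h1 : (fun w => G w - G wbar - fderiv ℝ G wbar (w - wbar)) =o[𝓝 wbar] fun w => w - wbar :=
    (hG.differentiableAt (by simp)).hasFDerivAt.isLittleO
  have hcont : ContinuousAt (fderiv ℝ G) wbar :=
    (hG.fderiv_right (m := 1) (by norm_num)).continuousAt
  have h2 : (fun w => (fderiv ℝ G wbar - fderiv ℝ G w) (w - wbar)) =o[𝓝 wbar]
      fun w => w - wbar := by
    rw [isLittleO_iff]
    intro ε hε
    have h3 : Tendsto (fun w => ‖fderiv ℝ G wbar - fderiv ℝ G w‖) (𝓝 wbar) (𝓝 0) := by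
      have := (tendsto_const_nhds (x := fderiv ℝ G wbar)).sub hcont.tendsto
      simpa using this.norm
    filter_upwards [h3.eventually (ge_mem_nhds hε)] with w hw
    exact ((fderiv ℝ G wbar - fderiv ℝ G w).le_opNorm _).trans (by gcongr)
  refine (h1.add h2).congr_left fun w => ?_
  rw [sub_apply]
  abel

/-- The linearization error of the complementarity function `max` vanishes near a zero. -/
theorem eventually_max_remainder_eq_zero {a₀ c₀ : ℝ} (h : max a₀ c₀ = 0) :
    ∀ᶠ t : ℝ × ℝ in 𝓝 (a₀, c₀),
      max t.1 t.2 - (if t.2 ≤ t.1 then t.1 - a₀ else t.2 - c₀) = 0 := by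
  have h1 : Tendsto (fun t : ℝ × ℝ => t.1) (𝓝 (a₀, c₀)) (𝓝 a₀) := continuous_fst.tendsto _
  have h2 : Tendsto (fun t : ℝ × ℝ => t.2) (𝓝 (a₀, c₀)) (𝓝 c₀) := continuous_snd.tendsto _
  rcases lt_trichotomy a₀ c₀ with hac | hac | hac
  -- If the two entries differ, the selected branch is constant nearby; if they agree, both are zero
  -- and either branch is exact.
  · rw [max_eq_right hac.le] at h
    filter_upwards [h1.eventually_lt h2 hac] with t ht
    rw [if_neg (not_le.2 ht), max_eq_right ht.le, h]; ring
  · rw [hac, max_self] at h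
    refine Eventually.of_forall fun t => ?_
    rw [hac, h]
    split_ifs with ht
    · rw [max_eq_left ht]; ring
    · rw [max_eq_right (not_le.1 ht).le]; ring
  · rw [max_eq_left hac.le] at h
    filter_upwards [h2.eventually_lt h1 hac] with t ht
    rw [if_pos ht.le, max_eq_left ht.le, h]; ring

namespace Data

variable {l n : ℕ} {Ω : Set (Euc l)} (D : Data Ω n)

theorem σhat_pos (hσu : 0 < D.σu) (hσl : 0 < D.σl) (hγ : 0 < D.γ) : 0 < D.σhat :=
  add_pos hσu (mul_pos hγ hσl)

open Classical in
/-- The Newton derivative at `x` in the form of a saddle point operator. -/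
noncomputable def newtonOp (x : X Ω n) : X Ω n → Z Ω n :=
  saddleOp D.A D.B D.BadjL D.KL D.KTL D.σhat (D.H₁ (x.1, x.2.1)) (D.H₂ (x.1, x.2.1))
    (cutoff (volume.restrict Ω) (D.measurableSet_A3 x.2.2.2.2))
    (fun j => -x.2.2.2.1 j ≤ D.Kv x.1 j - D.bT j)

theorem W'_eq_newtonOp {x : X Ω n} (hx : x ∈ dom (Ω := Ω) (n := n)) : D.W' x = D.newtonOp x := by
  obtain ⟨β, y, u, z, p⟩ := x
  funext s
  obtain ⟨dβ, dy, du, dz, dp⟩ := s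
  refine Prod.ext ?_ (Prod.ext ?_ (Prod.ext rfl (Prod.ext ?_ rfl)))
  · change D.hββ β y dβ + D.hβy β y dy + D.KT dz = D.H₁ (β, y) (dβ, dy) + D.KTL dz
    rw [D.H₁_apply hx]; rfl
  · change D.hyβ β y dβ + D.hyy β y dy + D.Aadj dp = D.H₂ (β, y) (dβ, dy) + D.A.flip dp
    rw [D.H₂_apply hx]; rfl
  · ext j
    by_cases hj : -z j ≤ D.Kv β j - D.bT j
    · exact (if_pos hj).trans (if_pos hj).symm
    · exact (if_neg hj).trans (if_neg hj).symm

theorem dom_mem_nhds {x : X Ω n} (hx : x ∈ dom (Ω := Ω) (n := n)) :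
    ∀ᶠ x' in 𝓝 x, x' ∈ dom (Ω := Ω) (n := n) :=
  (isOpen_pos.preimage continuous_fst).mem_nhds hx

/-- The a priori bound uses only bounds on `H₁`, `H₂` and `β` and one inactive index. These persist
near `x` by continuity and strictness, whereas the other active sets and `𝒜₃` may vary freely. -/
theorem eventually_newtonOp_invertible (hn : 1 ≤ n) (hσ : 0 < D.σhat) (hσβ : 0 < D.σβ)
    (hγ : 0 < D.γ) (hA : Function.Bijective D.A)
    (hK : D.T = {β | ∀ j, D.Kv β j ≤ D.bT j}) {x : X Ω n} (hx : x ∈ dom (Ω := Ω) (n := n))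
    {j₀ : Fin (n + 1)} (hj₀ : D.Kv x.1 j₀ - D.bT j₀ < -x.2.2.2.1 j₀) :
    ∃ C : ℝ, ∀ᶠ x' in 𝓝 x, Function.Bijective (D.newtonOp x') ∧
      ∀ s, ‖s‖ ≤ C * ‖D.newtonOp x' s‖ := by
  classical
  set w : Euc n × H01 Ω := (x.1, x.2.1) with hw
  obtain ⟨R, hR0, hR⟩ : ∃ R : ℝ, 0 < R ∧ ∀ i, x.1 i < R := by
    refine ⟨‖x.1‖ + 1, by positivity, fun i => ?_⟩
    have := (le_abs_self _).trans (PiLp.norm_apply_le x.1 i)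
    linarith
  obtain ⟨CK, hCK⟩ := D.exists_norm_le_KTL hn hK j₀
  have hAf := bijective_flip hA
  have hc : 0 < 3 * D.σβ / R ^ 4 := by positivity
  obtain ⟨C, hC⟩ := saddleOp_bound hA hAf D.inner_BadjL D.inner_KTL (κ := D.σhat)
    (M := max ‖D.H₁ w‖ ‖D.H₂ w‖ + 1) hσ hc j₀ hCK
  refine ⟨C, ?_⟩
  have hproj : Tendsto (fun x' : X Ω n => (x'.1, x'.2.1)) (𝓝 x) (𝓝 w) :=
    (continuous_fst.prodMk (continuous_fst.comp continuous_snd)).tendsto x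
  have hH₁ : ∀ᶠ x' in 𝓝 x, ‖D.H₁ (x'.1, x'.2.1)‖ < max ‖D.H₁ w‖ ‖D.H₂ w‖ + 1 := by
    have : ContinuousAt D.H₁ w :=
      ((D.contDiffAt_gradβ (w := w) hx).fderiv_right (m := 1) (by norm_num)).continuousAt
    exact (Tendsto.norm (E := Euc n × H01 Ω →L[ℝ] Euc n) (this.tendsto.comp hproj)).eventually
      (gt_mem_nhds ((le_max_left _ _).trans_lt (lt_add_one _)))
  have hH₂ : ∀ᶠ x' in 𝓝 x, ‖D.H₂ (x'.1, x'.2.1)‖ < max ‖D.H₁ w‖ ‖D.H₂ w‖ + 1 := by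
    have : ContinuousAt D.H₂ w :=
      ((D.contDiffAt_dery (w := w) hx).fderiv_right (m := 1) (by norm_num)).continuousAt
    exact (Tendsto.norm (E := Euc n × H01 Ω →L[ℝ] Hm1 Ω) (this.tendsto.comp hproj)).eventually
      (gt_mem_nhds ((le_max_right _ _).trans_lt (lt_add_one _)))
  have hRev : ∀ᶠ x' : X Ω n in 𝓝 x, ∀ i, x'.1 i < R := by
    refine eventually_all.2 fun i => ?_
    have : Continuous fun x' : X Ω n => x'.1 i := by fun_prop
    exact (this.tendsto x).eventually (gt_mem_nhds (hR i))
  have hjev : ∀ᶠ x' : X Ω n in 𝓝 x, ¬ (-x'.2.2.2.1 j₀ ≤ D.Kv x'.1 j₀ - D.bT j₀) := by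
    have h1 : Continuous fun x' : X Ω n => D.KL x'.1 j₀ - D.bT j₀ := by fun_prop
    have h2 : Continuous fun x' : X Ω n => -x'.2.2.2.1 j₀ := by fun_prop
    exact ((h1.tendsto x).eventually_lt (h2.tendsto x) hj₀).mono fun x' h => not_le.2 h
  filter_upwards [dom_mem_nhds hx, hH₁, hH₂, hRev, hjev] with x' hx' h1 h2 h3 h4
  have hen := D.energy_ge hγ hσβ (w := (x'.1, x'.2.1)) hx' (fun i => (h3 i).le)
  have hb := hC (D.H₁ (x'.1, x'.2.1)) (D.H₂ (x'.1, x'.2.1))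
    (cutoff (volume.restrict Ω) (D.measurableSet_A3 x'.2.2.2.2))
    (fun j => -x'.2.2.2.1 j ≤ D.Kv x'.1 j - D.bT j) h1.le h2.le hen (inner_cutoff _)
    (cutoff_cutoff _) h4
  refine ⟨⟨?_, ?_⟩, hb⟩
  · intro s t hst
    have hsub : D.newtonOp x' (s - t) = 0 := by
      have h := saddleOp_add D.A D.B D.BadjL D.KL D.KTL D.σhat (D.H₁ (x'.1, x'.2.1))
        (D.H₂ (x'.1, x'.2.1)) (cutoff (volume.restrict Ω) (D.measurableSet_A3 x'.2.2.2.2))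
        (fun j => -x'.2.2.2.1 j ≤ D.Kv x'.1 j - D.bT j) (s - t) t
      rw [sub_add_cancel] at h
      exact right_eq_add.1 (hst.symm.trans h)
    have h := hb (s - t)
    change ‖s - t‖ ≤ C * ‖D.newtonOp x' (s - t)‖ at h
    rw [hsub, norm_zero, mul_zero] at h
    exact sub_eq_zero.1 (norm_le_zero_iff.1 h)
  · exact saddleOp_surjective hA hAf D.inner_BadjL D.inner_KTL hσ hc j₀ hCK hen (inner_cutoff _)
      (cutoff_cutoff _) h4

theorem newtonOp_add (x s t : X Ω n) :
    D.newtonOp x (s + t) = D.newtonOp x s + D.newtonOp x t :=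
  saddleOp_add _ _ _ _ _ _ _ _ _ _ _ _

/-- Semismoothness of the projection formula. -/
theorem projection_isLittleO (hΩb : Bornology.IsBounded Ω) (hσ : 0 < D.σhat)
    (hUad : D.Uad.Nonempty) {q : ℝ≥0∞} [Fact (1 ≤ q)] (hq2 : q < 2)
    (Bq : Lp ℝ q (volume.restrict Ω) →L[ℝ] Hm1 Ω)
    (hBq : ∀ (v : Lp ℝ q (volume.restrict Ω)) (w : L2 Ω),
      (∀ᵐ x ∂(volume.restrict Ω), v x = w x) → Bq v = D.B w) (pbar : H01 Ω) :
    (fun p => (D.projArg p ⊔ D.ua) ⊓ D.ub - (D.projArg pbar ⊔ D.ua) ⊓ D.ub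
      - D.σhat⁻¹ • cutoff (volume.restrict Ω) (D.measurableSet_A3 p) (D.BadjL (p - pbar)))
      =o[𝓝 pbar] fun p => p - pbar := by
  have : IsFiniteMeasure (volume.restrict Ω) := ⟨by
    rw [Measure.restrict_apply_univ]; exact hΩb.measure_lt_top⟩
  have hab : ∀ᵐ x ∂(volume.restrict Ω), D.ua x ≤ D.ub x := by
    obtain ⟨v, hv⟩ := hUad
    have hv' : ∀ᵐ x ∂(volume.restrict Ω), D.ua x ≤ v x ∧ v x ≤ D.ub x := hv
    exact hv'.mono fun x h => h.1.trans h.2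
  have hq0 : 0 < q.toReal := ENNReal.toReal_pos
    (zero_lt_one.trans_le (Fact.out : 1 ≤ q)).ne' hq2.ne_top
  -- This positive exponent is the norm gap; it would be zero for `q = 2`.
  have hs : 0 < 1 / q.toReal - 1 / 2 := by
    have h2 : q.toReal < 2 := by
      simpa using (ENNReal.toReal_lt_toReal hq2.ne_top (by simp)).2 hq2
    rw [sub_pos]
    exact one_div_lt_one_div_of_lt hq0 h2
  have hgap : ∀ (p : H01 Ω) {E : Set (Euc l)} (hE : MeasurableSet E),
      ‖cutoff (volume.restrict Ω) hE ((D.σhat⁻¹ • D.BadjL) p)‖ ≤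
        D.σhat⁻¹ * ‖Bq‖ * ((volume.restrict Ω) E).toReal ^ (1 / q.toReal - 1 / 2) * ‖p‖ := by
    intro p E hE
    rw [smul_apply, map_smul, norm_smul, Real.norm_of_nonneg (inv_nonneg.2 hσ.le),
      mul_assoc, mul_assoc, ← mul_assoc ‖Bq‖]
    gcongr
    exact norm_cutoff_le_of_extension hq2.le D.B Bq hBq D.BadjL D.inner_BadjL p hE
  have hw : ∀ p, D.projArg p = D.projArg pbar + (D.σhat⁻¹ • D.BadjL) (p - pbar) := by
    intro p
    rw [smul_apply, map_sub, BadjL_apply, BadjL_apply, projArg, projArg]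
    module
  refine (clamp_isLittleO hab (D.σhat⁻¹ • D.BadjL) hs hgap D.projArg pbar hw
    D.measurableSet_A3).congr_left fun p => ?_
  rw [smul_apply, map_smul]
  rfl

theorem newton_isLittleO (hΩb : Bornology.IsBounded Ω) (hσ : 0 < D.σhat)
    (hUad : D.Uad.Nonempty) {q : ℝ≥0∞} [Fact (1 ≤ q)] (hq2 : q < 2)
    (Bq : Lp ℝ q (volume.restrict Ω) →L[ℝ] Hm1 Ω)
    (hBq : ∀ (v : Lp ℝ q (volume.restrict Ω)) (w : L2 Ω),
      (∀ᵐ x ∂(volume.restrict Ω), v x = w x) → Bq v = D.B w) {xb : X Ω n}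
    (hxb : xb ∈ dom (Ω := Ω) (n := n)) (hW : D.W xb = 0) :
    (fun x => D.W x - D.newtonOp x (x - xb)) =o[𝓝 xb] fun x => x - xb := by
  obtain ⟨βb, yb, ub, zb, pb⟩ := xb
  have hβb : ∀ i, 0 < βb i := hxb
  have w1 : D.gradβ (βb, yb) + D.KT zb = 0 := by
    rw [← D.hβ_eq hβb]; exact congrArg Prod.fst hW
  have w2 : D.dery (βb, yb) + D.Aadj pb = 0 := by
    rw [← D.hy_eq]; exact congrArg (fun r : Z Ω n => r.2.1) hW
  have w3 : ub - (D.projArg pb ⊔ D.ua) ⊓ D.ub = 0 := congrArg (fun r : Z Ω n => r.2.2.1) hW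
  have w4 : ∀ j, max (D.Kv βb j - D.bT j) (-zb j) = 0 := fun j =>
    congrArg (fun r : Z Ω n => r.2.2.2.1 j) hW
  have w5 : D.A yb - D.B ub = 0 := congrArg (fun r : Z Ω n => r.2.2.2.2) hW
  have hproj : Tendsto (fun x : X Ω n => (x.1, x.2.1)) (𝓝 (βb, yb, ub, zb, pb)) (𝓝 (βb, yb)) :=
    (continuous_fst.prodMk (continuous_fst.comp continuous_snd)).tendsto (βb, yb, ub, zb, pb)
  have hprojp : Tendsto (fun x : X Ω n => x.2.2.2.2) (𝓝 (βb, yb, ub, zb, pb)) (𝓝 pb) :=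
    (continuous_snd.comp (continuous_snd.comp (continuous_snd.comp continuous_snd))).tendsto
      (βb, yb, ub, zb, pb)
  have hO : (fun x : X Ω n => (x.1, x.2.1) - (βb, yb)) =O[𝓝 (βb, yb, ub, zb, pb)]
      fun x => x - (βb, yb, ub, zb, pb) := by
    refine IsBigO.of_bound 1 (Eventually.of_forall fun x => ?_)
    rw [one_mul]
    exact max_le (norm_fst_le (x - (βb, yb, ub, zb, pb)))
      ((norm_fst_le _).trans (norm_snd_le (x - (βb, yb, ub, zb, pb))))
  have hOp : (fun x : X Ω n => x.2.2.2.2 - pb) =O[𝓝 (βb, yb, ub, zb, pb)]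
      fun x => x - (βb, yb, ub, zb, pb) := by
    refine IsBigO.of_bound 1 (Eventually.of_forall fun x => ?_)
    rw [one_mul]
    exact (norm_snd_le _).trans ((norm_snd_le _).trans ((norm_snd_le _).trans
      (norm_snd_le (x - (βb, yb, ub, zb, pb)))))
  have r1 := ((newton_remainder_isLittleO (D.contDiffAt_gradβ (w := (βb, yb)) hβb)).comp_tendsto
    hproj).trans_isBigO hO
  have r2 := ((newton_remainder_isLittleO (D.contDiffAt_dery (w := (βb, yb)) hβb)).comp_tendsto
    hproj).trans_isBigO hO
  have r3 := (((D.projection_isLittleO hΩb hσ hUad hq2 Bq hBq pb).comp_tendsto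
    hprojp).trans_isBigO hOp).neg_left
  have r4 : ∀ᶠ x : X Ω n in 𝓝 (βb, yb, ub, zb, pb), ∀ j, max (D.Kv x.1 j - D.bT j) (-x.2.2.2.1 j) -
      (if -x.2.2.2.1 j ≤ D.Kv x.1 j - D.bT j then D.Kv x.1 j - D.bT j - (D.Kv βb j - D.bT j)
        else -x.2.2.2.1 j - -zb j) = 0 := by
    refine eventually_all.2 fun j => ?_
    have h1 : Continuous fun x : X Ω n => (D.KL x.1 j - D.bT j, -x.2.2.2.1 j) := by fun_prop
    exact (h1.tendsto (βb, yb, ub, zb, pb)).eventually (eventually_max_remainder_eq_zero (w4 j))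
  -- Two components of the remainder vanish near the zero: the complementarity row, where the
  -- selected branch is exact, and the state row, which is linear.
  refine IsLittleO.congr' (f₁ := fun x : X Ω n => ((_, _, _, 0, 0) : Z Ω n))
    (r1.prod_left (r2.prod_left (r3.prod_left ((isLittleO_zero _ _).prod_left
      (isLittleO_zero _ _))))) ?_ EventuallyEq.rfl
  filter_upwards [r4, dom_mem_nhds hxb] with x hx4 hxd
  obtain ⟨β, y, u, z, p⟩ := x
  refine Prod.ext ?_ (Prod.ext ?_ (Prod.ext ?_ (Prod.ext ?_ ?_)))
  · change D.gradβ (β, y) - D.gradβ (βb, yb) - D.H₁ (β, y) (β - βb, y - yb) =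
      D.hβ β y + D.KT z - (D.H₁ (β, y) (β - βb, y - yb) + D.KTL (z - zb))
    rw [D.hβ_eq hxd, map_sub, KTL_apply, KTL_apply, eq_neg_of_add_eq_zero_left w1]
    abel
  · change D.dery (β, y) - D.dery (βb, yb) - D.H₂ (β, y) (β - βb, y - yb) =
      D.hy β y + D.Aadj p - (D.H₂ (β, y) (β - βb, y - yb) + D.Aadj (p - pb))
    rw [D.hy_eq, map_sub, eq_neg_of_add_eq_zero_left w2]
    abel
  · change -((D.projArg p ⊔ D.ua) ⊓ D.ub - (D.projArg pb ⊔ D.ua) ⊓ D.ub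
      - D.σhat⁻¹ • cutoff (volume.restrict Ω) (D.measurableSet_A3 p) (D.BadjL (p - pb))) =
      u - (D.projArg p ⊔ D.ua) ⊓ D.ub - (u - ub
        - D.σhat⁻¹ • cutoff (volume.restrict Ω) (D.measurableSet_A3 p) (D.BadjL (p - pb)))
    rw [← sub_eq_zero.1 w3]
    abel
  · ext j
    refine (hx4 j).symm.trans ?_
    change _ = max (D.Kv β j - D.bT j) (-z j) -
      (if -z j ≤ D.Kv β j - D.bT j then D.KL (β - βb) j else -(z - zb) j)
    congr 1
    by_cases hj : -z j ≤ D.Kv β j - D.bT j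
    · rw [if_pos hj, if_pos hj, map_sub, KL_apply, KL_apply, PiLp.sub_apply, sub_sub_sub_cancel_right]
    · rw [if_neg hj, if_neg hj, PiLp.sub_apply]
      ring
  · change 0 = D.A y - D.B u - (D.A (y - yb) - D.B (u - ub))
    rw [map_sub, map_sub, sub_sub_sub_comm, sub_sub_cancel, sub_sub_cancel, w5]

theorem newtonConverges (hn : 1 ≤ n) (hΩb : Bornology.IsBounded Ω) (hσ : 0 < D.σhat)
    (hσβ : 0 < D.σβ) (hγ : 0 < D.γ) (hA : Function.Bijective D.A)
    (hK : D.T = {β | ∀ j, D.Kv β j ≤ D.bT j})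
    (hUad : D.Uad.Nonempty) {q : ℝ≥0∞} [Fact (1 ≤ q)] (hq2 : q < 2)
    (Bq : Lp ℝ q (volume.restrict Ω) →L[ℝ] Hm1 Ω)
    (hBq : ∀ (v : Lp ℝ q (volume.restrict Ω)) (w : L2 Ω),
      (∀ᵐ x ∂(volume.restrict Ω), v x = w x) → Bq v = D.B w) {xb : X Ω n}
    (hxb : xb ∈ dom (Ω := Ω) (n := n)) (hW : D.W xb = 0) :
    ∃ N ∈ 𝓝 xb, ∀ x₀ ∈ N, NewtonConverges D x₀ xb := by
  obtain ⟨j₀, hj₀⟩ := D.exists_inactive hn hK xb.1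
  -- The maximum is zero and the slack entry is negative, so the maximum is attained by `-z j₀`
  -- alone. This strictness keeps `j₀` inactive in a neighborhood.
  have hj₀' : D.Kv xb.1 j₀ - D.bT j₀ < -xb.2.2.2.1 j₀ := by
    have h : max (D.Kv xb.1 j₀ - D.bT j₀) (-xb.2.2.2.1 j₀) = 0 :=
      congrArg (fun r : Z Ω n => r.2.2.2.1 j₀) hW
    rcases max_choice (D.Kv xb.1 j₀ - D.bT j₀) (-xb.2.2.2.1 j₀) with h1 | h1
    · exact absurd (h1.symm.trans h) hj₀.ne
    · rwa [← h1, h]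
  obtain ⟨C, hC⟩ := D.eventually_newtonOp_invertible hn hσ hσβ hγ hA hK hxb hj₀'
  have hdom := dom_mem_nhds hxb
  obtain ⟨N, hN, hconv⟩ := newton_superlinear (W := D.W) (W' := D.W') (C := C) hdom
    (by
      filter_upwards [hdom] with x hx s t
      rw [D.W'_eq_newtonOp hx, D.newtonOp_add])
    (by
      filter_upwards [hdom, hC] with x hx h
      rw [D.W'_eq_newtonOp hx]; exact h.1)
    (by
      filter_upwards [hdom, hC] with x hx h
      rw [D.W'_eq_newtonOp hx]; exact h.2)
    ((D.newton_isLittleO hΩb hσ hUad hq2 Bq hBq hxb hW).congr' (by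
      filter_upwards [hdom] with x hx
      rw [D.W'_eq_newtonOp hx]) EventuallyEq.rfl)
  refine ⟨N, hN, fun x₀ hx₀ => ?_⟩
  obtain ⟨x, hx0, h | h⟩ := hconv x₀ hx₀
  · obtain ⟨i, h1, h2, h3⟩ := h
    exact ⟨x, hx0, Or.inl ⟨i, fun j hj => ⟨(h1 j hj).1, (h1 j hj).2.1, (h1 j hj).2.2⟩, h2, h3⟩⟩
  · exact ⟨x, hx0, Or.inr ⟨fun j => ⟨(h.1 j).1, (h.1 j).2.1, (h.1 j).2.2⟩, h.2⟩⟩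

end Data

end ParamId

/-! ### The main theorem. -/

theorem mainTheorem4 {l n : ℕ} (hn : 1 ≤ n)
    (Ω : Set (ParamId.Euc l)) (hΩ : IsOpen Ω) (hΩb : Bornology.IsBounded Ω)
    (D : ParamId.Data Ω n)
    (hσu : 0 < D.σu) (hσl : 0 < D.σl) (hσβ : 0 < D.σβ) (hγ : 0 < D.γ)
    (hbox : ∀ i, 0 < D.lo i ∧ D.lo i < D.hi i)
    (hUad : D.Uad.Nonempty)
    (hA : Function.Bijective D.A)
    (q q' : ℝ≥0∞) [Fact (1 ≤ q)] (hq1 : 1 < q) (hq2 : q < 2) (hqq' : 1 / q + 1 / q' = 1)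
    (Bq : Lp ℝ q (volume.restrict Ω) →L[ℝ] ParamId.Hm1 Ω)
    (hBq : ∀ (v : Lp ℝ q (volume.restrict Ω)) (w : ParamId.L2 Ω),
      (∀ᵐ x ∂(volume.restrict Ω), v x = w x) → Bq v = D.B w)
    (hum : MemLp D.um q' (volume.restrict Ω))
    (hua : MemLp D.ua q' (volume.restrict Ω))
    (hub : MemLp D.ub q' (volume.restrict Ω))
    (hTQ : D.T ⊆ D.Q)
    (hK : D.T = {β | ∀ j, D.Kv β j ≤ D.bT j}) :
    (∃! s, D.IsGlobalSolution id s) ∧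
    ∀ s, D.IsGlobalSolution id s →
      (∃! m, D.KKT s m) ∧
      ∀ m, D.KKT s m →
        ∃ N ∈ 𝓝 ((s.1, s.2.1, s.2.2, m.1, m.2.1) : ParamId.X Ω n),
          ∀ x₀ ∈ N, ParamId.NewtonConverges D x₀ (s.1, s.2.1, s.2.2, m.1, m.2.1) := by
  refine ⟨D.existsUnique_isGlobalSolution hσu hσl hσβ hγ hbox hUad hA hTQ, fun s hs =>
    ⟨D.existsUnique_KKT hn hbox hA hTQ hK hs, fun m hm => ?_⟩⟩
  have hσ := D.σhat_pos hσu hσl hγ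
  have hβ : ∀ i, 0 < s.1 i := D.pos_of_mem_Q hbox (hTQ hs.1.1)
  exact D.newtonConverges hn hΩb hσ hσβ hγ hA hK hUad hq2 Bq hBq hβ (hm.W_eq_zero hσ hβ)
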